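/- Let $c\ge 2$ and consider the planar system $$\dot u=v,\qquad \dot v=-cv-u(1-u),$$ which has a saddle point at $(1,0)$ and an attracting node at $(0,0)$. Let $h^c:[0,1]\to\mathbb R$ be a function whose graph $H_c=\{(u,h^c(u)):u\in[0,1]\}$ is the heteroclinic orbit of the system that tends to $(1,0)$ as time tends to $-\infty$ (so that it is an unstable separatrix of the saddle) and to $(0,0)$ as time tends to $+\infty$, together with these two critical points. Then $h^c$ is (one-sidedly) analytic at $u=1$. For $n\ge 1$ let $h^c_n$ be its Taylor polynomial of degree $n$ at $u=1$. Let $r=\tfrac12\left(\sqrt{c^2+4}-c\right)$, that is, $r>0$ and $c=\tfrac1r-r$. For $1\le m\le 10$ let $P_m=A_m/C_m$ be the Padé approximant of order $(m,m)$ at $u=1$ of the function $h^c_{22}(u)/\bigl(r\,u(u-1)\bigr)$ (that is, $A_m$ and $C_m$ are polynomials of degree at most $m$ with $C_m(1)\neq0$, and the Taylor expansions of the two functions in powers of $u-1$ agree up to order $2m$), and put $$R^c_m(u)=r\,u(u-1)\,\frac{A_m(u)}{C_m(u)}.$$ Then these Padé approximants exist; the numerator $r\,u(u-1)A_m(u)$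 has degree exactly $m+2$, the denominator $C_m$ has degree exactly $m$, they have no common factor, and $C_m$ has no zero in $[0,1]$. Moreover, for every $u\in(0,1)$, $$h^c_2(u)<h^c_3(u)<\cdots<h^c_{100}(u)<h^c(u)<R^c_{10}(u)<R^c_9(u)<\cdots<R^c_1(u).$$ -/

import Mathlib

open Set Filter Topology Polynomial

noncomputable section

/-- `(u, v)` is a solution, defined for all times, of the planar system
`u' = v`, `v' = -c v - u (1 - u)` (the travelling wave system of the classical
Fisher–Kolmogorov equation). -/
def IsFisherSolution (c : ℝ) (u v : ℝ → ℝ) : Prop :=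
  ∀ s : ℝ, HasDerivAt u (v s) s ∧ HasDerivAt v (-c * v s - u s * (1 - u s)) s

/-- `(u, v)` is a heteroclinic solution: it leaves the saddle point `(1, 0)` (along its unstable
separatrix) at time `-∞` and reaches the origin at time `+∞`. -/
def IsFisherHeteroclinic (c : ℝ) (u v : ℝ → ℝ) : Prop :=
  IsFisherSolution c u v ∧
    Tendsto (fun s => (u s, v s)) atBot (𝓝 ((1 : ℝ), (0 : ℝ))) ∧
    Tendsto (fun s => (u s, v s)) atTop (𝓝 ((0 : ℝ), (0 : ℝ)))

/-- The graph `{(x, h x) | x ∈ [0, 1]}` is the heteroclinic orbit together with the two critical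
points that it connects. Only the values of `h` on `[0, 1]` matter. -/
def IsHeteroclinicGraph (c : ℝ) (h : ℝ → ℝ) : Prop :=
  ∃ u v : ℝ → ℝ, IsFisherHeteroclinic c u v ∧
    (fun x : ℝ => (x, h x)) '' Icc (0 : ℝ) 1 =
      range (fun s => (u s, v s)) ∪ {((0 : ℝ), (0 : ℝ)), ((1 : ℝ), (0 : ℝ))}

/-- The Taylor polynomial of degree `n` at `u = 1` (one-sided derivatives, from inside `[0, 1]`) of
the function `h` whose graph is the separatrix. -/
def separatrixTaylor (h : ℝ → ℝ) (n : ℕ) (u : ℝ) : ℝ :=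
  taylorWithinEval h n (Icc (0 : ℝ) 1) 1 u

/-- The unstable eigenvalue `r > 0` of the saddle point `(1, 0)`, i.e. the positive number with
`c = 1 / r - r`. -/
def saddleRate (c : ℝ) : ℝ := (Real.sqrt (c ^ 2 + 4) - c) / 2

/-- `p / q` is the Padé approximant of order `(m, n)` of `F` at the point `a`: `deg p ≤ m`,
`deg q ≤ n`, `q a ≠ 0`, and `p / q` has the same Taylor expansion at `a` as `F` up to order `m + n`.
A punctured neighbourhood is used since `F` may be given by an expression with a removable
singularity at `a`. -/
def IsPadeApproximant (F : ℝ → ℝ) (a : ℝ) (m n : ℕ) (p q : ℝ[X]) : Prop :=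
  p.natDegree ≤ m ∧ q.natDegree ≤ n ∧ q.eval a ≠ 0 ∧
    (fun x => F x - p.eval x / q.eval x) =O[𝓝[≠] a] (fun x => (x - a) ^ (m + n + 1))

/-- The function `h₂₂(u) / (r u (u - 1))` whose Padé approximants at `u = 1` are taken; here `h₂₂`
is the Taylor polynomial of degree `22` of the separatrix. -/
def taylorQuotient (c : ℝ) (h : ℝ → ℝ) (u : ℝ) : ℝ :=
  separatrixTaylor h 22 u / (saddleRate c * u * (u - 1))

/-- The numerator `r u (u - 1) p(u)` of the rational function `r u (u - 1) p(u) / q(u)`. -/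
def boundNumerator (c : ℝ) (p : ℝ[X]) : ℝ[X] :=
  C (saddleRate c) * X * (X - 1) * p

/-- The rational function `r u (u - 1) p(u) / q(u)`. -/
def rationalBound (c : ℝ) (p q : ℝ[X]) (u : ℝ) : ℝ :=
  (boundNumerator c p).eval u / q.eval u

end

/-!
Put `w = 1 - u` and let `r > 0` be the unstable eigenvalue of the saddle, so that `r² + c r = 1`.
The orbit equation determines all coefficients of `h` at the saddle (`sepCoeff`),
`-h(1 - w) = r w - w² ∑ α_n w^n`, and the recurrence shows `α_n > 0`. This gives the half of the
chain that concerns Taylor polynomials, once the series is known to converge and to represent `h`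
for all `|w| < 1`.

The other half rests on the factorization `-h(1 - w) = r w (1 - w) S(w)`, in which
`S(w) = ∑ s_n w^n` turns out to be the generating series of the moments of a positive functional
`L` on the polynomials on `[0, 1]`, that is, a Stieltjes series. For such a series the classical
theory applies: the denominators of the Padé approximants are the reversed orthogonal polynomials
for the weight `X`. Hence they have no zeros in `[0, 1]` and full degree, the remainder is
`w^{2m+1} L(X Q² / (1 - w X))` divided by a square and thus positive, and the difference of
consecutive approximants is a multiple of `w^{2m+1}` of known sign (`IsMomentPade.eval_div_lt`,
`IsMomentPade.eval_div_lt_succ`). Only the moments `s_0, …, s_{20}` enter for `m ≤ 10`, and these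
are determined by the Taylor polynomial of degree `22`.

Positivity of `L` comes from complex analysis. In terms of `τ = log u`, the function `P = -h / u`
solves `P P' = c P - P² - 1 + e^τ`. It continues holomorphically to the strip `|Im τ| < π`, and
`Im P < 0` in the upper half of it (`exists_orbit_strip`). The continuation moves upwards from the
real axis, with a uniform step. The imaginary part cannot vanish first at an interior point: there,
along the horizontal line, it would have a critical point at which the equation gives
`P Im P' = Im e^τ ≠ 0`. Near the two ends of the strip the asymptotic behaviour decides, at the
node because of `c ≥ 2`. Negativity of `Im P` in turn keeps `P` away from the singularity `P = 0`
of the equation (`IsOrbit.exists_lower_bound`), which allows the next step. The map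
`w = 4 z / (1 + z)²` sends the unit disc to the slit plane, so `P` is a typically real function of
`z`. Up to a positive factor, `L(Q)` is the limit of integrals over the unit circle of `Im P(ρ z)`
against `Q(1 / w)` and a density with the sign of `Im z`, as `ρ → 1` (`momentFunctional_nonneg`).
Positivity is strict, because otherwise `h` would be rational, which the orbit equation excludes.
It also bounds `s_n` and hence gives convergence of the series up to the node, where it is
identified with `h` by the uniqueness of the unstable separatrix (`IsGraphFunction.eq_sepFun`).
-/

open Asymptotics

/-! ### The power series of the separatrix at the saddle -/

/-- Coefficients `α_n > 0` of the expansion `-h(1 - w) = r w - w² ∑ α_n w^n` of the separatrix at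
the saddle, given by the recurrence that comes from comparing powers of `w` in the equation. -/
noncomputable def sepCoeff (c r : ℝ) : ℕ → ℝ
  | 0 => 1 / (3 * r + c)
  | n + 1 => ((n : ℝ) + 4) / (2 * (((n : ℝ) + 4) * r + c)) *
      ∑ i : Fin (n + 1), sepCoeff c r i * sepCoeff c r (n - i)

theorem sepCoeff_zero (c r : ℝ) : sepCoeff c r 0 = 1 / (3 * r + c) := by
  rw [sepCoeff]

theorem sepCoeff_succ (c r : ℝ) (n : ℕ) :
    sepCoeff c r (n + 1) = ((n : ℝ) + 4) / (2 * (((n : ℝ) + 4) * r + c)) *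
      ∑ ij ∈ Finset.HasAntidiagonal.antidiagonal n, sepCoeff c r ij.1 * sepCoeff c r ij.2 := by
  rw [sepCoeff, Finset.Nat.sum_antidiagonal_eq_sum_range_succ
    (fun i j => sepCoeff c r i * sepCoeff c r j) n, Finset.sum_range]

theorem sepCoeff_pos {c r : ℝ} (hc : 0 < c) (hr : 0 < r) (n : ℕ) : 0 < sepCoeff c r n := by
  induction n using Nat.strong_induction_on with
  | _ n ih =>
    cases n with
    | zero => rw [sepCoeff_zero]; positivity
    | succ n =>
      rw [sepCoeff_succ]
      refine mul_pos (by positivity) (Finset.sum_pos (fun ij hij => ?_) ⟨(0, n), by simp⟩)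
      have := Finset.HasAntidiagonal.mem_antidiagonal.1 hij
      exact mul_pos (ih _ (by omega)) (ih _ (by omega))

/-- A partial sum of the Cauchy product of a nonnegative series with itself is at most the square
of the partial sum. -/
theorem sum_range_antidiagonal_mul_le {a : ℕ → ℝ} (ha : ∀ n, 0 ≤ a n) (N : ℕ) :
    ∑ n ∈ Finset.range N, ∑ ij ∈ Finset.HasAntidiagonal.antidiagonal n, a ij.1 * a ij.2 ≤
      (∑ n ∈ Finset.range N, a n) ^ 2 := by
  rw [← Finset.sum_biUnion, sq, Finset.sum_mul_sum, ← Finset.sum_product']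
  · refine Finset.sum_le_sum_of_subset_of_nonneg (fun x hx => ?_)
      fun x _ _ => mul_nonneg (ha _) (ha _)
    simp only [Finset.mem_biUnion, Finset.mem_range, Finset.HasAntidiagonal.mem_antidiagonal,
      Finset.mem_product] at hx ⊢
    omega
  · intro m _ n _ hmn
    exact Finset.disjoint_left.2 fun x hx hx' => hmn
      ((Finset.HasAntidiagonal.mem_antidiagonal.1 hx).symm.trans
        (Finset.HasAntidiagonal.mem_antidiagonal.1 hx'))

/-- Explicit disc of convergence: by induction the partial sums at `w = r / (2 α₀)` stay below
`2 α₀`, because the recurrence is dominated by a quadratic one. -/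
theorem sum_sepCoeff_le {c r : ℝ} (hc : 0 < c) (hr : 0 < r) (N : ℕ) :
    ∑ n ∈ Finset.range N, sepCoeff c r n * (r / (2 * sepCoeff c r 0)) ^ n ≤
      2 * sepCoeff c r 0 := by
  have hpos := sepCoeff_pos hc hr
  set x := r / (2 * sepCoeff c r 0) with hx
  have hx0 : 0 < x := div_pos hr (mul_pos two_pos (hpos 0))
  induction N with
  | zero => simpa using (hpos 0).le
  | succ N ih =>
    rw [Finset.sum_range_succ']
    have h1 : ∀ n, sepCoeff c r (n + 1) * x ^ (n + 1) ≤ x / (2 * r) *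
        ∑ ij ∈ Finset.HasAntidiagonal.antidiagonal n, (sepCoeff c r ij.1 * x ^ ij.1) *
          (sepCoeff c r ij.2 * x ^ ij.2) := by
      intro n
      have e : ∑ ij ∈ Finset.HasAntidiagonal.antidiagonal n, (sepCoeff c r ij.1 * x ^ ij.1) *
          (sepCoeff c r ij.2 * x ^ ij.2) =
          (∑ ij ∈ Finset.HasAntidiagonal.antidiagonal n, sepCoeff c r ij.1 * sepCoeff c r ij.2) * x ^ n := by
        rw [Finset.sum_mul]
        refine Finset.sum_congr rfl fun ij hij => ?_
        rw [← Finset.HasAntidiagonal.mem_antidiagonal.1 hij, pow_add]; ring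
      rw [e, sepCoeff_succ]
      set Z := ∑ ij ∈ Finset.HasAntidiagonal.antidiagonal n, sepCoeff c r ij.1 * sepCoeff c r ij.2
      have hS : 0 ≤ Z := Finset.sum_nonneg fun ij _ => (mul_pos (hpos _) (hpos _)).le
      have h2 : ((n : ℝ) + 4) / (2 * (((n : ℝ) + 4) * r + c)) ≤ 1 / (2 * r) := by
        rw [div_le_div_iff₀ (by positivity) (by positivity)]; nlinarith
      calc _ = ((n : ℝ) + 4) / (2 * (((n : ℝ) + 4) * r + c)) * (Z * x ^ (n + 1)) := by ring
        _ ≤ 1 / (2 * r) * (Z * x ^ (n + 1)) :=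
          mul_le_mul_of_nonneg_right h2 (by positivity)
        _ = _ := by rw [pow_succ]; ring
    have h3 := sum_range_antidiagonal_mul_le (a := fun n => sepCoeff c r n * x ^ n)
      (fun n => (mul_pos (hpos n) (by positivity)).le) N
    have h4 : (∑ n ∈ Finset.range N, sepCoeff c r n * x ^ n) ^ 2 ≤ (2 * sepCoeff c r 0) ^ 2 :=
      pow_le_pow_left₀ (Finset.sum_nonneg fun n _ => (mul_pos (hpos n) (by positivity)).le) ih 2
    calc _ ≤ ∑ n ∈ Finset.range N, x / (2 * r) *
        (∑ ij ∈ Finset.HasAntidiagonal.antidiagonal n, (sepCoeff c r ij.1 * x ^ ij.1) *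
          (sepCoeff c r ij.2 * x ^ ij.2)) + sepCoeff c r 0 * x ^ 0 := by
            exact add_le_add_left (Finset.sum_le_sum fun n _ => h1 n) _
      _ ≤ x / (2 * r) * (2 * sepCoeff c r 0) ^ 2 + sepCoeff c r 0 := by
        rw [← Finset.mul_sum, pow_zero, mul_one]
        gcongr
        exact h3.trans h4
      _ = 2 * sepCoeff c r 0 := by
        rw [hx]; have := (hpos 0).ne'; field_simp; ring

theorem exists_summable_sepCoeff {c r : ℝ} (hc : 0 < c) (hr : 0 < r) :
    ∃ ϱ : ℝ, 0 < ϱ ∧ Summable fun n => sepCoeff c r n * ϱ ^ n := by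
  have hpos := sepCoeff_pos hc hr
  refine ⟨r / (2 * sepCoeff c r 0), div_pos hr (mul_pos two_pos (hpos 0)), ?_⟩
  have hx0 : 0 < r / (2 * sepCoeff c r 0) := div_pos hr (mul_pos two_pos (hpos 0))
  exact summable_of_sum_range_le (fun n => (mul_pos (hpos n) (by positivity)).le)
    (sum_sepCoeff_le hc hr)

section PowerSeries

variable {𝕜 : Type*} [RCLike 𝕜]

theorem hasFPowerSeriesOnBall_tsum {a : ℕ → 𝕜} {ϱ : ℝ} (hϱ : 0 < ϱ)
    (ha : Summable fun n => ‖a n‖ * ϱ ^ n) :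
    HasFPowerSeriesOnBall (fun w => ∑' n, a n * w ^ n)
      (FormalMultilinearSeries.ofScalars 𝕜 a) 0 (ENNReal.ofReal ϱ) := by
  have hr : ENNReal.ofReal ϱ ≤ (FormalMultilinearSeries.ofScalars 𝕜 a).radius := by
    apply FormalMultilinearSeries.le_radius_of_summable
    simpa [FormalMultilinearSeries.ofScalars_norm, Real.coe_toNNReal _ hϱ.le] using ha
  have h0 : 0 < ENNReal.ofReal ϱ := ENNReal.ofReal_pos.2 hϱ
  have h := ((FormalMultilinearSeries.ofScalars 𝕜 a).hasFPowerSeriesOnBall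
    (h0.trans_le hr)).mono h0 hr
  refine h.congr fun w _ => ?_
  simp [FormalMultilinearSeries.sum, mul_comm]

/-- The factor `A(w) = ∑ α_n w^n` in `-h(1 - w) = r w - w² A(w)`. -/
noncomputable def sepSeries (𝕜 : Type*) [RCLike 𝕜] (c r : ℝ) (w : 𝕜) : 𝕜 :=
  ∑' n, (sepCoeff c r n : 𝕜) * w ^ n

/-- The function `Y(w) = r w - w² A(w)`, which is `-h(1 - w)` near the saddle. -/
noncomputable def sepFun (𝕜 : Type*) [RCLike 𝕜] (c r : ℝ) (w : 𝕜) : 𝕜 :=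
  (r : 𝕜) * w - w ^ 2 * sepSeries 𝕜 c r w

theorem norm_sepCoeff {c r : ℝ} (hc : 0 < c) (hr : 0 < r) (n : ℕ) :
    ‖(sepCoeff c r n : 𝕜)‖ = sepCoeff c r n := by
  rw [RCLike.norm_ofReal, abs_of_pos (sepCoeff_pos hc hr n)]

theorem hasFPowerSeriesOnBall_sepSeries {c r ϱ : ℝ} (hc : 0 < c) (hr : 0 < r) (hϱ : 0 < ϱ)
    (hs : Summable fun n => sepCoeff c r n * ϱ ^ n) :
    HasFPowerSeriesOnBall (sepSeries 𝕜 c r)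
      (FormalMultilinearSeries.ofScalars 𝕜 fun n => (sepCoeff c r n : 𝕜)) 0
      (ENNReal.ofReal ϱ) :=
  hasFPowerSeriesOnBall_tsum hϱ (by simpa only [norm_sepCoeff hc hr] using hs)

theorem differentiableAt_sepSeries {c r ϱ : ℝ} (hc : 0 < c) (hr : 0 < r)
    (hs : Summable fun n => sepCoeff c r n * ϱ ^ n) {w : 𝕜} (hw : ‖w‖ < ϱ) :
    DifferentiableAt 𝕜 (sepSeries 𝕜 c r) w := by
  have hϱ : 0 < ϱ := (norm_nonneg w).trans_lt hw
  refine ((hasFPowerSeriesOnBall_sepSeries hc hr hϱ hs).analyticAt_of_mem ?_).differentiableAt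
  rw [Metric.mem_eball, edist_dist, dist_zero_right]
  exact (ENNReal.ofReal_lt_ofReal_iff hϱ).2 hw

/-- The integrated equation `Y² / 2 + c ∫ Y = w² / 2 - w³ / 3`, divided by `w³`. -/
theorem sepSeries_quadratic {c r ϱ : ℝ} (hc : 0 < c) (hr : 0 < r)
    (hs : Summable fun n => sepCoeff c r n * ϱ ^ n) {w : 𝕜} (hw : ‖w‖ ≤ ϱ) :
    (r : 𝕜) * sepSeries 𝕜 c r w + c * (∑' n, (sepCoeff c r n : 𝕜) / (n + 3) * w ^ n) -
      w * sepSeries 𝕜 c r w ^ 2 / 2 = 1 / 3 := by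
  have hn : Summable fun n => ‖(sepCoeff c r n : 𝕜) * w ^ n‖ := by
    refine hs.of_nonneg_of_le (fun _ => norm_nonneg _) fun n => ?_
    rw [norm_mul, norm_pow, norm_sepCoeff hc hr]
    exact mul_le_mul_of_nonneg_left (pow_le_pow_left₀ (norm_nonneg _) hw n)
      (sepCoeff_pos hc hr n).le
  have hJ : Summable fun n => (sepCoeff c r n : 𝕜) / (n + 3) * w ^ n := by
    refine Summable.of_norm_bounded hn fun n => ?_
    rw [norm_mul, norm_mul, norm_div]
    refine mul_le_mul_of_nonneg_right (div_le_self (norm_nonneg _) ?_) (norm_nonneg _)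
    have : ((n : 𝕜) + 3) = ((n + 3 : ℕ) : 𝕜) := by push_cast; ring
    rw [this, RCLike.norm_natCast]; push_cast; linarith [(Nat.cast_nonneg n : (0 : ℝ) ≤ n)]
  have hsq : sepSeries 𝕜 c r w ^ 2 = ∑' n, (∑ ij ∈ Finset.HasAntidiagonal.antidiagonal n,
      (sepCoeff c r ij.1 : 𝕜) * sepCoeff c r ij.2) * w ^ n := by
    rw [sq, sepSeries, tsum_mul_tsum_eq_tsum_sum_antidiagonal_of_summable_norm hn hn]
    refine tsum_congr fun n => ?_
    rw [Finset.sum_mul]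
    refine Finset.sum_congr rfl fun ij hij => ?_
    rw [← Finset.HasAntidiagonal.mem_antidiagonal.1 hij, pow_add]; ring
  have hsqs : Summable fun n => (∑ ij ∈ Finset.HasAntidiagonal.antidiagonal n,
      (sepCoeff c r ij.1 : 𝕜) * sepCoeff c r ij.2) * w ^ n := by
    have := (summable_norm_sum_mul_antidiagonal_of_summable_norm hn hn).of_norm
    refine this.congr fun n => ?_
    rw [Finset.sum_mul]
    refine Finset.sum_congr rfl fun ij hij => ?_
    rw [← Finset.HasAntidiagonal.mem_antidiagonal.1 hij, pow_add]; ring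
  have hA : sepSeries 𝕜 c r w = sepCoeff c r 0 + ∑' n, (sepCoeff c r (n + 1) : 𝕜) * w ^ (n + 1) := by
    rw [sepSeries, hn.of_norm.tsum_eq_zero_add]; simp
  have hJ' : (∑' n, (sepCoeff c r n : 𝕜) / (n + 3) * w ^ n) = sepCoeff c r 0 / 3 +
      ∑' n, (sepCoeff c r (n + 1) : 𝕜) / ((n + 1 : ℕ) + 3) * w ^ (n + 1) := by
    rw [hJ.tsum_eq_zero_add]; simp
  have e1 : (r : 𝕜) * ∑' n, (sepCoeff c r (n + 1) : 𝕜) * w ^ (n + 1) + c *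
      ∑' n, (sepCoeff c r (n + 1) : 𝕜) / ((n + 1 : ℕ) + 3) * w ^ (n + 1) =
      w * (∑' n, (∑ ij ∈ Finset.HasAntidiagonal.antidiagonal n,
      (sepCoeff c r ij.1 : 𝕜) * sepCoeff c r ij.2) * w ^ n) / 2 := by
    have s1 := ((summable_nat_add_iff 1).2 hn.of_norm)
    have s2 := ((summable_nat_add_iff 1).2 hJ)
    rw [← tsum_mul_left, ← tsum_mul_left, ← (s1.mul_left _).tsum_add (s2.mul_left _),
      ← tsum_mul_left, ← tsum_div_const]
    refine tsum_congr fun n => ?_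
    have hrec : (sepCoeff c r (n + 1) : 𝕜) * (2 * ((n + 4) * r + c)) = (n + 4) *
        ∑ ij ∈ Finset.HasAntidiagonal.antidiagonal n, (sepCoeff c r ij.1 : 𝕜) * sepCoeff c r ij.2 := by
      have : sepCoeff c r (n + 1) * (2 * (((n : ℝ) + 4) * r + c)) = ((n : ℝ) + 4) *
          ∑ ij ∈ Finset.HasAntidiagonal.antidiagonal n, sepCoeff c r ij.1 * sepCoeff c r ij.2 := by
        rw [sepCoeff_succ]; field_simp
      exact_mod_cast congrArg (fun x : ℝ => (x : 𝕜)) this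
    have h4 : (n : 𝕜) + 4 ≠ 0 := by
      have : ((n : 𝕜) + 4) = ((n + 4 : ℕ) : 𝕜) := by push_cast; ring
      rw [this]; exact Nat.cast_ne_zero.2 (by omega)
    have h5 : ((n + 1 : ℕ) : 𝕜) + 3 = n + 4 := by push_cast; ring
    rw [h5]
    set Z := ∑ ij ∈ Finset.HasAntidiagonal.antidiagonal n, (sepCoeff c r ij.1 : 𝕜) * sepCoeff c r ij.2
    have h6 : Z = (sepCoeff c r (n + 1) : 𝕜) * (2 * ((n + 4) * r + c)) / (n + 4) := by
      rw [hrec]; field_simp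
    rw [h6, pow_succ]; field_simp
  have e0 : (r : 𝕜) * sepCoeff c r 0 + c * (sepCoeff c r 0 / 3) = 1 / 3 := by
    have : r * sepCoeff c r 0 + c * (sepCoeff c r 0 / 3) = 1 / 3 := by
      rw [sepCoeff_zero]; field_simp
    have h := congrArg (fun x : ℝ => (x : 𝕜)) this
    push_cast at h; exact h
  rw [hsq, hJ']
  nth_rw 1 [hA]
  linear_combination e0 + e1

/-- `Y` solves the equation of the orbits, `Y Y' = w (1 - w) - c Y`. -/
theorem sepFun_ode {c r ϱ : ℝ} (hc : 0 < c) (hr : 0 < r) (hcr : r ^ 2 + c * r = 1)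
    (hs : Summable fun n => sepCoeff c r n * ϱ ^ n) {w : 𝕜} (hw : ‖w‖ < ϱ) :
    DifferentiableAt 𝕜 (sepFun 𝕜 c r) w ∧
    sepFun 𝕜 c r w * deriv (sepFun 𝕜 c r) w = w * (1 - w) - c * sepFun 𝕜 c r w := by
  have hϱ : 0 < ϱ := (norm_nonneg w).trans_lt hw
  have hA := differentiableAt_sepSeries (𝕜 := 𝕜) hc hr hs hw
  have hd : DifferentiableAt 𝕜 (sepFun 𝕜 c r) w := by
    unfold sepFun; fun_prop
  refine ⟨hd, ?_⟩
  have hmem : w ∈ Metric.ball (0 : 𝕜) ϱ := by simpa using hw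
  have hJ : HasDerivAt (fun z : 𝕜 => ∑' n, (sepCoeff c r n : 𝕜) / (n + 3) * z ^ (n + 3))
      (∑' n, (sepCoeff c r n : 𝕜) * w ^ (n + 2)) w := by
    refine hasDerivAt_tsum_of_isPreconnected (𝕜 := 𝕜) (F := 𝕜)
      (g := fun n z => (sepCoeff c r n : 𝕜) / (n + 3) * z ^ (n + 3))
      (g' := fun n z => (sepCoeff c r n : 𝕜) * z ^ (n + 2))
      (u := fun n => sepCoeff c r n * ϱ ^ n * ϱ ^ 2)
      (hs.mul_right _) Metric.isOpen_ball (convex_ball _ _).isPreconnected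
      (t := Metric.ball (0 : 𝕜) ϱ) (y₀ := 0) ?_ ?_ (by simpa using hϱ) ?_ hmem
    · intro n y _
      have h3 : (n : 𝕜) + 3 ≠ 0 := by
        have : ((n : 𝕜) + 3) = ((n + 3 : ℕ) : 𝕜) := by push_cast; ring
        rw [this]; exact Nat.cast_ne_zero.2 (by omega)
      refine ((hasDerivAt_pow (n + 3) y).const_mul
        ((sepCoeff c r n : 𝕜) / (n + 3))).congr_deriv ?_
      push_cast
      field_simp
    · intro n y hy
      rw [norm_mul, norm_pow, norm_sepCoeff hc hr, mul_assoc, ← pow_add]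
      have : ‖y‖ < ϱ := by simpa using hy
      exact mul_le_mul_of_nonneg_left (pow_le_pow_left₀ (norm_nonneg _) this.le _)
        (sepCoeff_pos hc hr n).le
    · simp
  -- the integrated equation holds identically on the disc, so it may be differentiated
  have hid : (fun z : 𝕜 => sepFun 𝕜 c r z ^ 2 / 2 + c * (r * z ^ 2 / 2 -
      ∑' n, (sepCoeff c r n : 𝕜) / (n + 3) * z ^ (n + 3))) =ᶠ[𝓝 w]
      fun z => z ^ 2 / 2 - z ^ 3 / 3 := by
    filter_upwards [Metric.isOpen_ball.mem_nhds hmem] with z hz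
    have hz' : ‖z‖ ≤ ϱ := by simpa using (Metric.mem_ball.1 hz).le
    have h := sepSeries_quadratic (𝕜 := 𝕜) hc hr hs hz'
    have e : (∑' n, (sepCoeff c r n : 𝕜) / (n + 3) * z ^ (n + 3)) =
        z ^ 3 * ∑' n, (sepCoeff c r n : 𝕜) / (n + 3) * z ^ n := by
      rw [← tsum_mul_left]; exact tsum_congr fun n => by ring
    have hcr' : (r : 𝕜) ^ 2 + c * r = 1 := by
      have := congrArg (fun x : ℝ => (x : 𝕜)) hcr
      push_cast at this; exact this
    rw [e, sepFun]
    linear_combination (-z ^ 3) * h + z ^ 2 / 2 * hcr'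
  have hd1 : HasDerivAt (fun z : 𝕜 => sepFun 𝕜 c r z ^ 2 / 2 + c * (r * z ^ 2 / 2 -
      ∑' n, (sepCoeff c r n : 𝕜) / (n + 3) * z ^ (n + 3)))
      (sepFun 𝕜 c r w * deriv (sepFun 𝕜 c r) w + c * sepFun 𝕜 c r w) w := by
    have e : (∑' n, (sepCoeff c r n : 𝕜) * w ^ (n + 2)) = w ^ 2 * sepSeries 𝕜 c r w := by
      rw [sepSeries, ← tsum_mul_left]; exact tsum_congr fun n => by ring
    have h2 : HasDerivAt (fun z : 𝕜 => (r : 𝕜) * z ^ 2 / 2) (r * w) w := by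
      refine (((hasDerivAt_pow 2 w).const_mul (r : 𝕜)).div_const 2).congr_deriv ?_
      push_cast; ring
    refine (((hd.hasDerivAt.pow 2).div_const 2).add ((h2.sub hJ).const_mul (c : 𝕜))).congr_deriv ?_
    rw [e, sepFun]; push_cast; ring
  have hd2 : HasDerivAt (fun z : 𝕜 => z ^ 2 / 2 - z ^ 3 / 3) (w - w ^ 2) w := by
    refine (((hasDerivAt_pow 2 w).div_const 2).sub ((hasDerivAt_pow 3 w).div_const 3)).congr_deriv ?_
    push_cast; ring
  have := hd1.unique (hd2.congr_of_eventuallyEq hid)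
  linear_combination this

end PowerSeries

/-! ### Holomorphic solutions of the orbit equation: existence, uniqueness, continuation -/

/-- Holomorphic Picard iteration: a first order equation `q' = G(τ, q)` with a bounded Lipschitz
right-hand side has a holomorphic solution on a disc of explicit radius. -/
theorem exists_holomorphic_solution {G : ℂ → ℂ → ℂ} {τ₀ p₀ : ℂ} {ρ b N K : ℝ}
    (hρ : 0 < ρ) (hb : 0 ≤ b) (hK : 0 ≤ K)
    (hG : ∀ q : ℂ → ℂ, DifferentiableOn ℂ q (Metric.ball τ₀ ρ) →
      MapsTo q (Metric.ball τ₀ ρ) (Metric.closedBall p₀ b) →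
      DifferentiableOn ℂ (fun τ => G τ (q τ)) (Metric.ball τ₀ ρ))
    (hN : ∀ τ ∈ Metric.ball τ₀ ρ, ∀ p ∈ Metric.closedBall p₀ b, ‖G τ p‖ ≤ N)
    (hL : ∀ τ ∈ Metric.ball τ₀ ρ, ∀ p ∈ Metric.closedBall p₀ b, ∀ p' ∈ Metric.closedBall p₀ b,
      ‖G τ p - G τ p'‖ ≤ K * ‖p - p'‖)
    (hNρ : N * ρ ≤ b) (hKρ : K * ρ ≤ 1 / 2) :
    ∃ q : ℂ → ℂ, DifferentiableOn ℂ q (Metric.ball τ₀ ρ) ∧ q τ₀ = p₀ ∧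
      MapsTo q (Metric.ball τ₀ ρ) (Metric.closedBall p₀ b) ∧
      ∀ τ ∈ Metric.ball τ₀ ρ, deriv q τ = G τ (q τ) := by
  set D := Metric.ball τ₀ ρ with hD
  have hτ₀ : τ₀ ∈ D := Metric.mem_ball_self hρ
  have hDo : IsOpen D := Metric.isOpen_ball
  have hDc : Convex ℝ D := convex_ball _ _
  let T := {q : ℂ → ℂ // DifferentiableOn ℂ q D ∧ MapsTo q D (Metric.closedBall p₀ b) ∧ q τ₀ = p₀}
  have hstep : ∀ q : T, ∃ q' : T, ∀ τ ∈ D, HasDerivAt q'.1 (G τ (q.1 τ)) τ := by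
    rintro ⟨q, hq1, hq2, hq3⟩
    obtain ⟨g, hg0, hg⟩ := ((hG q hq1 hq2).isExactOn_ball).with_val_at τ₀ p₀
    refine ⟨⟨g, fun τ hτ => (hg τ hτ).differentiableAt.differentiableWithinAt, ?_, hg0⟩, hg⟩
    intro τ hτ
    have := hDc.norm_image_sub_le_of_norm_hasDerivWithin_le (C := N)
      (fun x hx => (hg x hx).hasDerivWithinAt) (fun x hx => hN x hx _ (hq2 hx)) hτ₀ hτ
    rw [mem_closedBall_iff_norm, ← hg0]
    have hN0 : 0 ≤ N := (norm_nonneg _).trans (hN τ₀ hτ₀ p₀ (Metric.mem_closedBall_self hb))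
    have h2 : ‖τ - τ₀‖ ≤ ρ := (mem_ball_iff_norm.1 hτ).le
    exact this.trans ((mul_le_mul_of_nonneg_left h2 hN0).trans hNρ)
  choose next hnext using hstep
  let q0 : T := ⟨fun _ => p₀, differentiableOn_const _, fun _ _ => Metric.mem_closedBall_self hb, rfl⟩
  let q : ℕ → T := fun n => next^[n] q0
  have hq : ∀ n, q (n + 1) = next (q n) := fun n => Function.iterate_succ_apply' next n q0
  have hder : ∀ n, ∀ τ ∈ D, HasDerivAt (q (n + 1)).1 (G τ ((q n).1 τ)) τ := by
    intro n τ hτ; rw [hq]; exact hnext _ τ hτ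
  have hdiff : ∀ n, ∀ τ ∈ D, ‖(q (n + 1)).1 τ - (q n).1 τ‖ ≤ 2 * b * (1 / 2) ^ n := by
    intro n
    induction n with
    | zero =>
      intro τ hτ
      have h1 := mem_closedBall_iff_norm.1 ((q 1).2.2.1 hτ)
      simp only [zero_add, pow_zero, mul_one]
      calc _ ≤ b := h1
        _ ≤ 2 * b := by linarith
    | succ n ih =>
      intro τ hτ
      have h0 : (q (n + 1 + 1)).1 τ₀ - (q (n + 1)).1 τ₀ = 0 := by
        rw [(q (n + 1 + 1)).2.2.2, (q (n + 1)).2.2.2, sub_self]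
      have := hDc.norm_image_sub_le_of_norm_hasDerivWithin_le (C := K * (2 * b * (1 / 2) ^ n))
        (f := fun τ => (q (n + 1 + 1)).1 τ - (q (n + 1)).1 τ)
        (fun x hx => ((hder (n + 1) x hx).sub (hder n x hx)).hasDerivWithinAt)
        (fun x hx => (hL x hx _ ((q (n + 1)).2.2.1 hx) _ ((q n).2.2.1 hx)).trans
          (mul_le_mul_of_nonneg_left (ih x hx) hK)) hτ₀ hτ
      simp only [h0, sub_zero] at this
      have h2 : ‖τ - τ₀‖ ≤ ρ := (mem_ball_iff_norm.1 hτ).le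
      calc _ ≤ K * (2 * b * (1 / 2) ^ n) * ‖τ - τ₀‖ := this
        _ ≤ K * (2 * b * (1 / 2) ^ n) * ρ := by gcongr
        _ = (K * ρ) * (2 * b * (1 / 2) ^ n) := by ring
        _ ≤ 1 / 2 * (2 * b * (1 / 2) ^ n) := by gcongr
        _ = _ := by ring
  have hlim : ∀ τ, ∃ l, τ ∈ D → Tendsto (fun n => (q n).1 τ) atTop (𝓝 l) := by
    intro τ
    by_cases hτ : τ ∈ D
    · have : CauchySeq fun n => (q n).1 τ := by
        refine cauchySeq_of_le_geometric (1 / 2) (2 * b) (by norm_num) fun n => ?_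
        rw [dist_comm, dist_eq_norm]; exact hdiff n τ hτ
      obtain ⟨l, hl⟩ := cauchySeq_tendsto_of_complete this
      exact ⟨l, fun _ => hl⟩
    · exact ⟨0, fun h => absurd h hτ⟩
  choose Q hQ using hlim
  have hunif : TendstoUniformlyOn (fun n => (q n).1) Q atTop D := by
    have hb0 : Tendsto (fun n : ℕ => 2 * b * (1 / 2 : ℝ) ^ n / (1 - 1 / 2)) atTop (𝓝 0) := by
      have := tendsto_pow_atTop_nhds_zero_of_lt_one (r := (1 / 2 : ℝ)) (by norm_num) (by norm_num)
      simpa using (this.const_mul (2 * b)).div_const (1 - 1 / 2)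
    rw [Metric.tendstoUniformlyOn_iff]
    intro ε hε
    filter_upwards [hb0.eventually (gt_mem_nhds hε)] with n hn τ hτ
    rw [dist_comm]
    refine lt_of_le_of_lt (dist_le_of_le_geometric_of_tendsto (f := fun n => (q n).1 τ)
      (1 / 2) (2 * b) (by norm_num) (fun n => ?_) (hQ τ hτ) n) hn
    rw [dist_comm, dist_eq_norm]; exact hdiff n τ hτ
  have hloc := hunif.tendstoLocallyUniformlyOn
  have hqd : ∀ᶠ n in atTop, DifferentiableOn ℂ (q n).1 D := .of_forall fun n => (q n).2.1
  have hmaps : MapsTo Q D (Metric.closedBall p₀ b) := fun τ hτ =>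
    Metric.isClosed_closedBall.mem_of_tendsto (hQ τ hτ) (.of_forall fun n => (q n).2.2.1 hτ)
  refine ⟨Q, hloc.differentiableOn hqd hDo, ?_, hmaps, fun τ hτ => ?_⟩
  · have : Tendsto (fun n => (q n).1 τ₀) atTop (𝓝 p₀) := by simp [(q _).2.2.2]
    exact tendsto_nhds_unique (hQ τ₀ hτ₀) this
  · have h1 : Tendsto (fun n => deriv (q (n + 1)).1 τ) atTop (𝓝 (deriv Q τ)) :=
      ((hloc.deriv hqd hDo).tendsto_at hτ).comp (tendsto_add_atTop_nat 1)
    have h2 : Tendsto (fun n => deriv (q (n + 1)).1 τ) atTop (𝓝 (G τ (Q τ))) := by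
      simp only [fun n => (hder n τ hτ).deriv]
      rw [tendsto_iff_norm_sub_tendsto_zero]
      have h3 := (tendsto_iff_norm_sub_tendsto_zero.1 (hQ τ hτ)).const_mul K
      rw [mul_zero] at h3
      exact squeeze_zero (fun _ => norm_nonneg _)
        (fun n => hL τ hτ _ ((q n).2.2.1 hτ) _ (hmaps hτ)) h3
    exact tendsto_nhds_unique h1 h2

/-- `P` is a holomorphic solution on `Ω` of `P P' = c P - P² - 1 + e^τ`. This is the equation of
the orbits for `P = -v / u` in terms of `τ = log u`. It is written without division, so that it
makes sense at the saddle `τ = 0`, where `P = 0`. -/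
def IsOrbit (c : ℝ) (Ω : Set ℂ) (P : ℂ → ℂ) : Prop :=
  DifferentiableOn ℂ P Ω ∧ ∀ τ ∈ Ω, P τ * deriv P τ = c * P τ - P τ ^ 2 - 1 + Complex.exp τ

theorem IsOrbit.mono {c : ℝ} {Ω Ω' : Set ℂ} {P : ℂ → ℂ} (h : IsOrbit c Ω P) (hs : Ω' ⊆ Ω) :
    IsOrbit c Ω' P :=
  ⟨h.1.mono hs, fun τ hτ => h.2 τ (hs hτ)⟩

theorem IsOrbit.congr {c : ℝ} {Ω : Set ℂ} {P Q : ℂ → ℂ} (h : IsOrbit c Ω P) (hΩ : IsOpen Ω)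
    (hs : EqOn Q P Ω) : IsOrbit c Ω Q := by
  refine ⟨h.1.congr hs, fun τ hτ => ?_⟩
  have : Q =ᶠ[𝓝 τ] P := hs.eventuallyEq_of_mem (hΩ.mem_nhds hτ)
  rw [this.deriv_eq, hs hτ, h.2 τ hτ]

theorem IsOrbit.union {c : ℝ} {Ω Ω' : Set ℂ} {P : ℂ → ℂ} (hΩ : IsOpen Ω) (hΩ' : IsOpen Ω')
    (h : IsOrbit c Ω P) (h' : IsOrbit c Ω' P) : IsOrbit c (Ω ∪ Ω') P :=
  ⟨h.1.union_of_isOpen h'.1 hΩ hΩ', fun τ hτ => hτ.elim (h.2 τ) (h'.2 τ)⟩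

/-- The radius of existence is uniform as long as `P` stays bounded and away from `0`, where the
equation is singular. -/
theorem exists_local_orbit (c : ℝ) {δ : ℝ} (hδ : 0 < δ) (M B : ℝ) :
    ∃ ρ > 0, ∀ τ₀ p₀ : ℂ, δ ≤ ‖p₀‖ → ‖p₀‖ ≤ M → τ₀.re ≤ B →
      ∃ q, IsOrbit c (Metric.ball τ₀ ρ) q ∧ q τ₀ = p₀ := by
  set R := 1 + Real.exp (B + 1) with hR
  have hR0 : 0 < R := by positivity
  set N := |c| + |M| + δ + R * (2 / δ) with hN
  have hN0 : 0 < N := by positivity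
  set K := 1 + R * (4 / δ ^ 2) with hK
  have hK0 : 0 < K := by positivity
  set ρ := min 1 (min (δ / 2 / N) (1 / (2 * K))) with hρ
  have hρ0 : 0 < ρ := by positivity
  have hρ1 : ρ ≤ 1 := min_le_left _ _
  have hρ2 : ρ ≤ δ / 2 / N := (min_le_right _ _).trans (min_le_left _ _)
  have hρ3 : ρ ≤ 1 / (2 * K) := (min_le_right _ _).trans (min_le_right _ _)
  refine ⟨ρ, hρ0, fun τ₀ p₀ h1 h2 h3 => ?_⟩
  have hlow : ∀ p ∈ Metric.closedBall p₀ (δ / 2), δ / 2 ≤ ‖p‖ := by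
    intro p hp
    have := mem_closedBall_iff_norm'.1 hp
    have := norm_sub_norm_le p₀ p
    linarith
  have hne : ∀ p ∈ Metric.closedBall p₀ (δ / 2), p ≠ 0 := fun p hp =>
    norm_pos_iff.1 ((half_pos hδ).trans_le (hlow p hp))
  have hexp : ∀ τ ∈ Metric.ball τ₀ ρ, ‖1 - Complex.exp τ‖ ≤ R := by
    intro τ hτ
    refine (norm_sub_le _ _).trans ?_
    rw [norm_one, Complex.norm_exp, hR]
    gcongr
    have := (Complex.abs_re_le_norm (τ - τ₀)).trans (mem_ball_iff_norm.1 hτ).le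
    rw [Complex.sub_re] at this
    linarith [le_abs_self (τ.re - τ₀.re)]
  obtain ⟨q, hq1, hq2, hq3, hq4⟩ := exists_holomorphic_solution (τ₀ := τ₀) (p₀ := p₀) (ρ := ρ)
    (b := δ / 2) (N := N) (K := K) (G := fun τ p => c - p - (1 - Complex.exp τ) / p)
    hρ0 (by positivity) hK0.le
    (fun q hq hqm => by
      refine (((differentiableOn_const _).sub hq).sub (DifferentiableOn.div ?_ hq ?_))
      · exact (differentiableOn_const _).sub Complex.differentiable_exp.differentiableOn
      · exact fun τ hτ => hne _ (hqm hτ))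
    (fun τ hτ p hp => by
      have hp2 : ‖p‖ ≤ |M| + δ := by
        have h4 := norm_sub_norm_le p p₀
        have h5 := mem_closedBall_iff_norm.1 hp
        linarith [le_abs_self M]
      calc ‖(c : ℂ) - p - (1 - Complex.exp τ) / p‖ ≤ ‖(c : ℂ)‖ + ‖p‖ + ‖(1 - Complex.exp τ) / p‖ :=
            (norm_sub_le _ _).trans (add_le_add_left (norm_sub_le _ _) _)
        _ ≤ |c| + (|M| + δ) + R * (2 / δ) := by
          rw [Complex.norm_real, Real.norm_eq_abs, norm_div]
          gcongr
          calc _ ≤ R / (δ / 2) := div_le_div₀ hR0.le (hexp τ hτ) (half_pos hδ) (hlow p hp)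
            _ = _ := by field_simp
        _ = N := by rw [hN]; ring)
    (fun τ hτ p hp p' hp' => by
      have e : ((c : ℂ) - p - (1 - Complex.exp τ) / p) - (c - p' - (1 - Complex.exp τ) / p') =
          -(p - p') + (1 - Complex.exp τ) / (p * p') * (p - p') := by
        have := hne p hp; have := hne p' hp'; field_simp; ring
      simp only [e]
      have h6 : ‖(1 - Complex.exp τ) / (p * p')‖ ≤ R * (4 / δ ^ 2) := by
        rw [norm_div, norm_mul]
        calc _ ≤ R / (δ / 2 * (δ / 2)) := div_le_div₀ hR0.le (hexp τ hτ) (by positivity)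
              (mul_le_mul (hlow p hp) (hlow p' hp') (by positivity) (norm_nonneg _))
          _ = _ := by field_simp; ring
      refine (norm_add_le _ _).trans ?_
      rw [norm_neg, norm_mul, hK, add_mul, one_mul]
      gcongr)
    (by rw [le_div_iff₀ hN0] at hρ2; linarith)
    (by rw [le_div_iff₀ (by positivity)] at hρ3; linarith)
  refine ⟨q, ⟨hq1, fun τ hτ => ?_⟩, hq2⟩
  rw [hq4 τ hτ]
  have := hne _ (hq3 hτ)
  field_simp
  ring

theorem IsOrbit.eqOn_of_eventuallyEq {c : ℝ} {Ω : Set ℂ} {P Q : ℂ → ℂ} (hΩ : IsOpen Ω)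
    (hc : IsPreconnected Ω) (hP : IsOrbit c Ω P) (hQ : IsOrbit c Ω Q) {τ₀ : ℂ} (h₀ : τ₀ ∈ Ω)
    (h : P =ᶠ[𝓝 τ₀] Q) : EqOn P Q Ω :=
  (hP.1.analyticOnNhd hΩ).eqOn_of_preconnected_of_eventuallyEq (hQ.1.analyticOnNhd hΩ) hc h₀ h

/-- Uniqueness: the difference `d` of two solutions satisfies a linear equation `d' = l d`. -/
theorem IsOrbit.eqOn {c : ℝ} {Ω : Set ℂ} {P Q : ℂ → ℂ} (hΩ : IsOpen Ω) (hc : IsPreconnected Ω)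
    (hP : IsOrbit c Ω P) (hQ : IsOrbit c Ω Q) {τ₀ : ℂ} (h₀ : τ₀ ∈ Ω) (h : P τ₀ = Q τ₀)
    (hne : P τ₀ ≠ 0) : EqOn P Q Ω := by
  refine hP.eqOn_of_eventuallyEq hΩ hc hQ h₀ ?_
  have hPc := (hP.1.differentiableAt (hΩ.mem_nhds h₀)).continuousAt
  have hQc := (hQ.1.differentiableAt (hΩ.mem_nhds h₀)).continuousAt
  have hev : ∀ᶠ τ in 𝓝 τ₀, τ ∈ Ω ∧ P τ ≠ 0 ∧ Q τ ≠ 0 :=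
    (hΩ.eventually_mem h₀).and ((hPc.eventually_ne hne).and (hQc.eventually_ne (h ▸ hne)))
  obtain ⟨ε, hε, hball⟩ := Metric.eventually_nhds_iff_ball.1 hev
  have hPd : ∀ τ ∈ Metric.ball τ₀ ε, HasDerivAt P (deriv P τ) τ := fun τ hτ =>
    (hP.1.differentiableAt (hΩ.mem_nhds (hball τ hτ).1)).hasDerivAt
  have hQd : ∀ τ ∈ Metric.ball τ₀ ε, HasDerivAt Q (deriv Q τ) τ := fun τ hτ =>
    (hQ.1.differentiableAt (hΩ.mem_nhds (hball τ hτ).1)).hasDerivAt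
  have hl : DifferentiableOn ℂ (fun τ => -1 + (1 - Complex.exp τ) / (P τ * Q τ))
      (Metric.ball τ₀ ε) := by
    intro τ hτ
    obtain ⟨-, hp, hq⟩ := hball τ hτ
    have := (hPd τ hτ).differentiableAt
    have := (hQd τ hτ).differentiableAt
    have : P τ * Q τ ≠ 0 := mul_ne_zero hp hq
    refine DifferentiableAt.differentiableWithinAt ?_
    fun_prop (disch := assumption)
  obtain ⟨g, hg⟩ := hl.isExactOn_ball
  have hmul : ∀ τ ∈ Metric.ball τ₀ ε,
      HasDerivAt (fun τ => (P τ - Q τ) * Complex.exp (-g τ)) 0 τ := by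
    intro τ hτ
    obtain ⟨hτΩ, hp, hq⟩ := hball τ hτ
    have h1 := ((hPd τ hτ).sub (hQd τ hτ)).mul ((hg τ hτ).neg.cexp)
    refine h1.congr_deriv ?_
    have e1 : deriv P τ = c - P τ - (1 - Complex.exp τ) / P τ := by
      have := hP.2 τ hτΩ; field_simp; linear_combination this
    have e2 : deriv Q τ = c - Q τ - (1 - Complex.exp τ) / Q τ := by
      have := hQ.2 τ hτΩ; field_simp; linear_combination this
    rw [e1, e2]
    simp only [Pi.sub_apply]
    field_simp
    ring
  have hconst : ∀ τ ∈ Metric.ball τ₀ ε, (P τ - Q τ) * Complex.exp (-g τ) = 0 := by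
    intro τ hτ
    have := Metric.isOpen_ball.is_const_of_deriv_eq_zero (convex_ball τ₀ ε).isPreconnected
      (fun x hx => (hmul x hx).differentiableAt.differentiableWithinAt)
      (fun x hx => (hmul x hx).deriv) hτ (Metric.mem_ball_self hε)
    rw [this, h, sub_self, zero_mul]
  filter_upwards [Metric.ball_mem_nhds τ₀ hε] with τ hτ
  exact sub_eq_zero.1 ((mul_eq_zero.1 (hconst τ hτ)).resolve_right (Complex.exp_ne_zero _))

/-- Analytic continuation: local solutions on discs of a common radius around points of a convex
domain glue to one solution. Two such discs that meet contain the midpoint of their centres, which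
belongs to the convex domain. -/
theorem IsOrbit.exists_extension {c ρ : ℝ} {Ω X : Set ℂ} {P : ℂ → ℂ} (hΩ : IsOpen Ω)
    (hconv : Convex ℝ Ω) (hP : IsOrbit c Ω P) (hX : X ⊆ Ω)
    (hloc : ∀ x ∈ X, P x ≠ 0 ∧ ∃ q, IsOrbit c (Metric.ball x ρ) q ∧ q x = P x) :
    ∃ P', IsOrbit c (Ω ∪ ⋃ x ∈ X, Metric.ball x ρ) P' ∧ EqOn P' P Ω := by
  classical
  have hq : ∀ x, ∃ q, x ∈ X → IsOrbit c (Metric.ball x ρ) q ∧ q x = P x := fun x => by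
    by_cases hx : x ∈ X
    · exact (hloc x hx).2.imp fun q h _ => h
    · exact ⟨P, fun h => absurd h hx⟩
  choose q hq using hq
  have h1 : ∀ x ∈ X, EqOn (q x) P (Metric.ball x ρ ∩ Ω) := by
    intro x hx τ hτ
    have hρ : 0 < ρ := Metric.pos_of_mem_ball hτ.1
    refine IsOrbit.eqOn (Metric.isOpen_ball.inter hΩ) ((convex_ball x ρ).inter hconv).isPreconnected
      ((hq x hx).1.mono inter_subset_left) (hP.mono inter_subset_right)
      ⟨Metric.mem_ball_self hρ, hX hx⟩ (hq x hx).2 ?_ hτ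
    rw [(hq x hx).2]; exact (hloc x hx).1
  have h2 : ∀ x ∈ X, ∀ y ∈ X, EqOn (q x) (q y) (Metric.ball x ρ ∩ Metric.ball y ρ) := by
    intro x hx y hy τ hτ
    have hd : dist x y < 2 * ρ := by
      have := dist_triangle_right x y τ
      have := Metric.mem_ball'.1 hτ.1
      have := Metric.mem_ball'.1 hτ.2
      linarith
    have hm : midpoint ℝ x y ∈ (Metric.ball x ρ ∩ Metric.ball y ρ) ∩ Ω := by
      refine ⟨⟨?_, ?_⟩, hconv.midpoint_mem (hX hx) (hX hy)⟩
      · rw [Metric.mem_ball, dist_midpoint_left]; norm_num; linarith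
      · rw [Metric.mem_ball, dist_midpoint_right]; norm_num; linarith
    refine IsOrbit.eqOn_of_eventuallyEq (Metric.isOpen_ball.inter Metric.isOpen_ball)
      ((convex_ball x ρ).inter (convex_ball y ρ)).isPreconnected
      ((hq x hx).1.mono inter_subset_left) ((hq y hy).1.mono inter_subset_right) hm.1 ?_ hτ
    filter_upwards [((Metric.isOpen_ball.inter Metric.isOpen_ball).inter hΩ).mem_nhds hm] with z hz
    rw [h1 x hx ⟨hz.1.1, hz.2⟩, h1 y hy ⟨hz.1.2, hz.2⟩]
  let P' : ℂ → ℂ := fun τ => if τ ∈ Ω then P τ else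
    if h : ∃ x ∈ X, τ ∈ Metric.ball x ρ then q h.choose τ else 0
  have hP'1 : EqOn P' P Ω := fun τ hτ => if_pos hτ
  have hP'2 : ∀ x ∈ X, EqOn P' (q x) (Metric.ball x ρ) := by
    intro x hx τ hτ
    by_cases h : τ ∈ Ω
    · rw [hP'1 h, h1 x hx ⟨hτ, h⟩]
    · have he : ∃ x ∈ X, τ ∈ Metric.ball x ρ := ⟨x, hx, hτ⟩
      simp only [P', if_neg h, dif_pos he]
      exact h2 _ he.choose_spec.1 x hx ⟨he.choose_spec.2, hτ⟩
  have hU : IsOpen (⋃ x ∈ X, Metric.ball x ρ) :=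
    isOpen_biUnion fun _ _ => Metric.isOpen_ball
  refine ⟨P', IsOrbit.union hΩ hU (hP.congr hΩ hP'1) ⟨?_, ?_⟩, hP'1⟩
  · intro τ hτ
    obtain ⟨x, hx, hτx⟩ := mem_iUnion₂.1 hτ
    have h := (hq x hx).1.congr Metric.isOpen_ball (hP'2 x hx)
    exact (h.1.differentiableAt (Metric.isOpen_ball.mem_nhds hτx)).differentiableWithinAt
  · intro τ hτ
    obtain ⟨x, hx, hτx⟩ := mem_iUnion₂.1 hτ
    exact ((hq x hx).1.congr Metric.isOpen_ball (hP'2 x hx)).2 τ hτx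

/-! ### Rectangles, symmetry, and monotonicity on the real axis -/

/-- The germ at the saddle `τ = 0` of the solution of the orbit equation. -/
noncomputable def sepGerm (c r : ℝ) (τ : ℂ) : ℂ :=
  sepFun ℂ c r (1 - Complex.exp τ) / Complex.exp τ

theorem sepGerm_conj (c r : ℝ) (τ : ℂ) :
    sepGerm c r (starRingEnd ℂ τ) = starRingEnd ℂ (sepGerm c r τ) := by
  simp [sepGerm, sepFun, sepSeries, Complex.exp_conj, Complex.conj_tsum]

theorem exists_isOrbit_sepGerm {c r : ℝ} (hc : 0 < c) (hr : 0 < r) (hcr : r ^ 2 + c * r = 1) :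
    ∃ ε > 0, IsOrbit c (Metric.ball 0 ε) (sepGerm c r) := by
  obtain ⟨ϱ, hϱ, hs⟩ := exists_summable_sepCoeff hc hr
  have hcont : ContinuousAt (fun τ : ℂ => ‖1 - Complex.exp τ‖) 0 := by fun_prop
  have hev : ∀ᶠ τ : ℂ in 𝓝 0, ‖1 - Complex.exp τ‖ < ϱ :=
    hcont.eventually_lt_const (by simpa using hϱ)
  obtain ⟨ε, hε, hball⟩ := Metric.eventually_nhds_iff_ball.1 hev
  have hd : ∀ τ ∈ Metric.ball (0 : ℂ) ε, HasDerivAt (sepGerm c r)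
      (-deriv (sepFun ℂ c r) (1 - Complex.exp τ) - sepGerm c r τ) τ := by
    intro τ hτ
    obtain ⟨h1, -⟩ := sepFun_ode (𝕜 := ℂ) hc hr hcr hs (hball τ hτ)
    have h2 : HasDerivAt (fun τ : ℂ => 1 - Complex.exp τ) (-Complex.exp τ) τ := by
      simpa using (Complex.hasDerivAt_exp τ).const_sub 1
    have h3 := (h1.hasDerivAt.comp τ h2).div (Complex.hasDerivAt_exp τ) (Complex.exp_ne_zero τ)
    refine h3.congr_deriv ?_
    have := Complex.exp_ne_zero τ
    simp only [Function.comp, sepGerm]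
    field_simp
  refine ⟨ε, hε, fun τ hτ => (hd τ hτ).differentiableAt.differentiableWithinAt, fun τ hτ => ?_⟩
  obtain ⟨-, h2⟩ := sepFun_ode (𝕜 := ℂ) hc hr hcr hs (hball τ hτ)
  have e := Complex.exp_ne_zero τ
  have h3 : sepGerm c r τ * Complex.exp τ = sepFun ℂ c r (1 - Complex.exp τ) := by
    rw [sepGerm]; field_simp
  rw [(hd τ hτ).deriv]
  rw [← h3] at h2
  apply mul_right_cancel₀ e
  simp only [RCLike.ofReal_eq_complex_ofReal] at h2
  linear_combination -h2

theorem deriv_sepGerm_zero {c r : ℝ} (hc : 0 < c) (hr : 0 < r) :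
    deriv (sepGerm c r) 0 = -r := by
  obtain ⟨ϱ, hϱ, hs⟩ := exists_summable_sepCoeff hc hr
  have hA := differentiableAt_sepSeries (𝕜 := ℂ) hc hr hs (w := 0) (by simpa using hϱ)
  have h1 : HasDerivAt (sepFun ℂ c r) r 0 := by
    refine (((hasDerivAt_id (0 : ℂ)).const_mul (r : ℂ)).sub
      (((hasDerivAt_pow 2 (0 : ℂ))).mul hA.hasDerivAt)).congr_deriv ?_
    simp
  have h2 : HasDerivAt (fun τ : ℂ => 1 - Complex.exp τ) (-1) 0 := by
    simpa using (Complex.hasDerivAt_exp 0).const_sub 1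
  have h1' : HasDerivAt (sepFun ℂ c r) r (1 - Complex.exp 0) := by simpa using h1
  have h3 := (h1'.comp (0 : ℂ) h2).div (Complex.hasDerivAt_exp 0) (Complex.exp_ne_zero 0)
  have : HasDerivAt (sepGerm c r) (-r) 0 := by
    refine h3.congr_deriv ?_
    simp [sepFun]
  exact this.deriv

/-- The open box `|Re τ| < L`, `a < Im τ < b`. -/
def box (L a b : ℝ) : Set ℂ := {τ | |τ.re| < L ∧ a < τ.im ∧ τ.im < b}

theorem isOpen_box (L a b : ℝ) : IsOpen (box L a b) := by
  have h1 : Continuous fun τ : ℂ => |τ.re| := Complex.continuous_re.abs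
  exact (isOpen_lt h1 continuous_const).inter ((isOpen_lt continuous_const
    Complex.continuous_im).inter (isOpen_lt Complex.continuous_im continuous_const))

theorem convex_box (L a b : ℝ) : Convex ℝ (box L a b) := by
  have h : box L a b = {τ : ℂ | τ.re < L} ∩ {τ : ℂ | -L < τ.re} ∩ {τ : ℂ | a < τ.im} ∩
      {τ : ℂ | τ.im < b} := by
    ext τ; simp only [box, mem_ofPred_eq, mem_inter_iff, abs_lt]; tauto
  rw [h]
  exact (((convex_halfSpace_re_lt L).inter (convex_halfSpace_re_gt (-L))).inter
    (convex_halfSpace_im_gt a)).inter (convex_halfSpace_im_lt b)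

theorem box_mono {L L' a a' b b' : ℝ} (hL : L ≤ L') (ha : a' ≤ a) (hb : b ≤ b') :
    box L a b ⊆ box L' a' b' :=
  fun _ h => ⟨h.1.trans_le hL, ha.trans_lt h.2.1, h.2.2.trans_le hb⟩

theorem ofReal_mem_box {L a b σ : ℝ} (ha : a < 0) (hb : 0 < b) (hσ : |σ| < L) :
    (σ : ℂ) ∈ box L a b := ⟨by simpa using hσ, by simpa using ha, by simpa using hb⟩

theorem deriv_nonneg_of_le_left {q : ℝ → ℝ} {d a x : ℝ} (hax : a < x) (hq : HasDerivAt q d x)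
    (h : ∀ y ∈ Ioo a x, q y ≤ q x) : 0 ≤ d := by
  have h1 := (hasDerivAt_iff_tendsto_slope_left_right.1 hq).1
  refine ge_of_tendsto h1 ?_
  filter_upwards [Ioo_mem_nhdsLT hax] with y hy
  rw [slope_def_field]
  exact div_nonneg_of_nonpos (sub_nonpos.2 (h y hy)) (sub_nonpos.2 hy.2.le)

theorem deriv_nonpos_of_le_right {q : ℝ → ℝ} {d x b : ℝ} (hxb : x < b) (hq : HasDerivAt q d x)
    (h : ∀ y ∈ Ioo x b, q y ≤ q x) : d ≤ 0 := by
  have h1 := (hasDerivAt_iff_tendsto_slope_left_right.1 hq).2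
  refine le_of_tendsto h1 ?_
  filter_upwards [Ioo_mem_nhdsGT hxb] with y hy
  rw [slope_def_field]
  exact div_nonpos_of_nonpos_of_nonneg (sub_nonpos.2 (h y hy)) (sub_nonneg.2 hy.1.le)

theorem IsOrbit.conj {c : ℝ} {Ω : Set ℂ} {P : ℂ → ℂ} (hΩ : IsOpen Ω) (h : IsOrbit c Ω P) :
    IsOrbit c (starRingEnd ℂ ⁻¹' Ω) (fun τ => starRingEnd ℂ (P (starRingEnd ℂ τ))) := by
  have hd : ∀ τ, starRingEnd ℂ τ ∈ Ω → HasDerivAt (fun τ => starRingEnd ℂ (P (starRingEnd ℂ τ)))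
      (starRingEnd ℂ (deriv P (starRingEnd ℂ τ))) τ := by
    intro τ hτ
    simpa [Function.comp_def] using
      (h.1.differentiableAt (hΩ.mem_nhds hτ)).hasDerivAt.star_conj
  refine ⟨fun τ hτ => (hd τ hτ).differentiableAt.differentiableWithinAt, fun τ hτ => ?_⟩
  rw [(hd τ hτ).deriv, ← map_mul, h.2 _ hτ]
  simp [← Complex.exp_conj]

theorem IsOrbit.conj_eq {c r L a b : ℝ} {P : ℂ → ℂ} (hP : IsOrbit c (box L a b) P)
    (hg : P =ᶠ[𝓝 0] sepGerm c r) (ha : a < 0) (hb : 0 < b) (hL : 0 < L) {τ : ℂ}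
    (hτ : τ ∈ box L a b) (hτ' : starRingEnd ℂ τ ∈ box L a b) :
    P (starRingEnd ℂ τ) = starRingEnd ℂ (P τ) := by
  set κ := min (-a) b
  have hκ : 0 < κ := lt_min (by linarith) hb
  have h1 : box L (-κ) κ ⊆ box L a b :=
    box_mono le_rfl (by have := min_le_left (-a) b; linarith) (min_le_right _ _)
  have h2 : box L (-κ) κ ⊆ starRingEnd ℂ ⁻¹' box L a b := by
    intro τ hτ
    exact h1 ⟨by simpa using hτ.1, by simpa using hτ.2.2, by simpa using by linarith [hτ.2.1]⟩
  have h0 : (0 : ℂ) ∈ box L (-κ) κ := ⟨by simpa using hL, by simpa using hκ, by simpa using hκ⟩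
  have hcont : Tendsto (starRingEnd ℂ) (𝓝 (0 : ℂ)) (𝓝 0) := by
    simpa using (Complex.continuous_conj.tendsto (0 : ℂ))
  have hev : (fun τ => starRingEnd ℂ (P (starRingEnd ℂ τ))) =ᶠ[𝓝 0] P := by
    filter_upwards [hg, hcont.eventually hg] with z hz hz'
    rw [hz', hz, sepGerm_conj, Complex.conj_conj]
  have := ((hP.conj (isOpen_box L a b)).mono h2).eqOn_of_eventuallyEq (isOpen_box L (-κ) κ)
    (convex_box _ _ _).isPreconnected (hP.mono h1) h0 hev
  have hmem : τ ∈ box L (-κ) κ := by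
    refine ⟨hτ.1, ?_, ?_⟩
    · rcases min_choice (-a) b with h | h <;> simp only [κ, h]
      · linarith [hτ.2.1]
      · have := hτ'.2.2; simp at this; linarith
    · refine lt_min ?_ hτ.2.2
      have := hτ'.2.1; simp at this; linarith
  rw [← this hmem, Complex.conj_conj]

/-- On the real axis the continuation of the separatrix is real and strictly decreasing: at the
zero of `P'` that is closest to the saddle, `P P'' = e^τ`, which gives `P''` the wrong sign. -/
theorem IsOrbit.real_axis {c r L a b : ℝ} {P : ℂ → ℂ} (hc : 0 < c) (hr : 0 < r)
    (hP : IsOrbit c (box L a b) P)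
    (hg : P =ᶠ[𝓝 0] sepGerm c r) (ha : a < 0) (hb : 0 < b) {σ : ℝ} (hσ : |σ| < L) :
    P σ = ((P σ).re : ℝ) ∧ deriv P σ = ((deriv P σ).re : ℝ) ∧ (deriv P σ).re < 0 := by
  have hL : 0 < L := (abs_nonneg σ).trans_lt hσ
  have hopen := isOpen_box L a b
  have hmem : ∀ x : ℝ, |x| < L → (x : ℂ) ∈ box L a b := fun x hx => ofReal_mem_box ha hb hx
  have hPd : ∀ x : ℝ, |x| < L → HasDerivAt P (deriv P x) x := fun x hx =>
    (hP.1.differentiableAt (hopen.mem_nhds (hmem x hx))).hasDerivAt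
  have hPd2 : ∀ x : ℝ, |x| < L → HasDerivAt (deriv P) (deriv (deriv P) x) x := fun x hx =>
    ((hP.1.deriv hopen).differentiableAt (hopen.mem_nhds (hmem x hx))).hasDerivAt
  have him : ∀ x : ℝ, |x| < L → (P x).im = 0 := fun x hx => by
    have := hP.conj_eq hg ha hb hL (hmem x hx) (by simpa using hmem x hx)
    rw [Complex.conj_ofReal] at this
    exact Complex.conj_eq_iff_im.1 this.symm
  have hreal : ∀ x : ℝ, |x| < L → P x = ((P x).re : ℝ) := fun x hx =>
    Complex.ext rfl (by simpa using him x hx)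
  have hnhds : ∀ x : ℝ, |x| < L → ∀ᶠ y : ℝ in 𝓝 x, |y| < L := fun x hx =>
    continuous_abs.continuousAt.eventually_lt_const hx
  have hdre : ∀ x : ℝ, |x| < L → deriv P x = ((deriv P x).re : ℝ) := fun x hx => by
    have h1 : HasDerivAt (fun y : ℝ => P y) (deriv P x) x := (hPd x hx).comp_ofReal
    have h2 : HasDerivAt (fun y : ℝ => (((P y).re : ℝ) : ℂ)) ((deriv P x).re : ℝ) x :=
      (hPd x hx).real_of_complex.ofReal_comp
    refine h1.unique (h2.congr_of_eventuallyEq ?_)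
    filter_upwards [hnhds x hx] with y hy using hreal y hy
  refine ⟨hreal σ hσ, hdre σ hσ, ?_⟩
  set p : ℝ → ℝ := fun x => (P x).re with hp
  set q : ℝ → ℝ := fun x => (deriv P x).re with hq
  have hpd : ∀ x : ℝ, |x| < L → HasDerivAt p (q x) x := fun x hx => (hPd x hx).real_of_complex
  have hqd : ∀ x : ℝ, |x| < L → HasDerivAt q (deriv (deriv P) x).re x :=
    fun x hx => (hPd2 x hx).real_of_complex
  have hqc : ∀ x : ℝ, |x| < L → ContinuousAt q x := fun x hx => (hqd x hx).continuousAt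
  have hp0 : p 0 = 0 := by simp [hp, hg.self_of_nhds, sepGerm, sepFun]
  have hq0 : q 0 = -r := by
    simp only [hq, Complex.ofReal_zero]
    rw [hg.deriv_eq, deriv_sepGerm_zero hc hr]; simp
  have hcrit : ∀ x : ℝ, |x| < L → q x = 0 → p x * (deriv (deriv P) x).re = Real.exp x := by
    intro x hx h0
    have hP0 : deriv P x = 0 := by rw [hdre x hx]; simpa [hq] using h0
    have hid : (fun τ => P τ * deriv P τ) =ᶠ[𝓝 (x : ℂ)]
        fun τ => c * P τ - P τ ^ 2 - 1 + Complex.exp τ := by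
      filter_upwards [hopen.mem_nhds (hmem x hx)] with τ hτ using hP.2 τ hτ
    have h1 := (hPd x hx).mul (hPd2 x hx)
    have h2 := ((((hPd x hx).const_mul (c : ℂ)).sub ((hPd x hx).pow 2)).sub_const 1).add
      (Complex.hasDerivAt_exp x)
    have h3 := h1.unique (h2.congr_of_eventuallyEq hid)
    rw [hP0, hreal x hx] at h3
    have h4 := congrArg Complex.re h3
    simpa [← Complex.ofReal_exp] using h4
  have habs : ∀ {x y : ℝ}, |y| < L → |x| ≤ |y| → |x| < L := fun h1 h2 => h2.trans_lt h1
  by_contra hcon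
  have hcon : 0 ≤ q σ := not_lt.1 hcon
  rcases lt_trichotomy σ 0 with hs | hs | hs
  · have hin : ∀ x ∈ Icc σ 0, |x| < L := fun x hx =>
      habs hσ (by rw [abs_of_nonpos hx.2, abs_of_neg hs]; linarith [hx.1])
    have hcomp : IsCompact (Icc σ 0 ∩ q ⁻¹' Ici 0) :=
      isCompact_Icc.of_isClosed_subset (ContinuousOn.preimage_isClosed_of_isClosed
        (fun x hx => (hqc x (hin x hx)).continuousWithinAt) isClosed_Icc isClosed_Ici)
        inter_subset_left
    obtain ⟨x, ⟨hx1, hx2⟩, hmax⟩ := hcomp.exists_isGreatest ⟨σ, ⟨le_rfl, hs.le⟩, hcon⟩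
    have hx0 : x < 0 := lt_of_le_of_ne hx1.2 fun h => by
      rw [h, mem_preimage, mem_Ici, hq0] at hx2; linarith
    have hneg : ∀ y ∈ Ioc x 0, q y < 0 := fun y hy => by
      by_contra h
      exact absurd (hmax ⟨⟨hx1.1.trans hy.1.le, hy.2⟩, not_lt.1 h⟩) (not_le.2 hy.1)
    have hqx : q x = 0 := le_antisymm (by
      refine le_of_tendsto ((hqc x (hin x hx1)).tendsto.mono_left
        (nhdsWithin_le_nhds (s := Ioi x))) ?_
      filter_upwards [Ioo_mem_nhdsGT hx0] with y hy using (hneg y ⟨hy.1, hy.2.le⟩).le) hx2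
    have hpx : 0 < p x := by
      have : StrictAntiOn p (Icc x 0) := strictAntiOn_of_deriv_neg (convex_Icc _ _)
        (fun y hy => (hpd y (hin y ⟨hx1.1.trans hy.1, hy.2⟩)).continuousAt.continuousWithinAt)
        fun y hy => by
          rw [interior_Icc] at hy
          rw [(hpd y (hin y ⟨hx1.1.trans hy.1.le, hy.2.le⟩)).deriv]
          exact hneg y ⟨hy.1, hy.2.le⟩
      have := this ⟨le_rfl, hx0.le⟩ ⟨hx0.le, le_rfl⟩ hx0
      rwa [hp0] at this
    have h5 := deriv_nonpos_of_le_right hx0 (hqd x (hin x hx1))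
      fun y hy => by rw [hqx]; exact (hneg y ⟨hy.1, hy.2.le⟩).le
    have h6 := hcrit x (hin x hx1) hqx
    nlinarith [Real.exp_pos x]
  · rw [hs, hq0] at hcon; linarith
  · have hin : ∀ x ∈ Icc 0 σ, |x| < L := fun x hx =>
      habs hσ (by rw [abs_of_nonneg hx.1, abs_of_pos hs]; exact hx.2)
    have hcomp : IsCompact (Icc 0 σ ∩ q ⁻¹' Ici 0) :=
      isCompact_Icc.of_isClosed_subset (ContinuousOn.preimage_isClosed_of_isClosed
        (fun x hx => (hqc x (hin x hx)).continuousWithinAt) isClosed_Icc isClosed_Ici)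
        inter_subset_left
    obtain ⟨x, ⟨hx1, hx2⟩, hmin⟩ := hcomp.exists_isLeast ⟨σ, ⟨hs.le, le_rfl⟩, hcon⟩
    have hx0 : 0 < x := lt_of_le_of_ne hx1.1 fun h => by
      rw [← h, mem_preimage, mem_Ici, hq0] at hx2; linarith
    have hneg : ∀ y ∈ Ico 0 x, q y < 0 := fun y hy => by
      by_contra h
      exact absurd (hmin ⟨⟨hy.1, hy.2.le.trans hx1.2⟩, not_lt.1 h⟩) (not_le.2 hy.2)
    have hqx : q x = 0 := le_antisymm (by
      refine le_of_tendsto ((hqc x (hin x hx1)).tendsto.mono_left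
        (nhdsWithin_le_nhds (s := Iio x))) ?_
      filter_upwards [Ioo_mem_nhdsLT hx0] with y hy using (hneg y ⟨hy.1.le, hy.2⟩).le) hx2
    have hpx : p x < 0 := by
      have : StrictAntiOn p (Icc 0 x) := strictAntiOn_of_deriv_neg (convex_Icc _ _)
        (fun y hy => (hpd y (hin y ⟨hy.1, hy.2.trans hx1.2⟩)).continuousAt.continuousWithinAt)
        fun y hy => by
          rw [interior_Icc] at hy
          rw [(hpd y (hin y ⟨hy.1.le, hy.2.le.trans hx1.2⟩)).deriv]
          exact hneg y ⟨hy.1.le, hy.2⟩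
      have := this ⟨le_rfl, hx0.le⟩ ⟨hx0.le, le_rfl⟩ hx0
      rwa [hp0] at this
    have h5 := deriv_nonneg_of_le_left hx0 (hqd x (hin x hx1))
      fun y hy => by rw [hqx]; exact (hneg y ⟨hy.1.le, hy.2⟩).le
    have h6 := hcrit x (hin x hx1) hqx
    nlinarith [Real.exp_pos x]

/-! ### Continuation along the real axis -/

theorem IsOrbit.eqOn_inter {c : ℝ} {Ω Ω' : Set ℂ} {P Q g : ℂ → ℂ} (hΩ : IsOpen Ω)
    (hΩ' : IsOpen Ω') (hc : Convex ℝ Ω) (hc' : Convex ℝ Ω') (hP : IsOrbit c Ω P)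
    (hQ : IsOrbit c Ω' Q) (h0 : 0 ∈ Ω) (h0' : 0 ∈ Ω') (hPg : P =ᶠ[𝓝 0] g) (hQg : Q =ᶠ[𝓝 0] g) :
    EqOn P Q (Ω ∩ Ω') :=
  (hP.mono inter_subset_left).eqOn_of_eventuallyEq (hΩ.inter hΩ')
    (hc.inter hc').isPreconnected (hQ.mono inter_subset_right) ⟨h0, h0'⟩ (hPg.trans hQg.symm)

theorem zero_mem_box {L a b : ℝ} (hL : 0 < L) (ha : a < 0) (hb : 0 < b) : (0 : ℂ) ∈ box L a b :=
  ⟨by simpa using hL, by simpa using ha, by simpa using hb⟩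

section RealAxis

variable {c r L a b : ℝ} {P : ℂ → ℂ}

theorem IsOrbit.hasDerivAt_re (hP : IsOrbit c (box L a b) P) (ha : a < 0) (hb : 0 < b) {σ : ℝ}
    (hσ : |σ| < L) : HasDerivAt (fun x : ℝ => (P x).re) (deriv P σ).re σ :=
  ((hP.1.differentiableAt ((isOpen_box L a b).mem_nhds
    (ofReal_mem_box ha hb hσ))).hasDerivAt).real_of_complex

theorem IsOrbit.re_ode (hc : 0 < c) (hr : 0 < r) (hP : IsOrbit c (box L a b) P)
    (hg : P =ᶠ[𝓝 0] sepGerm c r) (ha : a < 0) (hb : 0 < b) {σ : ℝ} (hσ : |σ| < L) :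
    (P σ).re * (deriv P σ).re = c * (P σ).re - (P σ).re ^ 2 - 1 + Real.exp σ := by
  obtain ⟨h1, h2, -⟩ := hP.real_axis hc hr hg ha hb hσ
  have h := hP.2 σ (ofReal_mem_box ha hb hσ)
  rw [h1, h2, ← Complex.ofReal_exp] at h
  simpa using (by exact_mod_cast h : _ * _ = _)

theorem IsOrbit.strictAntiOn_re (hc : 0 < c) (hr : 0 < r) (hP : IsOrbit c (box L a b) P)
    (hg : P =ᶠ[𝓝 0] sepGerm c r) (ha : a < 0) (hb : 0 < b) :
    StrictAntiOn (fun x : ℝ => (P x).re) (Ioo (-L) L) := by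
  refine strictAntiOn_of_deriv_neg (convex_Ioo _ _) (fun x hx =>
    (hP.hasDerivAt_re ha hb (abs_lt.2 hx)).continuousAt.continuousWithinAt) fun x hx => ?_
  rw [interior_Ioo] at hx
  rw [(hP.hasDerivAt_re ha hb (abs_lt.2 hx)).deriv]
  exact (hP.real_axis hc hr hg ha hb (abs_lt.2 hx)).2.2

theorem re_zero_of_germ (hg : P =ᶠ[𝓝 0] sepGerm c r) : (P (0 : ℝ)).re = 0 := by
  simp [hg.self_of_nhds, sepGerm, sepFun]

theorem IsOrbit.re_pos (hc : 0 < c) (hr : 0 < r) (hP : IsOrbit c (box L a b) P)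
    (hg : P =ᶠ[𝓝 0] sepGerm c r) (ha : a < 0) (hb : 0 < b) {σ : ℝ} (hσ : |σ| < L) (h0 : σ < 0) :
    0 < (P σ).re := by
  have hL : 0 < L := (abs_nonneg σ).trans_lt hσ
  have := hP.strictAntiOn_re hc hr hg ha hb (abs_lt.1 hσ) ⟨by linarith, hL⟩ h0
  simpa only [re_zero_of_germ hg] using this

theorem IsOrbit.re_neg (hc : 0 < c) (hr : 0 < r) (hP : IsOrbit c (box L a b) P)
    (hg : P =ᶠ[𝓝 0] sepGerm c r) (ha : a < 0) (hb : 0 < b) {σ : ℝ} (hσ : |σ| < L) (h0 : 0 < σ) :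
    (P σ).re < 0 := by
  have hL : 0 < L := (abs_nonneg σ).trans_lt hσ
  have := hP.strictAntiOn_re hc hr hg ha hb ⟨by linarith, hL⟩ (abs_lt.1 hσ) h0
  simpa only [re_zero_of_germ hg] using this

/-- This is where `c ≥ 2` is used: at a point with `P = c / 2` the equation would give
`P P' = c² / 4 - 1 + e^τ > 0`. -/
theorem IsOrbit.re_lt (hc : 2 ≤ c) (hr : 0 < r) (hP : IsOrbit c (box L a b) P)
    (hg : P =ᶠ[𝓝 0] sepGerm c r) (ha : a < 0) (hb : 0 < b) {σ : ℝ} (hσ : |σ| < L) (h0 : σ < 0) :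
    (P σ).re < c / 2 := by
  have hc0 : 0 < c := by linarith
  by_contra hcon
  have hcont : ContinuousOn (fun x : ℝ => (P x).re) (Icc σ 0) := fun x hx =>
    (hP.hasDerivAt_re ha hb ((abs_lt.2 ⟨by linarith [(abs_lt.1 hσ).1, hx.1],
      by linarith [(abs_lt.1 hσ).1, hx.2]⟩))).continuousAt.continuousWithinAt
  obtain ⟨x, hx, hpx⟩ := intermediate_value_Icc' h0.le hcont
    (show c / 2 ∈ Icc _ _ from ⟨by simp only [re_zero_of_germ hg]; linarith, not_lt.1 hcon⟩)
  have hxL : |x| < L := abs_lt.2 ⟨by linarith [(abs_lt.1 hσ).1, hx.1],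
      by linarith [(abs_lt.1 hσ).1, hx.2]⟩
  have h1 := hP.re_ode hc0 hr hg ha hb hxL
  have h2 := (hP.real_axis hc0 hr hg ha hb hxL).2.2
  simp only at hpx
  rw [hpx] at h1
  nlinarith [Real.exp_pos x]

theorem IsOrbit.re_sq_le (hc : 0 < c) (hr : 0 < r) (hP : IsOrbit c (box L a b) P)
    (hg : P =ᶠ[𝓝 0] sepGerm c r) (ha : a < 0) (hb : 0 < b) {σ : ℝ} (hσ : |σ| < L) (h0 : 0 < σ) :
    (P σ).re ^ 2 ≤ Real.exp σ := by
  have h1 := hP.re_ode hc hr hg ha hb hσ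
  have h2 := (hP.real_axis hc hr hg ha hb hσ).2.2
  have h3 := hP.re_neg hc hr hg ha hb hσ h0
  nlinarith

theorem IsOrbit.norm_le (hc : 2 ≤ c) (hr : 0 < r) (hP : IsOrbit c (box L a b) P)
    (hg : P =ᶠ[𝓝 0] sepGerm c r) (ha : a < 0) (hb : 0 < b) {σ : ℝ} (hσ : |σ| < L) :
    ‖P σ‖ ≤ c / 2 + Real.exp L := by
  have hc0 : 0 < c := by linarith
  rw [(hP.real_axis hc0 hr hg ha hb hσ).1, Complex.norm_real, Real.norm_eq_abs]
  rcases lt_trichotomy σ 0 with h | h | h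
  · rw [abs_of_pos (hP.re_pos hc0 hr hg ha hb hσ h)]
    linarith [hP.re_lt hc hr hg ha hb hσ h, Real.exp_pos L]
  · rw [h, re_zero_of_germ hg, abs_zero]; positivity
  · have h1 := hP.re_sq_le hc0 hr hg ha hb hσ h
    have h2 : Real.exp σ ≤ Real.exp L ^ 2 := by
      rw [← Real.exp_nat_mul]; apply Real.exp_le_exp.2
      push_cast; linarith [(abs_lt.1 hσ).2]
    have := abs_le_of_sq_le_sq' (h1.trans h2) (Real.exp_pos L).le
    have := abs_le.2 this
    linarith

end RealAxis

/-- The separatrix continues holomorphically to a neighbourhood of any bounded piece of the real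
axis: monotonicity keeps it away from `0` and it stays bounded, so the local solutions have a
common radius. -/
theorem exists_orbit_real {c r : ℝ} (hc : 2 ≤ c) (hr : 0 < r) (hcr : r ^ 2 + c * r = 1) (L : ℝ) :
    ∃ κ > 0, ∃ P, IsOrbit c (box L (-κ) κ) P ∧ P =ᶠ[𝓝 0] sepGerm c r := by
  have hc0 : 0 < c := by linarith
  obtain ⟨ε₀, hε₀, hgerm⟩ := exists_isOrbit_sepGerm hc0 hr hcr
  set ε := ε₀ / 2 with hε
  have hε0 : 0 < ε := half_pos hε₀
  have hgb : IsOrbit c (box ε (-ε) ε) (sepGerm c r) := by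
    refine hgerm.mono fun τ hτ => ?_
    rw [mem_ball_zero_iff]
    have := Complex.norm_le_abs_re_add_abs_im τ
    have := abs_lt.2 hτ.2
    have := hτ.1
    linarith
  have hlt : |ε / 2| < ε := by rw [abs_of_pos (by linarith)]; linarith
  have hlt' : |-(ε / 2)| < ε := by rwa [abs_neg]
  set δ := min (-(sepGerm c r ((ε / 2 : ℝ) : ℂ)).re) (sepGerm c r ((-(ε / 2) : ℝ) : ℂ)).re with hδ
  have hδ0 : 0 < δ := lt_min
    (neg_pos.2 (hgb.re_neg hc0 hr .rfl (by linarith) hε0 hlt (by linarith)))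
    (hgb.re_pos hc0 hr .rfl (by linarith) hε0 hlt' (by linarith))
  obtain ⟨ρ₀, hρ₀, hlocal⟩ := exists_local_orbit c hδ0 (c / 2 + Real.exp (L + 1)) (L + 1)
  set ρ := min ρ₀ (min ε 1) with hρ
  have hρ0 : 0 < ρ := by positivity
  have hρε : ρ ≤ ε := (min_le_right _ _).trans (min_le_left _ _)
  have hρ1 : ρ ≤ 1 := (min_le_right _ _).trans (min_le_right _ _)
  have main : ∀ n : ℕ, ε + n * (ρ / 2) ≤ L + 1 → ∃ κ > 0, ∃ P,
      IsOrbit c (box (ε + n * (ρ / 2)) (-κ) κ) P ∧ P =ᶠ[𝓝 0] sepGerm c r := by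
    intro n
    induction n with
    | zero => exact fun _ => ⟨ε, hε0, sepGerm c r, by simpa using hgb, .rfl⟩
    | succ n ih =>
      intro hn
      set L₁ := ε + n * (ρ / 2) with hL₁
      have e1 : ε + ((n + 1 : ℕ) : ℝ) * (ρ / 2) = L₁ + ρ / 2 := by push_cast; ring
      rw [e1] at hn ⊢
      have hεL : ε ≤ L₁ := by rw [hL₁]; nlinarith [(Nat.cast_nonneg n : (0 : ℝ) ≤ n)]
      obtain ⟨κ, hκ, P, hP, hPg⟩ := ih (by linarith)
      have hκ' : -κ < 0 := by linarith
      have heq : ∀ σ : ℝ, |σ| < ε → P σ = sepGerm c r σ := fun σ hσ =>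
        hP.eqOn_inter (isOpen_box _ _ _) (isOpen_box _ _ _) (convex_box _ _ _) (convex_box _ _ _)
          hgb (zero_mem_box (by linarith) hκ' hκ) (zero_mem_box hε0 (by linarith) hε0) hPg .rfl
          ⟨ofReal_mem_box hκ' hκ (hσ.trans_le hεL), ofReal_mem_box (by linarith) hε0 hσ⟩
      have hlow : ∀ σ : ℝ, |σ| < L₁ → ε / 2 ≤ |σ| → δ ≤ ‖P σ‖ := by
        intro σ h1 h2
        have hanti := (hP.strictAntiOn_re hc0 hr hPg hκ' hκ).antitoneOn
        rcases le_or_gt 0 σ with h | h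
        · rw [abs_of_nonneg h] at h1 h2
          have h3 := hanti (⟨by linarith, by linarith⟩ : ε / 2 ∈ Ioo (-L₁) L₁)
            ⟨by linarith, h1⟩ h2
          simp only [heq _ hlt] at h3
          calc δ ≤ -(sepGerm c r ((ε / 2 : ℝ) : ℂ)).re := min_le_left _ _
            _ ≤ -(P σ).re := neg_le_neg h3
            _ ≤ |(P σ).re| := neg_le_abs _
            _ ≤ _ := Complex.abs_re_le_norm _
        · rw [abs_of_neg h] at h1 h2
          have h3 := hanti (⟨by linarith, by linarith⟩ : σ ∈ Ioo (-L₁) L₁)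
            (⟨by linarith, by linarith⟩ : -(ε / 2) ∈ Ioo (-L₁) L₁) (by linarith)
          simp only [heq _ hlt'] at h3
          calc δ ≤ (sepGerm c r ((-(ε / 2) : ℝ) : ℂ)).re := min_le_right _ _
            _ ≤ (P σ).re := h3
            _ ≤ |(P σ).re| := le_abs_self _
            _ ≤ _ := Complex.abs_re_le_norm _
      set X : Set ℂ := (fun σ : ℝ => (σ : ℂ)) '' {σ | |σ| < L₁ ∧ ε / 2 ≤ |σ|} with hX
      obtain ⟨P', hP', hPP'⟩ := hP.exists_extension (X := X) (ρ := ρ) (isOpen_box _ _ _)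
        (convex_box _ _ _)
        (by rintro _ ⟨σ, ⟨h1, -⟩, rfl⟩; exact ofReal_mem_box hκ' hκ h1)
        (by
          rintro _ ⟨σ, ⟨h1, h2⟩, rfl⟩
          have h3 := hlow σ h1 h2
          have h4 := hP.norm_le hc hr hPg hκ' hκ h1
          refine ⟨norm_pos_iff.1 (hδ0.trans_le h3), ?_⟩
          obtain ⟨q, hq1, hq2⟩ := hlocal σ (P σ) h3 (h4.trans (by gcongr; linarith))
            (by rw [Complex.ofReal_re]; linarith [le_abs_self σ])
          exact ⟨q, hq1.mono (Metric.ball_subset_ball (min_le_left _ _)), hq2⟩)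
      refine ⟨min κ (ρ / 2), by positivity, P', hP'.mono ?_, ?_⟩
      · intro τ hτ
        by_cases h : |τ.re| < L₁
        · exact Or.inl ⟨h, by linarith [hτ.2.1, min_le_left κ (ρ / 2)],
            hτ.2.2.trans_le (min_le_left _ _)⟩
        · right
          have him : |τ.im| < ρ / 2 := by
            have := abs_lt.2 hτ.2; exact this.trans_le (min_le_right _ _)
          have hre := hτ.1
          have key : ∀ σ : ℝ, |σ| = L₁ - ρ / 4 → |τ.re - σ| < 3 * ρ / 4 →
              τ ∈ ⋃ x ∈ X, Metric.ball x ρ := by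
            intro σ h1 h2
            refine mem_iUnion₂.2 ⟨σ, ⟨σ, ⟨by rw [h1]; linarith, by rw [h1]; linarith⟩, rfl⟩, ?_⟩
            rw [Metric.mem_ball, Complex.dist_eq]
            refine lt_of_pow_lt_pow_left₀ 2 hρ0.le ?_
            rw [Complex.sq_norm, Complex.normSq_apply]
            simp only [Complex.sub_re, Complex.ofReal_re, Complex.sub_im, Complex.ofReal_im,
              sub_zero]
            nlinarith [abs_lt.1 h2, abs_lt.1 him]
          rcases le_or_gt 0 τ.re with h0 | h0
          · rw [abs_of_nonneg h0] at h hre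
            exact key (L₁ - ρ / 4) (abs_of_pos (by linarith))
              (abs_lt.2 ⟨by linarith, by linarith⟩)
          · rw [abs_of_neg h0] at h hre
            exact key (-(L₁ - ρ / 4)) (by rw [abs_neg]; exact abs_of_pos (by linarith))
              (abs_lt.2 ⟨by linarith, by linarith⟩)
      · refine EventuallyEq.trans ?_ hPg
        exact hPP'.eventuallyEq_of_mem ((isOpen_box _ _ _).mem_nhds
          (zero_mem_box (by linarith) hκ' hκ))
  rcases le_or_gt L ε with h | h
  · exact ⟨ε, hε0, sepGerm c r, hgb.mono (box_mono h le_rfl le_rfl), .rfl⟩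
  · obtain ⟨κ, hκ, P, hP, hPg⟩ := main ⌈(L - ε) / (ρ / 2)⌉₊ (by
      have := (Nat.ceil_lt_add_one (show 0 ≤ (L - ε) / (ρ / 2) by
        apply div_nonneg <;> linarith)).le
      have h2 := mul_le_mul_of_nonneg_right this (by linarith : 0 ≤ ρ / 2)
      rw [add_mul, div_mul_cancel₀ _ (by linarith : ρ / 2 ≠ 0)] at h2
      linarith)
    refine ⟨κ, hκ, P, hP.mono (box_mono ?_ le_rfl le_rfl), hPg⟩
    have := mul_le_mul_of_nonneg_right (Nat.le_ceil ((L - ε) / (ρ / 2)))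
      (by linarith : 0 ≤ ρ / 2)
    rw [div_mul_cancel₀ _ (by linarith : ρ / 2 ≠ 0)] at this
    linarith

/-! ### Asymptotics at the two ends of the real axis -/

/-- The separatrix along the whole real `τ`-axis: `p` is its ratio `-v / u` and `q = p'`. -/
structure RealSeparatrix (c r : ℝ) (p q : ℝ → ℝ) : Prop where
  eq_of_orbit : ∀ {L a b : ℝ} {P : ℂ → ℂ}, a < 0 → 0 < b → IsOrbit c (box L a b) P →
    P =ᶠ[𝓝 0] sepGerm c r → ∀ σ : ℝ, |σ| < L → P σ = p σ
  hasDerivAt : ∀ σ, HasDerivAt p (q σ) σ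
  ode : ∀ σ, p σ * q σ = c * p σ - p σ ^ 2 - 1 + Real.exp σ
  q_neg : ∀ σ, q σ < 0
  zero : p 0 = 0
  pos : ∀ σ < 0, 0 < p σ
  lt_half : ∀ σ < 0, p σ < c / 2
  neg : ∀ σ > 0, p σ < 0
  sq_le : ∀ σ > 0, p σ ^ 2 ≤ Real.exp σ

/-- The solutions on the intervals `|σ| < L` agree by the identity theorem and glue to the whole
axis. -/
theorem exists_realSeparatrix {c r : ℝ} (hc : 2 ≤ c) (hr : 0 < r) (hcr : r ^ 2 + c * r = 1) :
    ∃ p q, RealSeparatrix c r p q := by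
  have hc0 : 0 < c := by linarith
  choose κ hκ P hP hg using exists_orbit_real hc hr hcr
  have hκ' : ∀ L, -κ L < 0 := fun L => neg_neg_of_pos (hκ L)
  have hlt : ∀ σ : ℝ, |σ| < |σ| + 1 := fun σ => lt_add_one _
  have hreal : ∀ σ : ℝ, P (|σ| + 1) σ = ((P (|σ| + 1) σ).re : ℝ) := fun σ =>
    ((hP _).real_axis hc0 hr (hg _) (hκ' _) (hκ _) (hlt σ)).1
  have hagree : ∀ {L a b : ℝ} {Q : ℂ → ℂ}, a < 0 → 0 < b → IsOrbit c (box L a b) Q →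
      Q =ᶠ[𝓝 0] sepGerm c r → ∀ σ : ℝ, |σ| < L → Q σ = P (|σ| + 1) σ := by
    intro L a b Q ha hb hQ hQg σ hσ
    exact hQ.eqOn_inter (isOpen_box _ _ _) (isOpen_box _ _ _) (convex_box _ _ _)
      (convex_box _ _ _) (hP (|σ| + 1)) (zero_mem_box ((abs_nonneg σ).trans_lt hσ) ha hb)
      (zero_mem_box (by positivity) (hκ' _) (hκ _)) hQg (hg _)
      ⟨ofReal_mem_box ha hb hσ, ofReal_mem_box (hκ' _) (hκ _) (hlt σ)⟩
  refine ⟨fun σ => (P (|σ| + 1) σ).re, fun σ => (deriv (P (|σ| + 1)) σ).re, ?_, ?_, ?_, ?_, ?_, ?_,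
    ?_, ?_, ?_⟩
  · intro L a b Q ha hb hQ hQg σ hσ
    rw [hagree ha hb hQ hQg σ hσ]; exact hreal σ
  · intro σ
    refine ((hP (|σ| + 1)).hasDerivAt_re (hκ' _) (hκ _) (hlt σ)).congr_of_eventuallyEq ?_
    filter_upwards [continuous_abs.continuousAt.eventually_lt_const (hlt σ)] with x hx
    rw [hagree (hκ' _) (hκ _) (hP (|σ| + 1)) (hg _) x hx]
  · exact fun σ => (hP _).re_ode hc0 hr (hg _) (hκ' _) (hκ _) (hlt σ)
  · exact fun σ => ((hP _).real_axis hc0 hr (hg _) (hκ' _) (hκ _) (hlt σ)).2.2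
  · exact re_zero_of_germ (hg _)
  · exact fun σ hσ => (hP _).re_pos hc0 hr (hg _) (hκ' _) (hκ _) (hlt σ) hσ
  · exact fun σ hσ => (hP _).re_lt hc hr (hg _) (hκ' _) (hκ _) (hlt σ) hσ
  · exact fun σ hσ => (hP _).re_neg hc0 hr (hg _) (hκ' _) (hκ _) (hlt σ) hσ
  · exact fun σ hσ => (hP _).re_sq_le hc0 hr (hg _) (hκ' _) (hκ _) (hlt σ) hσ

namespace RealSeparatrix

variable {c r : ℝ} {p q : ℝ → ℝ}

theorem strictAnti (h : RealSeparatrix c r p q) : StrictAnti p :=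
  strictAnti_of_deriv_neg fun σ => by rw [(h.hasDerivAt σ).deriv]; exact h.q_neg σ

/-- At the node the separatrix is tangent to an eigenvector: `p` is monotone and bounded, so it
converges, and its limit is a stationary point of the limiting equation `p' = c - p - 1 / p`. -/
theorem exists_tendsto_atBot (h : RealSeparatrix c r p q) :
    ∃ p₀ > 0, p₀ + 1 / p₀ = c ∧ Tendsto p atBot (𝓝 p₀) := by
  have hbdd : BddAbove (range p) := by
    refine ⟨max (c / 2) 0, ?_⟩
    rintro _ ⟨σ, rfl⟩
    rcases lt_trichotomy σ 0 with hs | hs | hs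
    · exact (h.lt_half σ hs).le.trans (le_max_left _ _)
    · rw [hs, h.zero]; exact le_max_right _ _
    · exact (h.neg σ hs).le.trans (le_max_right _ _)
  have hlim := tendsto_atBot_ciSup h.strictAnti.antitone hbdd
  set p₀ := ⨆ i, p i
  have hp₀ : 0 < p₀ := (h.pos (-1) (by norm_num)).trans_le (le_ciSup hbdd (-1))
  refine ⟨p₀, hp₀, ?_, hlim⟩
  have hq : Tendsto q atBot (𝓝 (c - p₀ - (1 - 0) / p₀)) := by
    have h1 : Tendsto (fun σ => c - p σ - (1 - Real.exp σ) / p σ) atBot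
        (𝓝 (c - p₀ - (1 - 0) / p₀)) :=
      (hlim.const_sub c).sub ((Real.tendsto_exp_atBot.const_sub 1).div hlim hp₀.ne')
    refine h1.congr' ?_
    filter_upwards [eventually_lt_atBot 0] with σ hσ
    have := (h.pos σ hσ).ne'
    field_simp
    linear_combination -h.ode σ
  have hmvt : ∀ σ, ∃ ξ ∈ Ioo (σ - 1) σ, q ξ = p σ - p (σ - 1) := by
    intro σ
    obtain ⟨ξ, hξ, he⟩ := exists_hasDerivAt_eq_slope p q (sub_one_lt σ)
      (fun x _ => (h.hasDerivAt x).continuousAt.continuousWithinAt) fun x _ => h.hasDerivAt x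
    exact ⟨ξ, hξ, by rw [he]; simp⟩
  choose ξ hξ hqξ using hmvt
  have hξlim : Tendsto ξ atBot atBot :=
    tendsto_atBot_mono (fun σ => (hξ σ).2.le) tendsto_id
  have h1 := hq.comp hξlim
  have h2 : Tendsto (fun σ => p σ - p (σ - 1)) atBot (𝓝 (p₀ - p₀)) :=
    hlim.sub (hlim.comp (tendsto_atBot_add_const_right _ (-1) tendsto_id))
  have h3 := tendsto_nhds_unique (h1.congr hqξ) h2
  rw [sub_self, sub_zero] at h3
  linarith

/-- Towards `u = ∞` one has `p² ~ 2 u / 3`: the function `(p² e^{-τ} - 2 / 3) e^{3 τ}` has a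
derivative of smaller order than `e^{3 τ}`. -/
theorem tendsto_atTop (h : RealSeparatrix c r p q) (hc : 0 < c) :
    Tendsto (fun σ => p σ ^ 2 / Real.exp σ) atTop (𝓝 (2 / 3)) := by
  set ψ : ℝ → ℝ := fun σ => p σ ^ 2 * Real.exp (2 * σ) - 2 / 3 * Real.exp (3 * σ) with hψ
  have hexp : ∀ k σ : ℝ, HasDerivAt (fun σ => Real.exp (k * σ)) (k * Real.exp (k * σ)) σ := by
    intro k σ
    simpa [mul_comm] using ((hasDerivAt_id σ).const_mul k).exp
  have hψd : ∀ σ, HasDerivAt ψ ((2 * c * p σ - 2) * Real.exp (2 * σ)) σ := by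
    intro σ
    refine ((((h.hasDerivAt σ).pow 2).mul (hexp 2 σ)).sub
      ((hexp 3 σ).const_mul (2 / 3))).congr_deriv ?_
    have e : Real.exp (3 * σ) = Real.exp σ * Real.exp (2 * σ) := by rw [← Real.exp_add]; ring_nf
    rw [e]
    simp only [Pi.pow_apply]
    push_cast
    linear_combination (2 * Real.exp (2 * σ)) * h.ode σ
  set C := 2 * c + 2 with hC
  have hbound : ∀ σ ≥ 0, ‖ψ σ‖ ≤ ‖ψ 0‖ + C * Real.exp (5 / 2 * σ) := by
    intro σ hσ
    have := image_norm_le_of_norm_deriv_right_le_deriv_boundary (f := ψ) (a := 0) (b := σ)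
      (B := fun x => ‖ψ 0‖ + C * Real.exp (5 / 2 * x))
      (fun x _ => (hψd x).continuousAt.continuousWithinAt) (fun x _ => (hψd x).hasDerivWithinAt)
      (le_add_of_nonneg_right (by positivity))
      (fun x => ((hexp (5 / 2) x).const_mul C).const_add _) (fun x hx => ?_)
    · exact this ⟨hσ, le_rfl⟩
    · rw [norm_mul, Real.norm_eq_abs, Real.norm_eq_abs, Real.abs_exp]
      have e : Real.exp (5 / 2 * x) = Real.exp (x / 2) * Real.exp (2 * x) := by
        rw [← Real.exp_add]; ring_nf
      have h1 : 1 ≤ Real.exp (x / 2) := Real.one_le_exp (by linarith [hx.1])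
      have hp : |p x| ≤ Real.exp (x / 2) := by
        rcases hx.1.eq_or_lt with h0 | h0
        · rw [← h0, h.zero, abs_zero]; positivity
        · refine abs_le_of_sq_le_sq ?_ (by positivity)
          rw [← Real.exp_nat_mul]; push_cast
          rw [mul_div_cancel₀ _ (two_ne_zero)]
          exact h.sq_le x h0
      have h2 : |2 * c * p x - 2| ≤ C * Real.exp (x / 2) := by
        refine (abs_sub _ _).trans ?_
        rw [abs_mul, abs_of_pos (by positivity : 0 < 2 * c), abs_two]
        nlinarith
      calc _ ≤ C * Real.exp (x / 2) * Real.exp (2 * x) := by gcongr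
        _ ≤ C * (5 / 2 * Real.exp (5 / 2 * x)) := by
          rw [e]
          have : 0 < Real.exp (x / 2) * Real.exp (2 * x) := by positivity
          have hC0 : 0 < C := by positivity
          nlinarith [mul_pos hC0 this]
  rw [tendsto_iff_norm_sub_tendsto_zero]
  have hz : Tendsto (fun σ : ℝ => ‖ψ 0‖ * Real.exp (-3 * σ) + C * Real.exp (-(1 / 2) * σ)) atTop
      (𝓝 0) := by
    have hk : ∀ k : ℝ, k < 0 → Tendsto (fun σ : ℝ => Real.exp (k * σ)) atTop (𝓝 0) := fun k hk =>
      Real.tendsto_exp_atBot.comp (tendsto_id.const_mul_atTop_of_neg hk)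
    simpa using ((hk (-3) (by norm_num)).const_mul ‖ψ 0‖).add
      ((hk (-(1 / 2)) (by norm_num)).const_mul C)
  refine squeeze_zero' (.of_forall fun _ => norm_nonneg _) ?_ hz
  filter_upwards [eventually_ge_atTop 0] with σ hσ
  have e1 : p σ ^ 2 / Real.exp σ - 2 / 3 = ψ σ * Real.exp (-3 * σ) := by
    have a1 : Real.exp (2 * σ) = Real.exp σ ^ 2 := by rw [← Real.exp_nat_mul]; norm_num
    have a2 : Real.exp (3 * σ) = Real.exp σ ^ 3 := by rw [← Real.exp_nat_mul]; norm_num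
    have a3 : Real.exp (-3 * σ) = (Real.exp σ ^ 3)⁻¹ := by
      rw [← a2, ← Real.exp_neg]; ring_nf
    rw [hψ, a3]; simp only [a1, a2]; field_simp
  rw [e1, norm_mul, Real.norm_eq_abs (Real.exp _), Real.abs_exp]
  calc _ ≤ (‖ψ 0‖ + C * Real.exp (5 / 2 * σ)) * Real.exp (-3 * σ) := by
        gcongr; exact hbound σ hσ
    _ = _ := by
      rw [add_mul, mul_assoc, ← Real.exp_add]; ring_nf

end RealSeparatrix

/-! ### A priori bounds and the sign of the imaginary part -/

section Vertical

variable {c r L a b : ℝ} {P : ℂ → ℂ}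

theorem vertical_mem_box {σ θ : ℝ} (hσ : |σ| < L) (ha : a < θ) (hb : θ < b) :
    (σ + θ * Complex.I : ℂ) ∈ box L a b := by
  refine ⟨?_, ?_, ?_⟩ <;> simpa

theorem norm_exp_vertical (σ θ : ℝ) : ‖Complex.exp (σ + θ * Complex.I)‖ = Real.exp σ := by
  rw [Complex.norm_exp]; simp

theorem IsOrbit.hasDerivAt_vertical {Ω : Set ℂ} (hΩ : IsOpen Ω) (hP : IsOrbit c Ω P) {σ θ : ℝ}
    (h : (σ + θ * Complex.I : ℂ) ∈ Ω) :
    HasDerivAt (fun x : ℝ => P (σ + x * Complex.I))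
      (Complex.I * deriv P (σ + θ * Complex.I)) θ := by
  have h1 : HasDerivAt (fun z : ℂ => (σ : ℂ) + z * Complex.I) Complex.I (θ : ℂ) := by
    simpa using ((hasDerivAt_id (θ : ℂ)).mul_const Complex.I).const_add (σ : ℂ)
  have h2 := (hP.1.differentiableAt (hΩ.mem_nhds h)).hasDerivAt.comp (θ : ℂ) h1
  rw [mul_comm]
  exact h2.comp_ofReal

theorem IsOrbit.hasDerivAt_horizontal {Ω : Set ℂ} (hΩ : IsOpen Ω) (hP : IsOrbit c Ω P) {σ θ : ℝ}
    (h : (σ + θ * Complex.I : ℂ) ∈ Ω) :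
    HasDerivAt (fun x : ℝ => P (x + θ * Complex.I)) (deriv P (σ + θ * Complex.I)) σ := by
  have h1 : HasDerivAt (fun z : ℂ => z + θ * Complex.I) 1 (σ : ℂ) :=
    (hasDerivAt_id (σ : ℂ)).add_const _
  have h2 := (hP.1.differentiableAt (hΩ.mem_nhds h)).hasDerivAt.comp (σ : ℂ) h1
  rw [mul_one] at h2
  exact h2.comp_ofReal

/-- A priori bound near the node: along vertical segments of length at most `π` far to the left the
solution stays close to the stationary value `p₀`. -/
theorem IsOrbit.norm_sub_le_left (hP : IsOrbit c (box L a b) P) (ha : a < 0) (hb : b ≤ Real.pi)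
    {p₀ η σ : ℝ} (hp₀ : 0 < p₀) (hpc : p₀ + 1 / p₀ = c)
    (hη : η * Real.exp ((2 + 2 / p₀ ^ 2) * Real.pi) ≤ p₀ / 2) (hσ : |σ| < L)
    (h0 : ‖P σ - p₀‖ ≤ η) (hσ' : 2 * Real.exp σ / p₀ < η) {θ : ℝ} (hθ : 0 ≤ θ) (hθb : θ < b) :
    ‖P (σ + θ * Complex.I) - p₀‖ ≤ p₀ / 2 := by
  set K := 2 + 2 / p₀ ^ 2 with hK
  have hη0 : 0 < η := lt_of_le_of_lt (by positivity) hσ'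
  have hmem : ∀ x ∈ Icc 0 θ, (σ + x * Complex.I : ℂ) ∈ box L a b := fun x hx =>
    vertical_mem_box hσ (ha.trans_le hx.1) (hx.2.trans_lt hθb)
  have hd : ∀ x ∈ Icc 0 θ, HasDerivAt (fun x : ℝ => P (σ + x * Complex.I) - p₀)
      (Complex.I * deriv P (σ + x * Complex.I)) x := fun x hx =>
    (hP.hasDerivAt_vertical (isOpen_box _ _ _) (hmem x hx)).sub_const _
  have hBd : ∀ x : ℝ, HasDerivAt (fun x => η * Real.exp (K * x)) (η * (K * Real.exp (K * x))) x := by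
    intro x
    simpa [mul_comm] using (((hasDerivAt_id x).const_mul K).exp).const_mul η
  have hBle : ∀ x ∈ Icc 0 θ, η * Real.exp (K * x) ≤ p₀ / 2 := fun x hx => by
    refine le_trans ?_ hη
    have : x ≤ Real.pi := by linarith [hx.2]
    gcongr
  refine (image_norm_le_of_norm_deriv_right_lt_deriv_boundary
    (fun x hx => (hd x hx).continuousAt.continuousWithinAt)
    (fun x hx => (hd x ⟨hx.1, hx.2.le⟩).hasDerivWithinAt) (B := fun x => η * Real.exp (K * x))
    (by simpa using h0) hBd (fun x hx hxB => ?_) ⟨hθ, le_rfl⟩).trans (hBle θ ⟨hθ, le_rfl⟩)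
  have hx' : x ∈ Icc 0 θ := ⟨hx.1, hx.2.le⟩
  set z := (σ + x * Complex.I : ℂ) with hz
  set f := P z - p₀ with hf
  have hfle : ‖f‖ ≤ p₀ / 2 := hxB.trans_le (hBle x hx')
  have hPlow : p₀ / 2 ≤ ‖P z‖ := by
    have h1 := norm_sub_norm_le (p₀ : ℂ) (P z)
    rw [norm_sub_rev, Complex.norm_real, Real.norm_eq_abs, abs_of_pos hp₀] at h1
    linarith
  have hPne : P z ≠ 0 := norm_pos_iff.1 (lt_of_lt_of_le (by positivity) hPlow)
  have hp₀' : (p₀ : ℂ) ≠ 0 := by exact_mod_cast hp₀.ne'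
  have hder : deriv P z = -f + f / (p₀ * P z) + Complex.exp z / P z := by
    have h1 := hP.2 z (hmem x hx')
    have h2 : (c : ℂ) = p₀ + 1 / p₀ := by rw [← hpc]; push_cast; ring
    rw [h2] at h1
    rw [hf]
    field_simp
    field_simp at h1
    linear_combination h1
  rw [norm_mul, Complex.norm_I, one_mul, hder]
  have hηB : η ≤ η * Real.exp (K * x) :=
    le_mul_of_one_le_right hη0.le (Real.one_le_exp (mul_nonneg (by positivity) hx.1))
  have t1 : ‖f / (p₀ * P z)‖ ≤ ‖f‖ * (2 / p₀ ^ 2) := by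
    rw [norm_div, norm_mul, Complex.norm_real, Real.norm_eq_abs, abs_of_pos hp₀]
    calc _ ≤ ‖f‖ / (p₀ * (p₀ / 2)) := by gcongr
      _ = _ := by field_simp
  have t2 : ‖Complex.exp z / P z‖ ≤ 2 * Real.exp σ / p₀ := by
    rw [norm_div, hz, norm_exp_vertical]
    calc _ ≤ Real.exp σ / (p₀ / 2) := by gcongr
      _ = _ := by field_simp
  calc _ ≤ ‖f‖ + ‖f / (p₀ * P z)‖ + ‖Complex.exp z / P z‖ := by
        refine (norm_add_le _ _).trans (add_le_add_left ((norm_add_le _ _).trans ?_) _)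
        rw [norm_neg]
    _ < ‖f‖ + ‖f‖ * (2 / p₀ ^ 2) + η * Real.exp (K * x) := by linarith
    _ = η * (K * Real.exp (K * x)) := by rw [hxB, hK]; ring

/-- A priori bound far to the right: along vertical segments of length at most `π` the function
`P²` stays close to `2 u / 3`. -/
theorem IsOrbit.norm_sq_sub_le_right (hc : 0 < c) (hP : IsOrbit c (box L a b) P) (ha : a < 0)
    (hb : b ≤ Real.pi) {η σ : ℝ} (hη : η * Real.exp (3 * Real.pi) ≤ 1 / 8) (hσ : |σ| < L)
    (h0 : ‖P σ ^ 2 - 2 / 3 * Complex.exp σ‖ ≤ η * Real.exp σ)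
    (hσ' : 2 + 2 * c * Real.exp (σ / 2) < η * Real.exp σ) {θ : ℝ} (hθ : 0 ≤ θ) (hθb : θ < b) :
    ‖P (σ + θ * Complex.I) ^ 2 - 2 / 3 * Complex.exp (σ + θ * Complex.I)‖ ≤ Real.exp σ / 8 := by
  have hη0 : 0 < η := by
    have : 0 < η * Real.exp σ := lt_trans (by positivity) hσ'
    exact pos_of_mul_pos_left this (Real.exp_pos σ).le
  have hmem : ∀ x ∈ Icc 0 θ, (σ + x * Complex.I : ℂ) ∈ box L a b := fun x hx =>
    vertical_mem_box hσ (ha.trans_le hx.1) (hx.2.trans_lt hθb)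
  have hexpd : ∀ x : ℝ, HasDerivAt (fun x : ℝ => Complex.exp (σ + x * Complex.I))
      (Complex.I * Complex.exp (σ + x * Complex.I)) x := by
    intro x
    have h1 : HasDerivAt (fun z : ℂ => (σ : ℂ) + z * Complex.I) Complex.I (x : ℂ) := by
      simpa using ((hasDerivAt_id (x : ℂ)).mul_const Complex.I).const_add (σ : ℂ)
    rw [mul_comm]
    exact h1.cexp.comp_ofReal
  have hd : ∀ x ∈ Icc 0 θ, HasDerivAt (fun x : ℝ => P (σ + x * Complex.I) ^ 2 -
      2 / 3 * Complex.exp (σ + x * Complex.I)) (Complex.I *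
        (-2 * (P (σ + x * Complex.I) ^ 2 - 2 / 3 * Complex.exp (σ + x * Complex.I)) +
        2 * c * P (σ + x * Complex.I) - 2)) x := fun x hx => by
    refine (((hP.hasDerivAt_vertical (isOpen_box _ _ _) (hmem x hx)).pow 2).sub
      ((hexpd x).const_mul (2 / 3))).congr_deriv ?_
    have := hP.2 _ (hmem x hx)
    push_cast
    linear_combination 2 * Complex.I * this
  have hBd : ∀ x : ℝ, HasDerivAt (fun x => η * Real.exp σ * Real.exp (3 * x))
      (η * Real.exp σ * (3 * Real.exp (3 * x))) x := by
    intro x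
    simpa [mul_comm] using (((hasDerivAt_id x).const_mul 3).exp).const_mul (η * Real.exp σ)
  have hBle : ∀ x ∈ Icc 0 θ, η * Real.exp σ * Real.exp (3 * x) ≤ Real.exp σ / 8 := fun x hx => by
    have : x ≤ Real.pi := by linarith [hx.2]
    calc _ ≤ η * Real.exp σ * Real.exp (3 * Real.pi) := by gcongr
      _ = η * Real.exp (3 * Real.pi) * Real.exp σ := by ring
      _ ≤ 1 / 8 * Real.exp σ := by gcongr
      _ = _ := by ring
  refine (image_norm_le_of_norm_deriv_right_lt_deriv_boundary
    (fun x hx => (hd x hx).continuousAt.continuousWithinAt)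
    (fun x hx => (hd x ⟨hx.1, hx.2.le⟩).hasDerivWithinAt)
    (B := fun x => η * Real.exp σ * Real.exp (3 * x))
    (by simpa using h0) hBd (fun x hx hxB => ?_) ⟨hθ, le_rfl⟩).trans (hBle θ ⟨hθ, le_rfl⟩)
  have hx' : x ∈ Icc 0 θ := ⟨hx.1, hx.2.le⟩
  set z := (σ + x * Complex.I : ℂ) with hz
  set f := P z ^ 2 - 2 / 3 * Complex.exp z with hf
  have hfle : ‖f‖ ≤ Real.exp σ / 8 := hxB.trans_le (hBle x hx')
  have hPup : ‖P z‖ ≤ Real.exp (σ / 2) := by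
    refine le_of_sq_le_sq ?_ (Real.exp_pos _).le
    rw [← norm_pow, ← Real.exp_nat_mul]
    push_cast
    rw [mul_div_cancel₀ _ (two_ne_zero)]
    have e : P z ^ 2 = f + 2 / 3 * Complex.exp z := by rw [hf]; ring
    rw [e]
    refine (norm_add_le _ _).trans ?_
    rw [norm_mul, hz, norm_exp_vertical]
    norm_num
    linarith [Real.exp_pos σ]
  have hηB : η * Real.exp σ ≤ η * Real.exp σ * Real.exp (3 * x) :=
    le_mul_of_one_le_right (by positivity) (Real.one_le_exp (mul_nonneg (by positivity) hx.1))
  rw [norm_mul, Complex.norm_I, one_mul]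
  calc _ ≤ 2 * ‖f‖ + 2 * c * ‖P z‖ + 2 := by
        refine (norm_sub_le _ _).trans (add_le_add ((norm_add_le _ _).trans ?_) (by norm_num))
        simp [abs_of_pos hc]
    _ ≤ 2 * ‖f‖ + 2 * c * Real.exp (σ / 2) + 2 := by gcongr
    _ < 2 * ‖f‖ + η * Real.exp σ * Real.exp (3 * x) := by linarith
    _ = η * Real.exp σ * (3 * Real.exp (3 * x)) := by rw [hxB]; ring

/-- Far to the right `P` is near the branch of `√(2 u / 3)` that is negative on the axis. Up to the
height of a zero of `Im P` one has `cos ≥ 1 / 2`, and hence `Re P` has no zero. -/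
theorem re_neg_of_im_eq_zero_right {σ : ℝ} (hcont : ∀ x : ℝ, 0 ≤ x → x < b →
      ContinuousAt (fun x : ℝ => P (σ + x * Complex.I)) x) (hb : b ≤ Real.pi)
    (h : ∀ x : ℝ, 0 ≤ x → x < b → ‖P (σ + x * Complex.I) ^ 2 -
      2 / 3 * Complex.exp (σ + x * Complex.I)‖ ≤ Real.exp σ / 8)
    (h0 : (P σ).re < 0) {θ : ℝ} (hθ : 0 ≤ θ) (hθb : θ < b)
    (him : (P (σ + θ * Complex.I)).im = 0) : (P (σ + θ * Complex.I)).re < 0 := by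
  have hre : ∀ x : ℝ, (Complex.exp (σ + x * Complex.I)).re = Real.exp σ * Real.cos x := by
    intro x; rw [Complex.exp_re]; simp
  have him' : ∀ x : ℝ, (Complex.exp (σ + x * Complex.I)).im = Real.exp σ * Real.sin x := by
    intro x; rw [Complex.exp_im]; simp
  have hE := Real.exp_pos σ
  have hcos : 1 / 2 ≤ Real.cos θ := by
    have h1 := (Complex.abs_re_le_norm _).trans (h θ hθ hθb)
    have h2 := (Complex.abs_im_le_norm _).trans (h θ hθ hθb)
    simp only [Complex.sub_re, Complex.sub_im, sq, Complex.mul_re, Complex.mul_im, him, hre, him']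
      at h1 h2
    norm_num at h1 h2
    have h3 : Real.cos θ ≥ -(3 / 16) := by
      have := (abs_le.1 h1).2
      by_contra hcon
      nlinarith [mul_self_nonneg (P (σ + θ * Complex.I)).re]
    have h4 : |Real.sin θ| ≤ 3 / 16 := by
      by_contra hcon
      nlinarith
    have h5 := Real.sin_sq_add_cos_sq θ
    rw [← sq_abs (Real.sin θ)] at h5
    nlinarith [abs_nonneg (Real.sin θ)]
  by_contra hcon
  obtain ⟨x, hx, hpx⟩ := intermediate_value_Icc hθ (f := fun x : ℝ => (P (σ + x * Complex.I)).re)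
    (fun x hx => (Complex.continuous_re.continuousAt.comp
      (hcont x hx.1 (hx.2.trans_lt hθb))).continuousWithinAt)
    (show (0 : ℝ) ∈ Icc _ _ from ⟨by simpa using h0.le, not_lt.1 hcon⟩)
  have h1 := (Complex.abs_re_le_norm _).trans (h x hx.1 (hx.2.trans_lt hθb))
  simp only at hpx
  simp only [Complex.sub_re, sq, Complex.mul_re, hpx, hre] at h1
  norm_num at h1
  have h2 : Real.cos θ ≤ Real.cos x :=
    Real.cos_le_cos_of_nonneg_of_le_pi hx.1 (by linarith) hx.2
  have := (abs_le.1 h1).1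
  nlinarith [mul_self_nonneg (P (σ + x * Complex.I)).im]

/-- Only the equation of `P²` is used, which is not singular where `P` vanishes, so that Grönwall
applies. -/
theorem exists_norm_le_vertical (c L M₀ : ℝ) (hc : 0 < c) : ∃ M : ℝ, ∀ {a b : ℝ} {P : ℂ → ℂ},
    IsOrbit c (box L a b) P → a < 0 → b ≤ Real.pi → ∀ σ θ : ℝ, |σ| < L → ‖P σ‖ ≤ M₀ → 0 ≤ θ →
    θ < b → ‖P (σ + θ * Complex.I)‖ ≤ M := by
  set ε := 2 * c + 2 + 2 * Real.exp L with hε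
  refine ⟨1 + gronwallBound (M₀ ^ 2) (2 * c + 2) ε Real.pi, ?_⟩
  intro a b P hP ha hb σ θ hσ h0 hθ hθb
  have hmem : ∀ x ∈ Icc 0 θ, (σ + x * Complex.I : ℂ) ∈ box L a b := fun x hx =>
    vertical_mem_box hσ (ha.trans_le hx.1) (hx.2.trans_lt hθb)
  have hd : ∀ x ∈ Icc 0 θ, HasDerivAt (fun x : ℝ => P (σ + x * Complex.I) ^ 2)
      (2 * Complex.I * (c * P (σ + x * Complex.I) - P (σ + x * Complex.I) ^ 2 - 1 +
        Complex.exp (σ + x * Complex.I))) x := fun x hx => by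
    refine ((hP.hasDerivAt_vertical (isOpen_box _ _ _) (hmem x hx)).pow 2).congr_deriv ?_
    have := hP.2 _ (hmem x hx)
    push_cast
    linear_combination 2 * Complex.I * this
  have hle : ∀ z : ℂ, ‖z‖ ≤ 1 + ‖z ^ 2‖ := fun z => by
    rw [norm_pow]; nlinarith [sq_nonneg (‖z‖ - 1 / 2)]
  have h1 := norm_le_gronwallBound_of_norm_deriv_right_le (δ := M₀ ^ 2) (K := 2 * c + 2) (ε := ε)
    (fun x hx => (hd x hx).continuousAt.continuousWithinAt)
    (fun x hx => (hd x ⟨hx.1, hx.2.le⟩).hasDerivWithinAt)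
    (by simpa using pow_le_pow_left₀ (norm_nonneg _) h0 2)
    (fun x hx => by
      set z := P (σ + x * Complex.I)
      have hz := hle z
      have hu : ‖Complex.exp (σ + x * Complex.I)‖ ≤ Real.exp L := by
        rw [norm_exp_vertical]; exact Real.exp_le_exp.2 ((le_abs_self σ).trans hσ.le)
      have e : ‖c * z - z ^ 2 - 1 + Complex.exp (σ + x * Complex.I)‖ ≤
          c * ‖z‖ + ‖z ^ 2‖ + 1 + Real.exp L := by
        refine (norm_add_le _ _).trans (add_le_add ((norm_sub_le _ _).trans
          (add_le_add ((norm_sub_le _ _).trans (add_le_add_left ?_ _)) (by simp))) hu)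
        rw [norm_mul, Complex.norm_real, Real.norm_eq_abs, abs_of_pos hc]
      rw [norm_mul, norm_mul, Complex.norm_I, hε]
      norm_num
      norm_num at e hz
      nlinarith) θ ⟨hθ, le_rfl⟩
  have h2 : gronwallBound (M₀ ^ 2) (2 * c + 2) ε (θ - 0) ≤
      gronwallBound (M₀ ^ 2) (2 * c + 2) ε Real.pi :=
    gronwallBound_mono (sq_nonneg _) (by positivity) (by positivity) (by linarith)
  exact (hle _).trans (by linarith)

/-- The imaginary part cannot vanish: at a lowest zero `τ`, the value of `P` is a real `x ≠ 0`, and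
the derivative of `Im P` along the horizontal line through `τ` is `Im (e^τ) / x ≠ 0`, whereas
`Im P` has a maximum there. At the two vertical sides the sign of `x` decides. -/
theorem IsOrbit.im_neg (hP : IsOrbit c (box (L + 1) a b) P) (ha : a < 0) (hb : b ≤ Real.pi)
    (hL : 0 < L) {θ₁ : ℝ} (hθ₁ : 0 < θ₁)
    (hinit : ∀ τ : ℂ, |τ.re| ≤ L → 0 < τ.im → τ.im < θ₁ → (P τ).im < 0)
    (hleft : ∀ θ : ℝ, 0 ≤ θ → θ < b → 0 < (P ((-L : ℝ) + θ * Complex.I)).re)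
    (hright : ∀ θ : ℝ, 0 ≤ θ → θ < b → (P ((L : ℝ) + θ * Complex.I)).im = 0 →
      (P ((L : ℝ) + θ * Complex.I)).re < 0)
    {τ : ℂ} (hτ : |τ.re| ≤ L) (h0 : 0 < τ.im) (hτb : τ.im < b) : (P τ).im < 0 := by
  have hopen := isOpen_box (L + 1) a b
  by_contra hcon
  set Z : Set ℂ := (Icc (-L) L ×ℂ Icc (θ₁ / 2) τ.im) ∩ (fun z => (P z).im) ⁻¹' Ici 0 with hZ
  have hsub : ∀ z ∈ (Icc (-L) L ×ℂ Icc (θ₁ / 2) τ.im), z ∈ box (L + 1) a b := by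
    intro z hz
    rw [Complex.mem_reProdIm] at hz
    refine ⟨?_, by linarith [hz.2.1], hz.2.2.trans_lt hτb⟩
    have := abs_le.2 hz.1
    linarith
  have hcontP : ∀ z ∈ box (L + 1) a b, ContinuousAt (fun z => (P z).im) z := fun z hz =>
    Complex.continuous_im.continuousAt.comp
      (hP.1.differentiableAt (hopen.mem_nhds hz)).continuousAt
  have hcompact : IsCompact (Icc (-L) L ×ℂ Icc (θ₁ / 2) τ.im) :=
    isCompact_Icc.reProdIm isCompact_Icc
  have hZc : IsCompact Z := hcompact.of_isClosed_subset
    (ContinuousOn.preimage_isClosed_of_isClosed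
      (fun z hz => (hcontP z (hsub z hz)).continuousWithinAt) hcompact.isClosed isClosed_Ici)
    inter_subset_left
  have hτ1 : θ₁ ≤ τ.im := by
    by_contra h
    exact hcon (hinit τ hτ h0 (not_le.1 h))
  have hτZ : τ ∈ Z := ⟨Complex.mem_reProdIm.2 ⟨abs_le.1 hτ, by linarith, le_rfl⟩, not_lt.1 hcon⟩
  obtain ⟨w, hwZ, hmin⟩ := hZc.exists_isMinOn ⟨τ, hτZ⟩ Complex.continuous_im.continuousOn
  have hw := Complex.mem_reProdIm.1 hwZ.1
  have hwbox := hsub w hwZ.1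
  have hw1 : θ₁ ≤ w.im := by
    by_contra h
    exact absurd hwZ.2 (not_le.2 (hinit w (abs_le.2 hw.1) (by linarith [hw.2.1]) (not_le.1 h)))
  -- below the level of `w` the imaginary part is negative, on that level it is at most `0`
  have hbelow : ∀ z : ℂ, |z.re| ≤ L → 0 < z.im → z.im < w.im → (P z).im < 0 := by
    intro z hz hz0 hzw
    rcases lt_or_ge z.im θ₁ with h | h
    · exact hinit z hz hz0 h
    · by_contra hneg
      have : z ∈ Z := ⟨Complex.mem_reProdIm.2 ⟨abs_le.1 hz, by linarith, by linarith [hw.2.2]⟩,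
        not_lt.1 hneg⟩
      exact absurd (hmin this) (not_le.2 hzw)
  have hlevel : ∀ x : ℝ, |x| ≤ L → (P (x + w.im * Complex.I)).im ≤ 0 := by
    intro x hx
    have hmem : (x + w.im * Complex.I : ℂ) ∈ box (L + 1) a b :=
      vertical_mem_box (by linarith) hwbox.2.1 hwbox.2.2
    have h1 : Tendsto (fun y : ℝ => (P (x + y * Complex.I)).im) (𝓝[<] w.im)
        (𝓝 (P (x + w.im * Complex.I)).im) :=
      ((Complex.continuous_im.continuousAt.comp (hP.hasDerivAt_vertical hopen
        hmem).continuousAt).tendsto).mono_left nhdsWithin_le_nhds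
    refine le_of_tendsto h1 ?_
    filter_upwards [Ioo_mem_nhdsLT (show 0 < w.im by linarith)] with y hy
    exact (hbelow _ (by simpa using hx) (by simpa using hy.1) (by simpa using hy.2)).le
  have hwe : (w.re + w.im * Complex.I : ℂ) = w := Complex.re_add_im w
  have him0 : (P w).im = 0 :=
    le_antisymm (by have := hlevel w.re (abs_le.2 hw.1); rwa [hwe] at this) hwZ.2
  have hreal : P w = ((P w).re : ℝ) := Complex.ext rfl (by simpa using him0)
  have hsin : 0 < (Complex.exp w).im := by
    rw [Complex.exp_im]
    exact mul_pos (Real.exp_pos _) (Real.sin_pos_of_pos_of_lt_pi (by linarith)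
      (by linarith [hwbox.2.2]))
  have hode := hP.2 w hwbox
  rw [hreal] at hode
  have hode' := congrArg Complex.im hode
  simp [sq] at hode'
  have hder : HasDerivAt (fun x : ℝ => (P (x + w.im * Complex.I)).im) (deriv P w).im w.re := by
    have h1 := hP.hasDerivAt_horizontal hopen (σ := w.re) (θ := w.im) (by rw [hwe]; exact hwbox)
    rw [hwe] at h1
    exact Complex.imCLM.hasFDerivAt.comp_hasDerivAt w.re h1
  have hle : ∀ x : ℝ, |x| ≤ L → (P (x + w.im * Complex.I)).im ≤
      (P (w.re + w.im * Complex.I)).im := by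
    intro x hx; rw [hwe, him0]; exact hlevel x hx
  have hnonneg : -L < w.re → 0 ≤ (deriv P w).im := fun h =>
    deriv_nonneg_of_le_left h hder fun y hy => hle y (abs_le.2 ⟨hy.1.le, by linarith [hy.2, hw.1.2]⟩)
  have hnonpos : w.re < L → (deriv P w).im ≤ 0 := fun h =>
    deriv_nonpos_of_le_right h hder fun y hy => hle y (abs_le.2 ⟨by linarith [hy.1, hw.1.1], hy.2.le⟩)
  rcases eq_or_lt_of_le hw.1.1 with hl | hl
  · have h1 := hleft w.im (by linarith) hwbox.2.2
    rw [hl, hwe] at h1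
    have h2 := hnonpos (by linarith)
    nlinarith
  · rcases eq_or_lt_of_le hw.1.2 with hr | hr
    · have h1 := hright w.im (by linarith) hwbox.2.2
      rw [← hr, hwe] at h1
      have h2 := hnonneg hl
      nlinarith [h1 him0]
    · have : (deriv P w).im = 0 := le_antisymm (hnonpos hr) (hnonneg hl)
      rw [this, mul_zero] at hode'
      linarith

end Vertical

/-! ### A lower bound for the modulus -/

set_option maxHeartbeats 1000000 in
/-- While the imaginary part of `P` is negative below `τ₀`, the value `P τ₀` cannot be small: if it
were, then `V = P²` would be close to `2 K (τ - τ₀)` with `K = e^{τ₀} - 1`, and along the segment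
`τ₀ + t K̄ (1 + i s)` the real part of `V` would be positive while its imaginary part changes sign.
Since `Im V = 2 Re P Im P`, the real part of `P` vanishes somewhere on it, and there `V ≤ 0`. -/
theorem IsOrbit.exists_lower_bound (c M B : ℝ) {k t₀ : ℝ} (hk : 0 < k) (ht₀ : 0 < t₀) :
    ∃ δ > 0, ∀ {Ω : Set ℂ} {P : ℂ → ℂ} {τ₀ : ℂ}, IsOpen Ω → IsOrbit c Ω P →
      (∀ τ : ℂ, ‖τ - τ₀‖ ≤ t₀ → τ.im ≤ τ₀.im → τ ∈ Ω ∧ (P τ).im < 0 ∧ ‖P τ‖ ≤ M) →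
      τ₀.re ≤ B → k ≤ (Complex.exp τ₀).im → δ ≤ ‖P τ₀‖ := by
  set C₁ := 2 * (|c| * |M| + M ^ 2 + 1 + Real.exp (B + 1)) with hC₁
  set K₁ := 1 + Real.exp B with hK₁
  set m := k ^ 3 / (4 * K₁ ^ 2) with hm
  have hC₁0 : 0 < C₁ := by positivity
  have hK₁0 : 0 < K₁ := by positivity
  have hm0 : 0 < m := by positivity
  -- the radius `T` is so small that the derivative of `P²` differs from `2 K` by less than `m`
  obtain ⟨T, ⟨hT0, hTt⟩, hTm⟩ : ∃ T ∈ Ioo 0 (min t₀ 1),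
      2 * |c| * √((1 + C₁) * T) + 2 * (1 + C₁) * T + 2 * Real.exp (B + 1) * T < m := by
    have hcont : Continuous fun T : ℝ =>
        2 * |c| * √((1 + C₁) * T) + 2 * (1 + C₁) * T + 2 * Real.exp (B + 1) * T := by fun_prop
    have h1 := (hcont.tendsto 0).mono_left (nhdsWithin_le_nhds (s := Ioi 0))
    simp only [mul_zero, Real.sqrt_zero, add_zero] at h1
    have h2 : ∀ᶠ T in 𝓝[>] (0 : ℝ), T ∈ Ioo 0 (min t₀ 1) := Ioo_mem_nhdsGT (lt_min ht₀ one_pos)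
    exact (h2.and (h1.eventually (gt_mem_nhds hm0))).exists
  have hTt₀ : T ≤ t₀ := (hTt.trans_le (min_le_left _ _)).le
  have hT1 : T ≤ 1 := (hTt.trans_le (min_le_right _ _)).le
  refine ⟨√(min m 1 * T), by positivity, ?_⟩
  intro Ω P τ₀ hΩ hP hD hB hkτ
  by_contra! hlt
  have hV0 : ‖P τ₀ ^ 2‖ ≤ min m 1 * T := by
    rw [norm_pow, ← Real.sq_sqrt (show 0 ≤ min m 1 * T by positivity)]
    exact pow_le_pow_left₀ (norm_nonneg _) hlt.le 2
  have hV0m : ‖P τ₀ ^ 2‖ ≤ m * T :=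
    hV0.trans (mul_le_mul_of_nonneg_right (min_le_left _ _) hT0.le)
  have hV01 : ‖P τ₀ ^ 2‖ ≤ T :=
    hV0.trans (mul_le_of_le_one_left hT0.le (min_le_right _ _))
  set D : Set ℂ := Metric.closedBall τ₀ T ∩ {τ | τ.im ≤ τ₀.im} with hDdef
  have hDconv : Convex ℝ D := (convex_closedBall _ _).inter (convex_halfSpace_im_le _)
  have hτ₀D : τ₀ ∈ D := ⟨Metric.mem_closedBall_self hT0.le, le_refl τ₀.im⟩
  have hDist : ∀ τ ∈ D, ‖τ - τ₀‖ ≤ T := fun τ hτ => mem_closedBall_iff_norm.1 hτ.1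
  have hDD : ∀ τ ∈ D, τ ∈ Ω ∧ (P τ).im < 0 ∧ ‖P τ‖ ≤ M := fun τ hτ =>
    hD τ ((hDist τ hτ).trans hTt₀) hτ.2
  have hexp : ∀ τ ∈ D, ‖Complex.exp τ‖ ≤ Real.exp (B + 1) := by
    intro τ hτ
    rw [Complex.norm_exp]
    have h1 := (Complex.abs_re_le_norm _).trans (hDist τ hτ)
    rw [Complex.sub_re] at h1
    exact Real.exp_le_exp.2 (by linarith [(abs_le.1 h1).2])
  set K := Complex.exp τ₀ - 1 with hK
  set V' : ℂ → ℂ := fun τ => 2 * (c * P τ - P τ ^ 2 - 1 + Complex.exp τ) with hV'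
  have hder : ∀ τ ∈ D, HasDerivAt (fun τ => P τ ^ 2) (V' τ) τ := by
    intro τ hτ
    refine ((hP.1.differentiableAt (hΩ.mem_nhds (hDD τ hτ).1)).hasDerivAt.pow 2).congr_deriv ?_
    have := hP.2 τ (hDD τ hτ).1
    push_cast
    linear_combination 2 * this
  have hVbd : ∀ τ ∈ D, ‖V' τ‖ ≤ C₁ := by
    intro τ hτ
    have hM : ‖P τ‖ ≤ M := (hDD τ hτ).2.2
    have hM0 : 0 ≤ M := (norm_nonneg _).trans hM
    have h2 : ‖(c : ℂ) * P τ‖ ≤ |c| * |M| := by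
      rw [norm_mul, Complex.norm_real, Real.norm_eq_abs, abs_of_nonneg hM0]; gcongr
    have h3 : ‖P τ ^ 2‖ ≤ M ^ 2 := by rw [norm_pow]; gcongr
    calc ‖V' τ‖ = 2 * ‖c * P τ - P τ ^ 2 - 1 + Complex.exp τ‖ := by
          rw [hV', norm_mul]; norm_num
      _ ≤ C₁ := by
          rw [hC₁]
          gcongr
          refine (norm_add_le _ _).trans (add_le_add ((norm_sub_le _ _).trans
            (add_le_add ((norm_sub_le _ _).trans (add_le_add h2 h3)) (by simp))) (hexp τ hτ))
  have hVT : ∀ τ ∈ D, ‖P τ ^ 2‖ ≤ (1 + C₁) * T := by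
    intro τ hτ
    have h1 := hDconv.norm_image_sub_le_of_norm_hasDerivWithin_le
      (fun x hx => (hder x hx).hasDerivWithinAt) hVbd hτ₀D hτ
    have h2 := norm_sub_norm_le (P τ ^ 2) (P τ₀ ^ 2)
    have h3 := mul_le_mul_of_nonneg_left (hDist τ hτ) hC₁0.le
    linarith
  have hexpT : ∀ τ ∈ D, ‖Complex.exp τ - Complex.exp τ₀‖ ≤ Real.exp (B + 1) * T := by
    intro τ hτ
    have h1 := hDconv.norm_image_sub_le_of_norm_hasDerivWithin_le
      (fun x _ => (Complex.hasDerivAt_exp x).hasDerivWithinAt) hexp hτ₀D hτ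
    exact h1.trans (mul_le_mul_of_nonneg_left (hDist τ hτ) (Real.exp_pos _).le)
  have hVK : ∀ τ ∈ D, ‖V' τ - 2 * K‖ ≤ m := by
    intro τ hτ
    have e : V' τ - 2 * K = 2 * (c * P τ - P τ ^ 2 + (Complex.exp τ - Complex.exp τ₀)) := by
      rw [hV', hK]; ring
    have h1 : ‖P τ‖ ≤ √((1 + C₁) * T) := by
      refine Real.le_sqrt_of_sq_le ?_
      rw [← norm_pow]; exact hVT τ hτ
    have h2 : ‖(c : ℂ) * P τ‖ ≤ |c| * √((1 + C₁) * T) := by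
      rw [norm_mul, Complex.norm_real, Real.norm_eq_abs]; gcongr
    have h3 := (norm_add_le (c * P τ - P τ ^ 2) (Complex.exp τ - Complex.exp τ₀)).trans
      (add_le_add ((norm_sub_le _ _).trans (add_le_add h2 (hVT τ hτ))) (hexpT τ hτ))
    rw [e, norm_mul]
    norm_num
    linarith
  have hVlin : ∀ τ ∈ D, ‖P τ ^ 2 - 2 * K * (τ - τ₀)‖ ≤ 2 * m * T := by
    intro τ hτ
    have h1 := hDconv.norm_image_sub_le_of_norm_hasDerivWithin_le
      (f := fun τ => P τ ^ 2 - 2 * K * (τ - τ₀)) (f' := fun τ => V' τ - 2 * K)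
      (fun x hx => (((hder x hx).sub
        (((hasDerivAt_id x).sub_const τ₀).const_mul (2 * K))).congr_deriv
          (by simp)).hasDerivWithinAt) hVK hτ₀D hτ
    have h2 := norm_sub_norm_le (P τ ^ 2 - 2 * K * (τ - τ₀)) (P τ₀ ^ 2 - 2 * K * (τ₀ - τ₀))
    have h3 := mul_le_mul_of_nonneg_left (hDist τ hτ) hm0.le
    simp only [sub_self, mul_zero, sub_zero] at h1 h2
    linarith
  have hKk : k ≤ K.im := by simpa [hK] using hkτ
  have hKn : ‖K‖ ≤ K₁ := by
    rw [hK, hK₁, add_comm]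
    refine (norm_sub_le _ _).trans (add_le_add ?_ (by simp))
    rw [Complex.norm_exp]; exact Real.exp_le_exp.2 hB
  have hKre : |K.re| ≤ K₁ := (Complex.abs_re_le_norm _).trans hKn
  have hKim : K.im ≤ K₁ := ((le_abs_self _).trans (Complex.abs_im_le_norm _)).trans hKn
  set s₀ := k / K₁ with hs₀
  have hs₀0 : 0 < s₀ := by positivity
  have hs₀1 : s₀ ≤ 1 := (div_le_one hK₁0).2 (hKk.trans hKim)
  set t := T / (2 * K₁) with ht
  have ht0 : 0 < t := by positivity
  set seg : ℝ → ℂ := fun s => τ₀ + t * (starRingEnd ℂ K) * (1 + s * Complex.I) with hseg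
  have hsegD : ∀ s : ℝ, |s| ≤ s₀ → seg s ∈ D := by
    intro s hs
    constructor
    · rw [mem_closedBall_iff_norm, hseg]
      have h1 : ‖(1 + s * Complex.I : ℂ)‖ ≤ 2 := by
        refine (norm_add_le _ _).trans ?_
        rw [norm_mul, Complex.norm_real, Real.norm_eq_abs, Complex.norm_I, norm_one]
        linarith
      rw [add_sub_cancel_left, norm_mul, norm_mul, Complex.norm_real, RCLike.norm_conj,
        Real.norm_eq_abs, abs_of_pos ht0]
      calc t * ‖K‖ * _ ≤ t * K₁ * 2 := by gcongr
        _ = T := by rw [ht]; field_simp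
    · have h1 : s * K.re ≤ k := by
        refine (le_abs_self _).trans ?_
        rw [abs_mul]
        calc _ ≤ s₀ * K₁ := by gcongr
          _ = k := by rw [hs₀]; field_simp
      have h2 : (seg s).im = τ₀.im + t * (s * K.re - K.im) := by
        simp [hseg]; ring
      change (seg s).im ≤ τ₀.im
      rw [h2]
      nlinarith
  have hsegK : ∀ s : ℝ, 2 * K * (seg s - τ₀) = (2 * t * Complex.normSq K : ℝ) * (1 + s * Complex.I) := by
    intro s
    rw [hseg, add_sub_cancel_left]
    push_cast
    rw [← Complex.mul_conj]; ring
  have hnK : k ^ 2 ≤ Complex.normSq K := by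
    rw [Complex.normSq_apply]; nlinarith [mul_self_nonneg K.re]
  have hbig : 4 * m * T ≤ 2 * t * Complex.normSq K * s₀ := by
    calc 4 * m * T = 2 * t * k ^ 2 * s₀ := by rw [hm, ht, hs₀]; field_simp
      _ ≤ _ := by gcongr
  have hmT : 0 < m * T := by positivity
  have hre : ∀ s : ℝ, |s| ≤ s₀ → 0 < (P (seg s) ^ 2).re := by
    intro s hs
    have h1 := (Complex.abs_re_le_norm _).trans (hVlin _ (hsegD s hs))
    rw [hsegK, Complex.sub_re, Complex.re_ofReal_mul] at h1
    simp only [Complex.add_re, Complex.one_re, Complex.mul_re, Complex.ofReal_re, Complex.I_re,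
      Complex.ofReal_im, Complex.I_im] at h1
    have h2 : 2 * t * Complex.normSq K * s₀ ≤ 2 * t * Complex.normSq K :=
      mul_le_of_le_one_right (mul_nonneg (by positivity) (Complex.normSq_nonneg _)) hs₀1
    linarith [(abs_le.1 h1).1]
  have him : ∀ s : ℝ, |s| ≤ s₀ →
      |2 * (P (seg s)).re * (P (seg s)).im - 2 * t * Complex.normSq K * s| ≤ 2 * m * T := by
    intro s hs
    have h1 := (Complex.abs_im_le_norm _).trans (hVlin _ (hsegD s hs))
    rw [hsegK, Complex.sub_im, Complex.im_ofReal_mul] at h1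
    simp only [sq, Complex.add_im, Complex.one_im, Complex.mul_im, Complex.ofReal_re, Complex.I_re,
      Complex.ofReal_im, Complex.I_im] at h1
    have e : 2 * (P (seg s)).re * (P (seg s)).im - 2 * t * Complex.normSq K * s =
        (P (seg s)).re * (P (seg s)).im + (P (seg s)).im * (P (seg s)).re -
          2 * t * Complex.normSq K * (0 + (s * 1 + 0 * 0)) := by ring
    rw [e]
    exact h1
  have hcont : ContinuousOn (fun s : ℝ => (P (seg s)).re) (Icc (-s₀) s₀) := by
    intro s hs
    have h1 : ContinuousAt P (seg s) :=
      (hP.1.differentiableAt (hΩ.mem_nhds (hDD _ (hsegD s (abs_le.2 hs))).1)).continuousAt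
    have h2 : Continuous seg := by rw [hseg]; fun_prop
    exact (Complex.continuous_re.continuousAt.comp
      (h1.comp (f := seg) h2.continuousAt)).continuousWithinAt
  have hend : |s₀| ≤ s₀ := (abs_of_pos hs₀0).le
  have hend' : |(-s₀)| ≤ s₀ := by rw [abs_neg]; exact hend
  obtain ⟨s, hs, hsre⟩ := intermediate_value_Icc' (by linarith : -s₀ ≤ s₀) hcont
    (show (0 : ℝ) ∈ Icc _ _ from ⟨by
      have h1 := (abs_le.1 (him s₀ hend)).1
      have h2 := (hDD _ (hsegD s₀ hend)).2.1
      by_contra hcon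
      nlinarith, by
      have h1 := (abs_le.1 (him (-s₀) hend')).2
      have h2 := (hDD _ (hsegD (-s₀) hend')).2.1
      by_contra hcon
      nlinarith⟩)
  have h1 := hre s (abs_le.2 hs)
  simp only at hsre
  rw [sq, Complex.mul_re, hsre] at h1
  nlinarith [mul_self_nonneg (P (seg s)).im]

/-! ### Continuation to the strip -/

/-- The asymptotics on the real axis supply the initial values of the a priori bounds at both ends.
-/
theorem RealSeparatrix.exists_vertical_bounds {c r : ℝ} {p q : ℝ → ℝ}
    (h : RealSeparatrix c r p q) (hc : 0 < c) :
    ∃ A p₀ : ℝ, 0 < p₀ ∧ ∀ {L a b : ℝ} {P : ℂ → ℂ}, a < 0 → 0 < b → b ≤ Real.pi →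
      IsOrbit c (box L a b) P → P =ᶠ[𝓝 0] sepGerm c r →
      ∀ σ θ : ℝ, |σ| < L → 0 ≤ θ → θ < b →
        (σ ≤ -A → ‖P (σ + θ * Complex.I) - p₀‖ ≤ p₀ / 2) ∧
        (A ≤ σ → ‖P (σ + θ * Complex.I) ^ 2 - 2 / 3 * Complex.exp (σ + θ * Complex.I)‖ ≤
          Real.exp σ / 8) := by
  obtain ⟨p₀, hp₀, hpc, hbot⟩ := h.exists_tendsto_atBot
  have htop := h.tendsto_atTop hc
  set η₁ := p₀ / 2 * Real.exp (-((2 + 2 / p₀ ^ 2) * Real.pi)) with hη₁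
  set η₂ := 1 / 8 * Real.exp (-(3 * Real.pi)) with hη₂
  have hη₁0 : 0 < η₁ := by positivity
  have hη₂0 : 0 < η₂ := by positivity
  have e1 : ∀ᶠ σ in atBot, |p σ - p₀| ≤ η₁ ∧ 2 * Real.exp σ / p₀ < η₁ := by
    have t1 : Tendsto (fun σ => |p σ - p₀|) atBot (𝓝 0) := by
      simpa using (hbot.sub_const p₀).abs
    have t2 : Tendsto (fun σ => 2 * Real.exp σ / p₀) atBot (𝓝 0) := by
      simpa using (Real.tendsto_exp_atBot.const_mul 2).div_const p₀
    exact ((t1.eventually_lt_const hη₁0).mono fun _ => le_of_lt).and (t2.eventually_lt_const hη₁0)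
  have e2 : ∀ᶠ σ in atTop, |p σ ^ 2 / Real.exp σ - 2 / 3| ≤ η₂ ∧
      2 + 2 * c * Real.exp (σ / 2) < η₂ * Real.exp σ := by
    have t1 : Tendsto (fun σ => |p σ ^ 2 / Real.exp σ - 2 / 3|) atTop (𝓝 0) := by
      simpa using (htop.sub_const (2 / 3)).abs
    have t2 : Tendsto (fun σ => 2 * Real.exp (-σ) + 2 * c * Real.exp (-(σ / 2))) atTop (𝓝 0) := by
      have h1 : Tendsto (fun σ : ℝ => Real.exp (-σ)) atTop (𝓝 0) :=
        Real.tendsto_exp_neg_atTop_nhds_zero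
      have h2 := h1.comp (tendsto_id.atTop_div_const (show (0 : ℝ) < 2 by norm_num))
      simpa [Function.comp_def] using (h1.const_mul 2).add (h2.const_mul (2 * c))
    refine ((t1.eventually_lt_const hη₂0).mono fun _ => le_of_lt).and
      ((t2.eventually_lt_const hη₂0).mono fun σ hσ => ?_)
    have h3 := mul_lt_mul_of_pos_right hσ (Real.exp_pos σ)
    have h4 : Real.exp (-σ) * Real.exp σ = 1 := by rw [← Real.exp_add]; simp
    have h5 : Real.exp (-(σ / 2)) * Real.exp σ = Real.exp (σ / 2) := by
      rw [← Real.exp_add]; congr 1; ring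
    calc _ = (2 * Real.exp (-σ) + 2 * c * Real.exp (-(σ / 2))) * Real.exp σ := by
          linear_combination (-2) * h4 - 2 * c * h5
      _ < _ := h3
  obtain ⟨A₁, hA₁⟩ := eventually_atBot.1 e1
  obtain ⟨A₂, hA₂⟩ := eventually_atTop.1 e2
  refine ⟨max (-A₁) A₂, p₀, hp₀, ?_⟩
  intro L a b P ha hb hbπ hP hg σ θ hσ hθ hθb
  have hreal := h.eq_of_orbit ha hb hP hg σ hσ
  constructor
  · intro hA
    obtain ⟨h1, h2⟩ := hA₁ σ (by linarith [le_max_left (-A₁) A₂])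
    refine hP.norm_sub_le_left ha hbπ hp₀ hpc (le_of_eq ?_) hσ (η := η₁) ?_ h2 hθ hθb
    · rw [hη₁, mul_assoc, ← Real.exp_add]; simp
    · rw [hreal, ← Complex.ofReal_sub, Complex.norm_real]; exact h1
  · intro hA
    obtain ⟨h1, h2⟩ := hA₂ σ (by linarith [le_max_right (-A₁) A₂])
    refine hP.norm_sq_sub_le_right hc ha hbπ (le_of_eq ?_) hσ (η := η₂) ?_ h2 hθ hθb
    · rw [hη₂, mul_assoc, ← Real.exp_add]; simp
    · have h3 : P σ ^ 2 - 2 / 3 * Complex.exp σ =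
          ((p σ ^ 2 / Real.exp σ - 2 / 3) * Real.exp σ : ℝ) := by
        rw [hreal]; push_cast
        have := Complex.exp_ne_zero σ
        field_simp
      rw [h3, Complex.norm_real, Real.norm_eq_abs, abs_mul, abs_of_pos (Real.exp_pos σ)]
      gcongr

/-- Just above the real axis the imaginary part is negative, since `P' < 0` on the axis. -/
theorem exists_orbit_thin {c r : ℝ} (hc : 2 ≤ c) (hr : 0 < r) (hcr : r ^ 2 + c * r = 1) (L : ℝ) :
    ∃ κ > 0, ∃ P, IsOrbit c (box L (-κ) κ) P ∧ P =ᶠ[𝓝 0] sepGerm c r ∧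
      ∀ τ ∈ box L (-κ) κ, 0 < τ.im → (P τ).im < 0 := by
  have hc0 : 0 < c := by linarith
  obtain ⟨κ, hκ, P, hP, hg⟩ := exists_orbit_real hc hr hcr (L + 1)
  have hopen := isOpen_box (L + 1) (-κ) κ
  have hκ' : -κ < 0 := neg_neg_of_pos hκ
  set U : Set ℂ := box (L + 1) (-κ) κ ∩ (fun z => (deriv P z).re) ⁻¹' Iio 0 with hU
  have hUo : IsOpen U :=
    ContinuousOn.isOpen_inter_preimage
      (fun z hz => (Complex.continuous_re.continuousAt.comp
        ((hP.1.deriv hopen).differentiableAt (hopen.mem_nhds hz)).continuousAt).continuousWithinAt)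
      hopen isOpen_Iio
  have hKc : IsCompact ((fun x : ℝ => (x : ℂ)) '' Icc (-L) L) :=
    isCompact_Icc.image Complex.continuous_ofReal
  have hKU : (fun x : ℝ => (x : ℂ)) '' Icc (-L) L ⊆ U := by
    rintro _ ⟨x, hx, rfl⟩
    have hx' : |x| < L + 1 := (abs_le.2 hx).trans_lt (lt_add_one _)
    exact ⟨ofReal_mem_box hκ' hκ hx', (hP.real_axis hc0 hr hg hκ' hκ hx').2.2⟩
  obtain ⟨δ, hδ, hδU⟩ := hKc.exists_thickening_subset_open hUo hKU
  have hin : ∀ τ : ℂ, |τ.re| ≤ L → |τ.im| < δ → τ ∈ U := by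
    intro τ h1 h2
    refine hδU (Metric.mem_thickening_iff.2 ⟨τ.re, ⟨τ.re, abs_le.1 h1, rfl⟩, ?_⟩)
    rw [Complex.dist_of_re_eq (by simp)]
    simpa using h2
  refine ⟨min δ κ, lt_min hδ hκ, P, hP.mono (box_mono (by linarith)
    (neg_le_neg (min_le_right _ _)) (min_le_right _ _)), hg, ?_⟩
  intro τ hτ h0
  have hτδ : τ.im < δ := hτ.2.2.trans_le (min_le_left _ _)
  have hinU : ∀ y ∈ Icc 0 τ.im, (τ.re + y * Complex.I : ℂ) ∈ U := fun y hy =>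
    hin _ (by simpa using hτ.1.le) (by simpa [abs_of_nonneg hy.1] using hy.2.trans_lt hτδ)
  have hd : ∀ y ∈ Icc 0 τ.im, HasDerivAt (fun y : ℝ => (P (τ.re + y * Complex.I)).im)
      (deriv P (τ.re + y * Complex.I)).re y := fun y hy => by
    have h1 := hP.hasDerivAt_vertical hopen (hinU y hy).1
    refine (Complex.imCLM.hasFDerivAt.comp_hasDerivAt y h1).congr_deriv ?_
    simp
  have hanti : StrictAntiOn (fun y : ℝ => (P (τ.re + y * Complex.I)).im) (Icc 0 τ.im) := by
    refine strictAntiOn_of_deriv_neg (convex_Icc _ _)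
      (fun y hy => (hd y hy).continuousAt.continuousWithinAt) fun y hy => ?_
    have hy' := interior_subset hy
    rw [(hd y hy').deriv]
    exact (hinU y hy').2
  have h1 := hanti ⟨le_rfl, h0.le⟩ ⟨h0.le, le_rfl⟩ h0
  have h2 := (hP.real_axis hc0 hr hg hκ' hκ (show |τ.re| < L + 1 by linarith [hτ.1])).1
  simp only [Complex.ofReal_zero, zero_mul, add_zero] at h1
  rw [h2, Complex.re_add_im] at h1
  simpa using h1

/-- The separatrix extends holomorphically to every rectangle in the strip `0 ≤ Im τ < π`, and its
imaginary part is negative there. The extension proceeds in upward steps of fixed size, by the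
uniform local existence theorem and the two-sided a priori bounds for `|P|`. -/
theorem exists_orbit_strip {c r : ℝ} (hc : 2 ≤ c) (hr : 0 < r) (hcr : r ^ 2 + c * r = 1)
    (L₀ : ℝ) {Θ : ℝ} (hΘ0 : 0 < Θ) (hΘ : Θ < Real.pi) :
    ∃ κ > 0, ∃ P, IsOrbit c (box L₀ (-κ) Θ) P ∧ P =ᶠ[𝓝 0] sepGerm c r ∧
      ∀ τ ∈ box L₀ (-κ) Θ, 0 < τ.im → (P τ).im < 0 := by
  have hc0 : 0 < c := by linarith
  obtain ⟨p, q, hpq⟩ := exists_realSeparatrix hc hr hcr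
  obtain ⟨A, p₀, hp₀, hvert⟩ := hpq.exists_vertical_bounds hc0
  set L := max L₀ (max A 0) + 1 with hLdef
  have hLL₀ : L₀ ≤ L := by linarith [le_max_left L₀ (max A 0)]
  have hLA : A ≤ L - 1 := by
    linarith [le_max_left A 0, le_max_right L₀ (max A 0)]
  have hL1 : 0 ≤ L - 1 := by
    linarith [le_max_right A 0, le_max_right L₀ (max A 0)]
  have hL : 0 < L := by linarith
  obtain ⟨κ, hκ, P₀, hP₀, hg₀, hneg₀⟩ := exists_orbit_thin hc hr hcr (L + 1)
  have hκ' : -κ < 0 := neg_neg_of_pos hκ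
  -- negativity of the imaginary part and bounds for a solution on a rectangle of any height
  have hneg : ∀ {b : ℝ} {P : ℂ → ℂ}, 0 < b → b ≤ Θ → IsOrbit c (box (L + 1) (-κ) b) P →
      P =ᶠ[𝓝 0] sepGerm c r → ∀ τ : ℂ, |τ.re| ≤ L → 0 < τ.im → τ.im < b → (P τ).im < 0 := by
    intro b P hb hbΘ hP hg τ h1 h2 h3
    have hbπ : b ≤ Real.pi := hbΘ.trans hΘ.le
    have hv := hvert hκ' hb hbπ hP hg
    have habs : |L| < L + 1 := by rw [abs_of_pos hL]; exact lt_add_one L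
    have habs' : |-L| < L + 1 := by rwa [abs_neg]
    refine hP.im_neg hκ' hbπ hL (lt_min hκ hb) (θ₁ := min κ b) ?_ ?_ ?_ h1 h2 h3
    · intro z hz hz0 hz1
      have hzm : z ∈ box (L + 1) (-κ) b :=
        ⟨by linarith, by linarith, hz1.trans_le (min_le_right _ _)⟩
      have hzm₀ : z ∈ box (L + 1) (-κ) κ :=
        ⟨by linarith, by linarith, hz1.trans_le (min_le_left _ _)⟩
      rw [hP.eqOn_inter (isOpen_box _ _ _) (isOpen_box _ _ _) (convex_box _ _ _)
        (convex_box _ _ _) hP₀ (zero_mem_box (by linarith) hκ' hb)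
        (zero_mem_box (by linarith) hκ' hκ) hg hg₀ ⟨hzm, hzm₀⟩]
      exact hneg₀ z hzm₀ hz0
    · intro θ h1 h2
      have h3 := (Complex.abs_re_le_norm _).trans ((hv (-L) θ habs' h1 h2).1 (by linarith))
      rw [Complex.sub_re, Complex.ofReal_re] at h3
      linarith [(abs_le.1 h3).1]
    · intro θ h1 h2 h3
      refine re_neg_of_im_eq_zero_right (b := b) (fun x hx hxb => ?_) hbπ (fun x hx hxb =>
        (hv L x habs hx hxb).2 (by linarith)) ?_ h1 h2 h3
      · exact (hP.hasDerivAt_vertical (isOpen_box _ _ _)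
          (vertical_mem_box habs (hκ'.trans_le hx) hxb)).continuousAt
      · rw [hpq.eq_of_orbit hκ' hb hP hg L habs]
        exact hpq.neg L hL
  obtain ⟨M, hM⟩ := exists_norm_le_vertical c (L + 1) (c / 2 + Real.exp (L + 1)) hc0
  set k := Real.exp (-L) * min (Real.sin (κ / 2)) (Real.sin Θ) with hk
  by_cases hκΘ : Θ ≤ κ
  · exact ⟨κ, hκ, P₀, hP₀.mono (box_mono (by linarith) le_rfl hκΘ), hg₀, fun τ hτ =>
      hneg₀ τ (box_mono (by linarith) le_rfl hκΘ hτ)⟩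
  have hκΘ' : κ < Θ := not_le.1 hκΘ
  have hk0 : 0 < k := mul_pos (Real.exp_pos _) (lt_min
    (Real.sin_pos_of_pos_of_lt_pi (by linarith) (by linarith))
    (Real.sin_pos_of_pos_of_lt_pi hΘ0 hΘ))
  obtain ⟨δ₁, hδ₁, hlow⟩ := IsOrbit.exists_lower_bound c M L hk0
    (show 0 < min (1 / 2) (κ / 4) by positivity)
  set δ := min δ₁ (min (p₀ / 2) (1 / 2)) with hδ
  have hδ0 : 0 < δ := by positivity
  have hbounds : ∀ {b : ℝ} {P : ℂ → ℂ}, 0 < b → b ≤ Θ → IsOrbit c (box (L + 1) (-κ) b) P →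
      P =ᶠ[𝓝 0] sepGerm c r → ∀ τ : ℂ, |τ.re| < L + 1 → κ / 2 ≤ τ.im → τ.im < b →
      δ ≤ ‖P τ‖ ∧ ‖P τ‖ ≤ M := by
    intro b P hb hbΘ hP hg τ h1 h2 h3
    have hbπ : b ≤ Real.pi := hbΘ.trans hΘ.le
    have hup : ∀ z : ℂ, |z.re| < L + 1 → 0 ≤ z.im → z.im < b → ‖P z‖ ≤ M := by
      intro z hz hz0 hzb
      have := hM hP hκ' hbπ z.re z.im hz (hP.norm_le hc hr hg hκ' hb hz) hz0 hzb
      rwa [Complex.re_add_im] at this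
    refine ⟨?_, hup τ h1 (by linarith) h3⟩
    have hv := hvert hκ' hb hbπ hP hg τ.re τ.im h1 (by linarith) h3
    rw [Complex.re_add_im] at hv
    rcases le_or_gt τ.re (-(L - 1)) with hl | hl
    · have h4 := hv.1 (by linarith)
      refine ((min_le_right _ _).trans (min_le_left _ _)).trans ?_
      have h5 := norm_sub_norm_le (p₀ : ℂ) (P τ)
      rw [norm_sub_rev, Complex.norm_real, Real.norm_eq_abs, abs_of_pos hp₀] at h5
      linarith
    rcases le_or_gt (L - 1) τ.re with hl' | hl'
    · have h4 := hv.2 (by linarith)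
      refine ((min_le_right _ _).trans (min_le_right _ _)).trans ?_
      have h5 := norm_sub_norm_le (2 / 3 * Complex.exp τ) (P τ ^ 2)
      rw [norm_sub_rev, norm_mul, Complex.norm_exp, norm_pow] at h5
      have h6 : 1 ≤ Real.exp τ.re := Real.one_le_exp (by linarith)
      norm_num at h5
      by_contra hcon
      nlinarith [norm_nonneg (P τ)]
    · refine (min_le_left _ _).trans (hlow (isOpen_box _ _ _) hP (fun z hz hzim => ?_)
        (by linarith) ?_)
      · have h4 := (Complex.abs_re_le_norm _).trans (hz.trans (min_le_left _ _))
        have h5 := (Complex.abs_im_le_norm _).trans (hz.trans (min_le_right _ _))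
        rw [Complex.sub_re, abs_le] at h4
        rw [Complex.sub_im, abs_le] at h5
        have h6 : |z.re| ≤ L := abs_le.2 ⟨by linarith, by linarith⟩
        have h7 : 0 < z.im := by linarith
        exact ⟨⟨by linarith, by linarith, by linarith⟩,
          hneg hb hbΘ hP hg z h6 h7 (by linarith), hup z (by linarith) h7.le (by linarith)⟩
      · rw [Complex.exp_im]
        have h4 : min (Real.sin (κ / 2)) (Real.sin Θ) ≤ Real.sin τ.im :=
          strictConcaveOn_sin_Icc.concaveOn.min_le_of_mem_Icc ⟨by linarith, by linarith⟩
            ⟨by linarith, hΘ.le⟩ ⟨h2, by linarith⟩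
        have h5 : 0 ≤ min (Real.sin (κ / 2)) (Real.sin Θ) :=
          (pos_of_mul_pos_right hk0 (Real.exp_pos _).le).le
        have h6 : -L ≤ τ.re := by linarith
        rw [hk]
        gcongr
  obtain ⟨ρ, hρ, hloc⟩ := exists_local_orbit c hδ0 M (L + 1)
  have hind : ∀ n : ℕ, ∃ P, IsOrbit c (box (L + 1) (-κ) (min (κ + n * (ρ / 2)) Θ)) P ∧
      P =ᶠ[𝓝 0] sepGerm c r := by
    intro n
    induction n with
    | zero => exact ⟨P₀, hP₀.mono (box_mono le_rfl le_rfl (by simp)), hg₀⟩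
    | succ n ih =>
      obtain ⟨P, hP, hg⟩ := ih
      set b := min (κ + n * (ρ / 2)) Θ with hb
      have hκb : κ ≤ b := le_min (le_add_of_nonneg_right (by positivity)) hκΘ'.le
      have hb0 : 0 < b := hκ.trans_le hκb
      have hbΘ : b ≤ Θ := min_le_right _ _
      obtain ⟨P', hP', hPP'⟩ := hP.exists_extension (ρ := ρ) (isOpen_box _ _ _)
        (convex_box _ _ _) (X := {z | |z.re| < L + 1 ∧ κ / 2 ≤ z.im ∧ z.im < b})
        (fun z hz => ⟨hz.1, by linarith [hz.2.1], hz.2.2⟩) (fun z hz => by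
          obtain ⟨h1, h2⟩ := hbounds hb0 hbΘ hP hg z hz.1 hz.2.1 hz.2.2
          exact ⟨norm_pos_iff.1 (hδ0.trans_le h1),
            hloc z (P z) h1 h2 ((le_abs_self _).trans hz.1.le)⟩)
      refine ⟨P', hP'.mono fun z hz => ?_, ?_⟩
      · rcases lt_or_ge z.im b with h | h
        · exact Or.inl ⟨hz.1, hz.2.1, h⟩
        · right
          have hzb : z.im < b + ρ / 2 := by
            rcases le_total (κ + n * (ρ / 2)) Θ with h' | h'
            · rw [hb, min_eq_left h']
              have := hz.2.2.trans_le (min_le_left _ _)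
              push_cast at this
              linarith
            · have := hz.2.2.trans_le (min_le_right _ _)
              rw [hb, min_eq_right h'] at h
              linarith
          have hlt : max (κ / 2) (b - ρ / 4) < b := max_lt (by linarith) (by linarith)
          refine mem_iUnion₂.2 ⟨⟨z.re, max (κ / 2) (b - ρ / 4)⟩,
            ⟨hz.1, le_max_left _ _, hlt⟩, ?_⟩
          rw [Metric.mem_ball, Complex.dist_of_re_eq (by simp), Real.dist_eq, abs_of_nonneg]
          · have := le_max_right (κ / 2) (b - ρ / 4)
            simp only
            linarith
          · simp only
            linarith
      · filter_upwards [hg, (isOpen_box (L + 1) (-κ) b).mem_nhds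
          (zero_mem_box (by linarith) hκ' hb0)] with z hz hz'
        rw [hPP' hz', hz]
  obtain ⟨n, hn⟩ := exists_nat_gt (Θ / (ρ / 2))
  obtain ⟨P, hP, hg⟩ := hind n
  have hmin : min (κ + n * (ρ / 2)) Θ = Θ := by
    rw [div_lt_iff₀ (by positivity)] at hn
    exact min_eq_right (by linarith)
  rw [hmin] at hP
  exact ⟨κ, hκ, P, hP.mono (box_mono (by linarith) le_rfl le_rfl), hg, fun τ hτ h0 =>
    hneg hΘ0 le_rfl hP hg τ (by linarith [hτ.1]) h0 hτ.2.2⟩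

/-! ### The typically real function in the unit disc -/

/-- Reflection in the real axis extends the solution to the lower half of the strip. -/
theorem exists_orbit_symm_strip {c r : ℝ} (hc : 2 ≤ c) (hr : 0 < r) (hcr : r ^ 2 + c * r = 1)
    {L Θ : ℝ} (hL : 0 < L) (hΘ0 : 0 < Θ) (hΘ : Θ < Real.pi) :
    ∃ P, IsOrbit c (box L (-Θ) Θ) P ∧ P =ᶠ[𝓝 0] sepGerm c r ∧
      ∀ τ ∈ box L (-Θ) Θ, (P τ).im * τ.im ≤ 0 := by
  classical
  obtain ⟨κ₀, hκ₀, P, hP, hg, hneg⟩ := exists_orbit_strip hc hr hcr L hΘ0 hΘ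
  set κ := min κ₀ Θ with hκdef
  have hκ : 0 < κ := lt_min hκ₀ hΘ0
  have hκΘ : κ ≤ Θ := min_le_right _ _
  have hsub : box L (-κ) Θ ⊆ box L (-κ₀) Θ :=
    box_mono le_rfl (neg_le_neg (min_le_left _ _)) le_rfl
  replace hP := hP.mono hsub
  have hQ := hP.conj (isOpen_box _ _ _)
  set Q : ℂ → ℂ := fun τ => starRingEnd ℂ (P (starRingEnd ℂ τ)) with hQdef
  set G : ℂ → ℂ := fun τ => if -κ < τ.im then P τ else Q τ with hG
  have hGP : EqOn G P (box L (-κ) Θ) := fun τ hτ => if_pos hτ.2.1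
  have hconj : ∀ τ ∈ box L (-Θ) κ, starRingEnd ℂ τ ∈ box L (-κ) Θ := fun τ hτ =>
    ⟨by simpa using hτ.1, by simpa using hτ.2.2, by simpa using by linarith [hτ.2.1]⟩
  have hGQ : EqOn G Q (box L (-Θ) κ) := by
    intro τ hτ
    by_cases h : -κ < τ.im
    · have h1 : τ ∈ box L (-κ) Θ := ⟨hτ.1, h, hτ.2.2.trans_le hκΘ⟩
      rw [hGP h1, hQdef]
      simp only
      rw [hP.conj_eq hg (by linarith) hΘ0 hL h1 (hconj τ hτ), Complex.conj_conj]
    · exact if_neg h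
  have h1 : IsOrbit c (box L (-κ) Θ) G := hP.congr (isOpen_box _ _ _) hGP
  have h2 : IsOrbit c (box L (-Θ) κ) G := (hQ.mono hconj).congr (isOpen_box _ _ _) hGQ
  refine ⟨G, (h1.union (isOpen_box _ _ _) (isOpen_box _ _ _) h2).mono fun τ hτ => ?_, ?_, ?_⟩
  · by_cases h : -κ < τ.im
    · exact Or.inl ⟨hτ.1, h, hτ.2.2⟩
    · exact Or.inr ⟨hτ.1, hτ.2.1, by linarith⟩
  · filter_upwards [hg, (isOpen_box L (-κ) Θ).mem_nhds (zero_mem_box hL (by linarith) hΘ0)]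
      with τ hτ hτ'
    rw [hGP hτ', hτ]
  · intro τ hτ
    rcases lt_trichotomy τ.im 0 with h | h | h
    · have hm : τ ∈ box L (-Θ) κ := ⟨hτ.1, hτ.2.1, h.trans hκ⟩
      have h3 := hneg _ (hsub (hconj τ hm)) (by simpa using h)
      have h4 : (G τ).im = -(P (starRingEnd ℂ τ)).im := by rw [hGQ hm, hQdef]; simp
      rw [h4]
      nlinarith
    · simp [h]
    · have hm : τ ∈ box L (-κ) Θ := ⟨hτ.1, by linarith, hτ.2.2⟩
      rw [hGP hm]
      nlinarith [hneg _ (hsub hm) h]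

section Disc

variable {z : ℂ}

theorem one_add_ne_zero_of_norm_lt_one (hz : ‖z‖ < 1) : 1 + z ≠ 0 := by
  intro h
  rw [← neg_eq_iff_add_eq_zero] at h
  rw [← h] at hz
  simp at hz

theorem re_cayley_pos (hz : ‖z‖ < 1) : 0 < ((1 - z) / (1 + z)).re := by
  have h0 : 0 < Complex.normSq (1 + z) :=
    Complex.normSq_pos.2 (one_add_ne_zero_of_norm_lt_one hz)
  have h1 : Complex.normSq z < 1 := by
    rw [← Complex.sq_norm]; nlinarith [norm_nonneg z]
  rw [Complex.normSq_apply] at h1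
  rw [Complex.div_re, ← add_div]
  refine div_pos ?_ h0
  simp
  nlinarith

theorem im_cayley (z : ℂ) :
    ((1 - z) / (1 + z)).im = -2 * z.im / Complex.normSq (1 + z) := by
  rw [Complex.div_im, ← sub_div]
  congr 1
  simp
  ring

theorem exp_two_mul_log_cayley (hz : ‖z‖ < 1) :
    Complex.exp (2 * Complex.log ((1 - z) / (1 + z))) = 1 - 4 * z / (1 + z) ^ 2 := by
  have h0 := one_add_ne_zero_of_norm_lt_one hz
  have h1 : (1 - z) / (1 + z) ≠ 0 := fun h => by simpa [h] using re_cayley_pos hz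
  rw [two_mul, Complex.exp_add, Complex.exp_log h1]
  field_simp
  ring

end Disc

/-- In the coordinate `z` of the unit disc, `w = 4 z / (1 + z)²`, the ratio `-h / u` is a typically
real function: its imaginary part has the sign of `Im z`. -/
theorem exists_typicallyReal {c r ρ : ℝ} (hc : 2 ≤ c) (hr : 0 < r) (hcr : r ^ 2 + c * r = 1)
    (hρ0 : 0 < ρ) (hρ : ρ < 1) :
    ∃ F : ℂ → ℂ, (∀ z, ‖z‖ ≤ ρ → DifferentiableAt ℂ F z) ∧
      (F =ᶠ[𝓝 0] fun z => sepFun ℂ c r (4 * z / (1 + z) ^ 2) / (1 - 4 * z / (1 + z) ^ 2)) ∧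
      ∀ z, ‖z‖ ≤ ρ → 0 ≤ (F z).im * z.im := by
  set T : ℂ → ℂ := fun z => 2 * Complex.log ((1 - z) / (1 + z)) with hT
  have hTd : ∀ z : ℂ, ‖z‖ < 1 → DifferentiableAt ℂ T z := by
    intro z hz
    have h1 : DifferentiableAt ℂ (fun z : ℂ => (1 - z) / (1 + z)) z :=
      DifferentiableAt.div (by fun_prop) (by fun_prop) (one_add_ne_zero_of_norm_lt_one hz)
    exact (h1.clog (Or.inl (re_cayley_pos hz))).const_mul 2
  have hTim : ∀ z, (T z).im = 2 * Complex.arg ((1 - z) / (1 + z)) := by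
    intro z; simp [hT, Complex.log_im]
  have hTπ : ∀ z : ℂ, ‖z‖ < 1 → |(T z).im| < Real.pi := by
    intro z hz
    have h1 := Complex.abs_arg_lt_pi_div_two_iff.2 (Or.inl (re_cayley_pos hz))
    rw [hTim, abs_mul, abs_two]
    linarith
  have hB : IsCompact (Metric.closedBall (0 : ℂ) ρ) := isCompact_closedBall _ _
  have hBlt : ∀ z ∈ Metric.closedBall (0 : ℂ) ρ, ‖z‖ < 1 := fun z hz =>
    (mem_closedBall_zero_iff.1 hz).trans_lt hρ
  have hTc : ContinuousOn T (Metric.closedBall 0 ρ) := fun z hz =>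
    (hTd z (hBlt z hz)).continuousAt.continuousWithinAt
  have hne : (Metric.closedBall (0 : ℂ) ρ).Nonempty := ⟨0, Metric.mem_closedBall_self hρ0.le⟩
  obtain ⟨x, hx, hxmax⟩ := hB.exists_isMaxOn hne
    (Complex.continuous_re.comp_continuousOn hTc).abs
  obtain ⟨y, hy, hymax⟩ := hB.exists_isMaxOn hne
    (Complex.continuous_im.comp_continuousOn hTc).abs
  have hyπ := hTπ y (hBlt y hy)
  set L := |(T x).re| + 1 with hL
  set Θ := (|(T y).im| + Real.pi) / 2 with hΘ
  have hΘy : |(T y).im| < Θ := by rw [hΘ]; linarith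
  obtain ⟨P, hP, hg, hsign⟩ := exists_orbit_symm_strip hc hr hcr (L := L) (Θ := Θ) (by positivity)
    (by positivity) (by rw [hΘ]; linarith)
  have hmem : ∀ z, ‖z‖ ≤ ρ → T z ∈ box L (-Θ) Θ := by
    intro z hz
    have h1 : |(T z).re| ≤ |(T x).re| := hxmax (mem_closedBall_zero_iff.2 hz)
    have h2 : |(T z).im| ≤ |(T y).im| := hymax (mem_closedBall_zero_iff.2 hz)
    have h3 := abs_lt.1 (h2.trans_lt hΘy)
    exact ⟨by linarith, h3.1, h3.2⟩
  have hT0 : T 0 = 0 := by simp [hT]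
  refine ⟨fun z => P (T z), fun z hz => ?_, ?_, fun z hz => ?_⟩
  · exact (hP.1.differentiableAt ((isOpen_box _ _ _).mem_nhds (hmem z hz))).comp z
      (hTd z (hz.trans_lt hρ))
  · have h1 : Tendsto T (𝓝 0) (𝓝 0) := by
      have := (hTd 0 (by simp)).continuousAt.tendsto
      rwa [hT0] at this
    filter_upwards [h1.eventually hg, Metric.ball_mem_nhds (0 : ℂ) one_pos] with z hz hz1
    rw [hz, sepGerm, exp_two_mul_log_cayley (mem_ball_zero_iff.1 hz1), sub_sub_cancel]
  · have h1 := hsign (T z) (hmem z hz)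
    have hz1 := hz.trans_lt hρ
    have hn : 0 < Complex.normSq (1 + z) :=
      Complex.normSq_pos.2 (one_add_ne_zero_of_norm_lt_one hz1)
    rcases lt_trichotomy z.im 0 with h | h | h
    · have h2 : 0 < (T z).im := by
        rw [hTim]
        have h3 : 0 < ((1 - z) / (1 + z)).im := by
          rw [im_cayley]; exact div_pos (by linarith) hn
        have h4 := Complex.arg_nonneg_iff.2 h3.le
        have h5 : Complex.arg ((1 - z) / (1 + z)) ≠ 0 := fun h5 =>
          h3.ne' (Complex.arg_eq_zero_iff.1 h5).2
        have := lt_of_le_of_ne h4 h5.symm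
        linarith
      have h3 : (P (T z)).im ≤ 0 := by
        by_contra hcon
        nlinarith
      nlinarith
    · simp [h]
    · have h2 : (T z).im < 0 := by
        rw [hTim]
        have h3 : ((1 - z) / (1 + z)).im < 0 := by
          rw [im_cayley]; exact div_neg_of_neg_of_pos (by linarith) hn
        have := Complex.arg_neg_iff.2 h3
        linarith
      have h3 : 0 ≤ (P (T z)).im := by
        by_contra hcon
        nlinarith
      positivity

/-! ### Moments and residues -/

/-- The moments `s_n`: the coefficients of `S(w) = ∑ s_n w^n`, where
`-h(1 - w) = r w (1 - w) S(w)`. -/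
noncomputable def sepMoment (c r : ℝ) (n : ℕ) : ℝ :=
  1 - (∑ j ∈ Finset.range n, sepCoeff c r j) / r

theorem sepMoment_zero (c r : ℝ) : sepMoment c r 0 = 1 := by simp [sepMoment]

theorem sepMoment_succ (c r : ℝ) (n : ℕ) :
    sepMoment c r (n + 1) = sepMoment c r n - sepCoeff c r n / r := by
  rw [sepMoment, sepMoment, Finset.sum_range_succ, add_div]; ring

/-- The linear functional on polynomials with prescribed moments `L(X^k) = s_k`. -/
noncomputable def momentFunctional (s : ℕ → ℝ) : ℝ[X] →ₗ[ℝ] ℝ :=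
  Polynomial.lsum fun k => s k • LinearMap.id

theorem momentFunctional_monomial (s : ℕ → ℝ) (k : ℕ) (a : ℝ) :
    momentFunctional s (monomial k a) = s k * a := by
  simp [momentFunctional]

theorem momentFunctional_X_pow (s : ℕ → ℝ) (k : ℕ) : momentFunctional s (X ^ k) = s k := by
  rw [← monomial_one_right_eq_X_pow, momentFunctional_monomial, mul_one]

section Contour

/-- The tail `∑ α_{n+k} w^n` of the series `A`. -/
noncomputable def sepTail (c r : ℝ) (k : ℕ) (w : ℂ) : ℂ := ∑' n, (sepCoeff c r (n + k) : ℂ) * w ^ n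

theorem summable_sepCoeff_tail {c r ϱ : ℝ} (hϱ : 0 < ϱ)
    (hs : Summable fun n => sepCoeff c r n * ϱ ^ n) (k : ℕ) :
    Summable fun n => sepCoeff c r (n + k) * ϱ ^ n := by
  refine (((summable_nat_add_iff k).2 hs).mul_right (ϱ ^ k)⁻¹).congr fun n => ?_
  rw [pow_add]; field_simp

theorem differentiableAt_sepTail {c r ϱ : ℝ} (hc : 0 < c) (hr : 0 < r)
    (hs : Summable fun n => sepCoeff c r n * ϱ ^ n) (k : ℕ) {w : ℂ} (hw : ‖w‖ < ϱ) :
    DifferentiableAt ℂ (sepTail c r k) w := by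
  have hϱ : 0 < ϱ := (norm_nonneg w).trans_lt hw
  have h1 := hasFPowerSeriesOnBall_tsum (𝕜 := ℂ) (a := fun n => (sepCoeff c r (n + k) : ℂ)) hϱ
    ((summable_sepCoeff_tail hϱ hs k).congr fun n => by
      have h : ‖(sepCoeff c r (n + k) : ℂ)‖ = sepCoeff c r (n + k) := norm_sepCoeff hc hr _
      rw [h])
  refine (h1.analyticAt_of_mem ?_).differentiableAt
  rw [Metric.mem_eball, edist_dist, dist_zero_right]
  exact (ENNReal.ofReal_lt_ofReal_iff hϱ).2 hw

theorem sepTail_eq {c r ϱ : ℝ} (hc : 0 < c) (hr : 0 < r)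
    (hs : Summable fun n => sepCoeff c r n * ϱ ^ n) (k : ℕ) {w : ℂ} (hw : ‖w‖ < ϱ) :
    sepTail c r k w = sepCoeff c r k + w * sepTail c r (k + 1) w := by
  have hϱ : 0 < ϱ := (norm_nonneg w).trans_lt hw
  have h1 : Summable fun n => (sepCoeff c r (n + k) : ℂ) * w ^ n := by
    refine Summable.of_norm_bounded (summable_sepCoeff_tail hϱ hs k) fun n => ?_
    have h2 : ‖(sepCoeff c r (n + k) : ℂ)‖ = sepCoeff c r (n + k) := norm_sepCoeff hc hr _
    rw [norm_mul, norm_pow, h2]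
    have := (sepCoeff_pos hc hr (n + k)).le
    gcongr
  rw [sepTail, h1.tsum_eq_zero_add, sepTail, ← tsum_mul_left]
  simp only [zero_add, pow_zero, mul_one]
  congr 1
  refine tsum_congr fun n => ?_
  rw [show n + 1 + k = n + (k + 1) by ring]; ring

theorem sepFun_eq_sum_add {c r ϱ : ℝ} (hc : 0 < c) (hr : 0 < r)
    (hs : Summable fun n => sepCoeff c r n * ϱ ^ n) {w : ℂ} (hw : ‖w‖ < ϱ) (k : ℕ) :
    sepFun ℂ c r w = (1 - w) * ∑ j ∈ Finset.range k, (r * sepMoment c r j : ℂ) * w ^ (j + 1) +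
      w ^ (k + 1) * (r * sepMoment c r k - w * sepTail c r k w) := by
  induction k with
  | zero =>
    simp only [sepFun, sepSeries, sepTail, sepMoment_zero, Finset.range_zero, Finset.sum_empty,
      add_zero, Complex.ofReal_one, Complex.coe_algebraMap]
    simp
    ring
  | succ k ih =>
    have hr' : (r : ℂ) ≠ 0 := by exact_mod_cast hr.ne'
    rw [ih, Finset.sum_range_succ, sepTail_eq hc hr hs k hw, sepMoment_succ]
    push_cast
    field_simp
    ring

/-- The inverse `1 / w` of the coordinate `w = 4 z / (1 + z)²`; it maps the unit circle to
`[0, 1]`. -/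
noncomputable def slitCoord (z : ℂ) : ℂ := (1 + z) ^ 2 / (4 * z)

/-- Minus the derivative of `slitCoord`. -/
noncomputable def slitDensity (z : ℂ) : ℂ := (1 - z ^ 2) / (4 * z ^ 2)

theorem hasDerivAt_slitCoord {z : ℂ} (hz : z ≠ 0) :
    HasDerivAt slitCoord (-slitDensity z) z := by
  have h1 : HasDerivAt (fun z : ℂ => (1 + z) ^ 2) (2 * (1 + z)) z := by
    refine ((hasDerivAt_id z).const_add 1).pow 2 |>.congr_deriv ?_
    simp
  have h2 : HasDerivAt (fun z : ℂ => 4 * z) 4 z := by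
    simpa using (hasDerivAt_id z).const_mul (4 : ℂ)
  refine (h1.div h2 (mul_ne_zero (by norm_num) hz)).congr_deriv ?_
  rw [slitDensity]
  field_simp
  ring

theorem continuousOn_slitDensity {U : Set ℂ} (hU : (0 : ℂ) ∉ U) : ContinuousOn slitDensity U := by
  refine ContinuousOn.div (by fun_prop) (by fun_prop) fun z hz => ?_
  have : z ≠ 0 := fun h => hU (h ▸ hz)
  exact mul_ne_zero (by norm_num) (pow_ne_zero 2 this)

/-- The function `-h / u` in the coordinate `z`. -/
noncomputable def discGerm (c r : ℝ) (z : ℂ) : ℂ :=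
  sepFun ℂ c r (4 * z / (1 + z) ^ 2) / (1 - 4 * z / (1 + z) ^ 2)

theorem one_sub_koebe_ne_zero {z : ℂ} (hz : ‖z‖ < 1) : 1 - 4 * z / (1 + z) ^ 2 ≠ 0 := by
  rw [← exp_two_mul_log_cayley hz]; exact Complex.exp_ne_zero _

theorem differentiableAt_koebe {z : ℂ} (hz : ‖z‖ < 1) :
    DifferentiableAt ℂ (fun z : ℂ => 4 * z / (1 + z) ^ 2) z :=
  DifferentiableAt.div (by fun_prop) (by fun_prop)
    (pow_ne_zero 2 (one_add_ne_zero_of_norm_lt_one hz))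

theorem differentiableAt_discGerm {c r ϱ : ℝ} (hc : 0 < c) (hr : 0 < r)
    (hs : Summable fun n => sepCoeff c r n * ϱ ^ n) {z : ℂ} (hz : ‖z‖ < 1)
    (hw : ‖4 * z / (1 + z) ^ 2‖ < ϱ) : DifferentiableAt ℂ (discGerm c r) z := by
  have h1 : DifferentiableAt ℂ (sepFun ℂ c r) (4 * z / (1 + z) ^ 2) :=
    ((differentiableAt_id).const_mul _).sub
      ((differentiableAt_id.pow 2).mul (differentiableAt_sepSeries hc hr hs hw))
  have h2 : DifferentiableAt ℂ (fun z => sepFun ℂ c r (4 * z / (1 + z) ^ 2)) z :=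
    DifferentiableAt.fun_comp' z h1 (differentiableAt_koebe hz)
  exact h2.div ((differentiableAt_koebe hz).const_sub 1) (one_sub_koebe_ne_zero hz)

/-- Residue computation: in `-h / u = r ∑ s_j w^{j+1}`, only the term `j = k` contributes, because
for `T = slitCoord z = 1 / w` the product `T^{k-j-1} T'` is a derivative for `j < k` and the
remaining terms are holomorphic. -/
theorem circleIntegral_discGerm_pow {c r ϱ ε : ℝ} (hc : 0 < c) (hr : 0 < r)
    (hs : Summable fun n => sepCoeff c r n * ϱ ^ n) (hε : 0 < ε) (hε1 : ε < 1)
    (hw : ∀ z : ℂ, ‖z‖ ≤ ε → ‖4 * z / (1 + z) ^ 2‖ < ϱ) (k : ℕ) :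
    (∮ z in C(0, ε), discGerm c r z * slitCoord z ^ k * slitDensity z) =
      2 * Real.pi * Complex.I * (r * sepMoment c r k) := by
  set w : ℂ → ℂ := fun z => 4 * z / (1 + z) ^ 2 with hwdef
  set H : ℂ → ℂ := fun z =>
    (r * sepMoment c r (k + 1) - w z * sepTail c r (k + 1) (w z)) / (1 - w z) with hH
  set g : ℂ → ℂ := fun z => -2 * (r * sepMoment c r k) / (1 + z) + 4 * (1 - z) / (1 + z) ^ 3 * H z
    with hg
  set Φ : ℂ → ℂ := fun z => ∑ j ∈ Finset.range k,
    (r * sepMoment c r j : ℂ) * slitCoord z ^ (k - j - 1) * slitDensity z with hΦ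
  have hlt : ∀ z : ℂ, ‖z‖ ≤ ε → ‖z‖ < 1 := fun z hz => hz.trans_lt hε1
  have hne : ∀ z ∈ Metric.sphere (0 : ℂ) ε, z ≠ 0 := fun z hz h => by
    rw [h, mem_sphere_zero_iff_norm, norm_zero] at hz; exact hε.ne hz
  have hexp : ∀ z ∈ Metric.sphere (0 : ℂ) ε,
      discGerm c r z * slitCoord z ^ k * slitDensity z =
        Φ z + (r * sepMoment c r k) * (z - 0)⁻¹ + g z := by
    intro z hz
    have hz0 := hne z hz
    have hzε : ‖z‖ ≤ ε := (mem_sphere_zero_iff_norm.1 hz).le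
    have h1 := one_add_ne_zero_of_norm_lt_one (hlt z hzε)
    have h2 := one_sub_koebe_ne_zero (hlt z hzε)
    have hTw : slitCoord z * w z = 1 := by rw [slitCoord, hwdef]; field_simp
    have hTwp : ∀ n : ℕ, slitCoord z ^ n * w z ^ n = 1 := fun n => by
      rw [← mul_pow, hTw, one_pow]
    have e : ∀ x a b : ℂ, 1 - x ≠ 0 →
        ((1 - x) * a + x ^ (k + 1 + 1) * b) / (1 - x) = a + x ^ (k + 2) * (b / (1 - x)) := by
      intro x a b hx
      field_simp
    have h3 : discGerm c r z = (∑ j ∈ Finset.range (k + 1), (r * sepMoment c r j : ℂ) *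
        w z ^ (j + 1)) + w z ^ (k + 2) * H z := by
      have h2' : 1 - w z ≠ 0 := h2
      change sepFun ℂ c r (w z) / (1 - w z) = _
      rw [sepFun_eq_sum_add hc hr hs (hw z hzε) (k + 1)]
      exact e (w z) _ _ h2'
    have h4 : ∀ j ∈ Finset.range k, (r * sepMoment c r j : ℂ) * w z ^ (j + 1) * slitCoord z ^ k =
        (r * sepMoment c r j : ℂ) * slitCoord z ^ (k - j - 1) := by
      intro j hj
      have : k = (k - j - 1) + (j + 1) := by have := Finset.mem_range.1 hj; omega
      conv_lhs => rw [this, pow_add]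
      linear_combination (r * sepMoment c r j : ℂ) * slitCoord z ^ (k - j - 1) * hTwp (j + 1)
    have h5 : w z * slitDensity z = z⁻¹ - 2 / (1 + z) := by
      rw [slitDensity, hwdef]; field_simp; ring
    have h6 : w z ^ 2 * slitDensity z = 4 * (1 - z) / (1 + z) ^ 3 := by
      rw [slitDensity, hwdef]; field_simp; ring
    have h7 : Φ z = (∑ j ∈ Finset.range k, (r * sepMoment c r j : ℂ) * w z ^ (j + 1)) *
        slitCoord z ^ k * slitDensity z := by
      rw [hΦ, Finset.sum_mul, Finset.sum_mul]
      exact Finset.sum_congr rfl fun j hj => by rw [h4 j hj]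
    rw [h3, Finset.sum_range_succ, h7, hg, sub_zero]
    simp only
    rw [← h6]
    linear_combination (slitDensity z * w z * (r * sepMoment c r k) +
      slitDensity z * w z ^ 2 * H z) * hTwp k + (r * sepMoment c r k) * h5
  have hsph0 : (0 : ℂ) ∉ Metric.sphere (0 : ℂ) ε := fun h => hne 0 h rfl
  have hTc : ContinuousOn slitCoord (Metric.sphere (0 : ℂ) ε) := fun z hz =>
    (hasDerivAt_slitCoord (hne z hz)).continuousAt.continuousWithinAt
  have hΦc : ContinuousOn Φ (Metric.sphere (0 : ℂ) ε) :=
    continuousOn_finsetSum _ fun j _ => (continuousOn_const.mul (hTc.pow _)).mul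
      (continuousOn_slitDensity hsph0)
  have hΦ0 : (∮ z in C(0, ε), Φ z) = 0 := by
    refine circleIntegral.integral_eq_zero_of_hasDerivWithinAt hε.le
      (f := fun z => ∑ j ∈ Finset.range k,
        (r * sepMoment c r j : ℂ) * (-(slitCoord z ^ (k - j) / (k - j : ℕ)))) fun z hz => ?_
    refine (HasDerivAt.fun_sum fun j hj => ?_).hasDerivWithinAt
    have hkj : 0 < k - j := by have := Finset.mem_range.1 hj; omega
    have hkj' : ((k - j : ℕ) : ℂ) ≠ 0 := by exact_mod_cast hkj.ne'
    refine (((((hasDerivAt_slitCoord (hne z hz)).pow (k - j)).div_const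
      ((k - j : ℕ) : ℂ)).neg).const_mul (r * sepMoment c r j : ℂ)).congr_deriv ?_
    field_simp
  have hgd : ∀ z : ℂ, ‖z‖ ≤ ε → DifferentiableAt ℂ g z := by
    intro z hz
    have h1 := one_add_ne_zero_of_norm_lt_one (hlt z hz)
    have h2 := one_sub_koebe_ne_zero (hlt z hz)
    have h3 : DifferentiableAt ℂ w z := differentiableAt_koebe (hlt z hz)
    have h4 : DifferentiableAt ℂ (fun z => sepTail c r (k + 1) (w z)) z :=
      DifferentiableAt.fun_comp' z (differentiableAt_sepTail hc hr hs (k + 1) (hw z hz)) h3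
    have h5 : DifferentiableAt ℂ H z :=
      ((h3.mul h4).const_sub _).div (h3.const_sub 1) h2
    have h6 : DifferentiableAt ℂ (fun z : ℂ => -2 * (r * sepMoment c r k : ℂ) / (1 + z)) z :=
      DifferentiableAt.div (by fun_prop) (by fun_prop) h1
    have h7 : DifferentiableAt ℂ (fun z : ℂ => 4 * (1 - z) / (1 + z) ^ 3) z :=
      DifferentiableAt.div (by fun_prop) (by fun_prop) (pow_ne_zero 3 h1)
    exact h6.add (h7.mul h5)
  have hgc : ContinuousOn g (Metric.closedBall 0 ε) := fun z hz =>
    (hgd z (mem_closedBall_zero_iff.1 hz)).continuousAt.continuousWithinAt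
  have hg0 : (∮ z in C(0, ε), g z) = 0 :=
    Complex.circleIntegral_eq_zero_of_differentiable_on_off_countable hε.le countable_empty hgc
      fun z hz => hgd z (mem_ball_zero_iff.1 hz.1).le
  have hinv : ContinuousOn (fun z : ℂ => (r * sepMoment c r k : ℂ) * (z - 0)⁻¹)
      (Metric.sphere 0 ε) :=
    continuousOn_const.mul (ContinuousOn.inv₀ (by fun_prop) fun z hz => by
      rw [sub_zero]; exact hne z hz)
  have hadd : ContinuousOn (fun z => Φ z + (r * sepMoment c r k : ℂ) * (z - 0)⁻¹)
      (Metric.sphere 0 ε) := hΦc.add hinv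
  rw [circleIntegral.integral_congr hε.le hexp, circleIntegral.integral_add
    (hadd.circleIntegrable hε.le)
    ((hgc.mono Metric.sphere_subset_closedBall).circleIntegrable hε.le),
    circleIntegral.integral_add (hΦc.circleIntegrable hε.le) (hinv.circleIntegrable hε.le),
    hΦ0, hg0, circleIntegral.integral_const_mul,
    circleIntegral.integral_sub_inv_of_mem_ball (Metric.mem_ball_self hε)]
  ring

/-- The moment functional as a contour integral: on a small circle around `z = 0` it is the
residue. -/
theorem circleIntegral_discGerm {c r ϱ ε : ℝ} (hc : 0 < c) (hr : 0 < r)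
    (hs : Summable fun n => sepCoeff c r n * ϱ ^ n) (hε : 0 < ε) (hε1 : ε < 1)
    (hw : ∀ z : ℂ, ‖z‖ ≤ ε → ‖4 * z / (1 + z) ^ 2‖ < ϱ) (Q : ℝ[X]) :
    (∮ z in C(0, ε), discGerm c r z * aeval (slitCoord z) Q * slitDensity z) =
      2 * Real.pi * Complex.I * (r * momentFunctional (sepMoment c r) Q) := by
  have hne : ∀ z ∈ Metric.sphere (0 : ℂ) ε, z ≠ 0 := fun z hz h => by
    rw [h, mem_sphere_zero_iff_norm, norm_zero] at hz; exact hε.ne hz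
  have hcont : ∀ Q : ℝ[X], ContinuousOn
      (fun z => discGerm c r z * aeval (slitCoord z) Q * slitDensity z) (Metric.sphere 0 ε) := by
    intro Q
    refine ContinuousOn.mul (ContinuousOn.mul (fun z hz => ?_) ?_)
      (continuousOn_slitDensity fun h => hne 0 h rfl)
    · have hz' := (mem_sphere_zero_iff_norm.1 hz).le
      exact (differentiableAt_discGerm hc hr hs (hz'.trans_lt hε1)
        (hw z hz')).continuousAt.continuousWithinAt
    · exact Q.continuous_aeval.comp_continuousOn fun z hz =>
        (hasDerivAt_slitCoord (hne z hz)).continuousAt.continuousWithinAt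
  induction Q using Polynomial.induction_on' with
  | add P Q hP hQ =>
    simp only [map_add, mul_add, add_mul]
    rw [circleIntegral.integral_add ((hcont P).circleIntegrable hε.le)
      ((hcont Q).circleIntegrable hε.le), hP, hQ]
    push_cast
    ring
  | monomial k a =>
    have h1 : ∀ z : ℂ, discGerm c r z * aeval (slitCoord z) (monomial k a) * slitDensity z =
        (a : ℂ) * (discGerm c r z * slitCoord z ^ k * slitDensity z) := by
      intro z
      rw [aeval_monomial, Complex.coe_algebraMap]; ring
    simp_rw [h1]
    rw [circleIntegral.integral_const_mul, circleIntegral_discGerm_pow hc hr hs hε hε1 hw,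
      momentFunctional_monomial]
    push_cast
    ring

end Contour

/-! ### Nonnegativity of the moment functional -/

/-- On the unit circle, for `T = slitCoord z`, the density `-T' dz` is `½ sin φ dφ` and
`T = (1 + cos φ) / 2` is real, so a typically real function has an integral with nonnegative
imaginary part. -/
theorem im_circleIntegral_nonneg {f : ℂ → ℂ} (hf : ContinuousOn f (Metric.sphere 0 1))
    (hsign : ∀ z ∈ Metric.sphere (0 : ℂ) 1, 0 ≤ (f z).im * z.im) {Q : ℝ[X]}
    (hQ : ∀ t ∈ Icc (0 : ℝ) 1, 0 ≤ Q.eval t) :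
    0 ≤ (∮ z in C(0, 1), f z * aeval (slitCoord z) Q * slitDensity z).im := by
  have hmem : ∀ θ : ℝ, circleMap 0 1 θ ∈ Metric.sphere (0 : ℂ) 1 := fun θ =>
    circleMap_mem_sphere 0 zero_le_one θ
  have hne : ∀ z ∈ Metric.sphere (0 : ℂ) 1, z ≠ 0 := fun z hz h => by
    rw [h, mem_sphere_zero_iff_norm, norm_zero] at hz; exact zero_ne_one hz
  have hT : ∀ θ : ℝ, slitCoord (circleMap 0 1 θ) = ((1 + Real.cos θ) / 2 : ℝ) := by
    intro θ
    have h0 := Complex.exp_ne_zero (θ * Complex.I)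
    rw [slitCoord, circleMap_zero, Complex.ofReal_one, one_mul]
    push_cast
    rw [Complex.cos, neg_mul, Complex.exp_neg]
    field_simp
    ring
  have hD : ∀ θ : ℝ, deriv (circleMap 0 1) θ * slitDensity (circleMap 0 1 θ) =
      (Real.sin θ / 2 : ℝ) := by
    intro θ
    have h0 := Complex.exp_ne_zero (θ * Complex.I)
    rw [slitDensity, deriv_circleMap, circleMap_zero, Complex.ofReal_one, one_mul]
    push_cast
    rw [Complex.sin, neg_mul, Complex.exp_neg]
    field_simp
    ring
  have hval : ∀ θ : ℝ, deriv (circleMap 0 1) θ • (f (circleMap 0 1 θ) *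
      aeval (slitCoord (circleMap 0 1 θ)) Q * slitDensity (circleMap 0 1 θ)) =
      f (circleMap 0 1 θ) * (Q.eval ((1 + Real.cos θ) / 2) * (Real.sin θ / 2) : ℝ) := by
    intro θ
    have h1 : aeval (slitCoord (circleMap 0 1 θ)) Q = (Q.eval ((1 + Real.cos θ) / 2) : ℝ) := by
      rw [hT, ← Complex.coe_algebraMap, aeval_algebraMap_apply, coe_aeval_eq_eval]
    rw [smul_eq_mul, h1, Complex.ofReal_mul, ← hD]
    ring
  have hcont : Continuous fun θ : ℝ =>
      f (circleMap 0 1 θ) * (Q.eval ((1 + Real.cos θ) / 2) * (Real.sin θ / 2) : ℝ) := by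
    have h1 : Continuous fun θ : ℝ => f (circleMap 0 1 θ) :=
      hf.comp_continuous (continuous_circleMap 0 1) hmem
    have h2 : Continuous fun θ : ℝ => Q.eval ((1 + Real.cos θ) / 2) :=
      Q.continuous.comp (by fun_prop)
    exact h1.mul (Complex.continuous_ofReal.comp (h2.mul (by fun_prop)))
  simp only [circleIntegral, hval]
  have h1 := Complex.imCLM.intervalIntegral_comp_comm
    (hcont.intervalIntegrable (μ := MeasureTheory.volume) 0 (2 * Real.pi))
  rw [Complex.imCLM_apply] at h1
  rw [← h1]
  refine intervalIntegral.integral_nonneg Real.two_pi_pos.le fun θ _ => ?_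
  have h2 := hsign _ (hmem θ)
  have h3 : (circleMap 0 1 θ).im = Real.sin θ := by
    rw [circleMap_zero, Complex.ofReal_one, one_mul, Complex.exp_ofReal_mul_I_im]
  have h4 := hQ ((1 + Real.cos θ) / 2)
    ⟨by linarith [Real.neg_one_le_cos θ], by linarith [Real.cos_le_one θ]⟩
  rw [h3] at h2
  rw [Complex.imCLM_apply, Complex.im_mul_ofReal]
  have := mul_nonneg h4 h2
  linarith

/-- The moment functional is nonnegative on polynomials that are nonnegative on `[0, 1]`. The
contour of the residue integral is moved to the unit circle, after rescaling `z` by `ρ < 1`. -/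
theorem momentFunctional_nonneg {c r : ℝ} (hc : 2 ≤ c) (hr : 0 < r) (hcr : r ^ 2 + c * r = 1)
    {Q : ℝ[X]} (hQ : ∀ t ∈ Icc (0 : ℝ) 1, 0 ≤ Q.eval t) :
    0 ≤ momentFunctional (sepMoment c r) Q := by
  have hc0 : 0 < c := by linarith
  obtain ⟨ϱ, hϱ, hs⟩ := exists_summable_sepCoeff hc0 hr
  obtain ⟨ε', hε', hball⟩ : ∃ ε' > 0, ∀ z ∈ Metric.ball (0 : ℂ) ε', ‖4 * z / (1 + z) ^ 2‖ < ϱ := by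
    have h1 : ContinuousAt (fun z : ℂ => ‖4 * z / (1 + z) ^ 2‖) 0 :=
      (differentiableAt_koebe (by simp)).continuousAt.norm
    exact Metric.eventually_nhds_iff_ball.1 (h1.eventually_lt_const (by simpa using hϱ))
  set ε := min ε' 1 / 2 with hε
  have hmin : 0 < min ε' 1 := lt_min hε' one_pos
  have hε0 : 0 < ε := half_pos hmin
  have hε1 : ε < 1 := by linarith [min_le_right ε' 1]
  have hεε' : ε < ε' := by linarith [min_le_left ε' 1]
  have hw : ∀ z : ℂ, ‖z‖ ≤ ε → ‖4 * z / (1 + z) ^ 2‖ < ϱ := fun z hz =>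
    hball z (mem_ball_zero_iff.2 (hz.trans_lt hεε'))
  have hGd : ∀ z ∈ Metric.ball (0 : ℂ) (min ε' 1), DifferentiableAt ℂ (discGerm c r) z := by
    intro z hz
    rw [mem_ball_zero_iff] at hz
    exact differentiableAt_discGerm hc0 hr hs (hz.trans_le (min_le_right _ _))
      (hball z (mem_ball_zero_iff.2 (hz.trans_le (min_le_left _ _))))
  have hGc : ContinuousOn (discGerm c r) (Metric.closedBall 0 ε) := fun z hz =>
    (hGd z (mem_ball_zero_iff.2 ((mem_closedBall_zero_iff.1 hz).trans_lt
      (by linarith)))).continuousAt.continuousWithinAt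
  -- the integral over the small circle for the function rescaled by `ρ`
  set J : ℝ → ℂ := fun ρ =>
    ∮ z in C(0, ε), discGerm c r (ρ * z) * aeval (slitCoord z) Q * slitDensity z with hJ
  have hJ1 : J 1 = 2 * Real.pi * Complex.I * (r * momentFunctional (sepMoment c r) Q) := by
    simp only [hJ, Complex.ofReal_one, one_mul]
    exact circleIntegral_discGerm hc0 hr hs hε0 hε1 hw Q
  have hJpos : ∀ ρ ∈ Ioo (0 : ℝ) 1, 0 ≤ (J ρ).im := by
    intro ρ hρ
    obtain ⟨F, hFd, hFg, hFs⟩ := exists_typicallyReal hc hr hcr hρ.1 hρ.2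
    have heq : EqOn F (discGerm c r) (Metric.ball 0 (min (min ε' 1) ρ)) := by
      refine AnalyticOnNhd.eqOn_of_preconnected_of_eventuallyEq (z₀ := 0)
        (DifferentiableOn.analyticOnNhd (fun z hz => ?_) Metric.isOpen_ball)
        (DifferentiableOn.analyticOnNhd (fun z hz => ?_) Metric.isOpen_ball)
        (convex_ball _ _).isPreconnected (Metric.mem_ball_self (lt_min hmin hρ.1)) hFg
      · exact (hFd z ((mem_ball_zero_iff.1 hz).le.trans
          (min_le_right _ _))).differentiableWithinAt
      · exact (hGd z (Metric.ball_subset_ball (min_le_left _ _) hz)).differentiableWithinAt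
    have hnorm : ∀ z : ℂ, ‖(ρ : ℂ) * z‖ = ρ * ‖z‖ := fun z => by
      rw [norm_mul, Complex.norm_real, Real.norm_eq_abs, abs_of_pos hρ.1]
    have hFd' : ∀ z : ℂ, ‖z‖ ≤ 1 → DifferentiableAt ℂ (fun z => F (ρ * z)) z := by
      intro z hz
      have h1 : DifferentiableAt ℂ F (ρ * z) := hFd _ (by
        rw [hnorm]; exact mul_le_of_le_one_right hρ.1.le hz)
      exact DifferentiableAt.fun_comp' z h1 (by fun_prop)
    have h1 : J ρ = ∮ z in C(0, 1), F (ρ * z) * aeval (slitCoord z) Q * slitDensity z := by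
      have hfd : ∀ z : ℂ, ‖z‖ ≤ 1 → z ≠ 0 → DifferentiableAt ℂ
          (fun z => F (ρ * z) * aeval (slitCoord z) Q * slitDensity z) z := by
        intro z hz hz0
        have h2 : DifferentiableAt ℂ slitDensity z :=
          DifferentiableAt.div (by fun_prop) (by fun_prop)
            (mul_ne_zero (by norm_num) (pow_ne_zero 2 hz0))
        have h3 : DifferentiableAt ℂ (fun z => aeval (slitCoord z) Q) z :=
          DifferentiableAt.fun_comp' z (Q.differentiable_aeval _)
            (hasDerivAt_slitCoord hz0).differentiableAt
        exact ((hFd' z hz).mul h3).mul h2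
      rw [Complex.circleIntegral_eq_of_differentiable_on_annulus_off_countable hε0 hε1.le
        countable_empty (fun z hz => ?_) fun z hz => ?_]
      · refine circleIntegral.integral_congr hε0.le fun z hz => ?_
        have hz' := mem_sphere_zero_iff_norm.1 hz
        rw [heq (mem_ball_zero_iff.2 ?_)]
        rw [hnorm, hz']
        refine lt_min ?_ ?_
        · calc ρ * ε ≤ ε := mul_le_of_le_one_left hε0.le hρ.2.le
            _ < _ := by linarith
        · exact mul_lt_of_lt_one_right hρ.1 hε1
      · refine (hfd z (mem_closedBall_zero_iff.1 hz.1) fun h => hz.2 ?_).continuousAt.continuousWithinAt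
        rw [h]; exact Metric.mem_ball_self hε0
      · refine hfd z (mem_ball_zero_iff.1 hz.1.1).le fun h => hz.1.2 ?_
        rw [h]; exact Metric.mem_closedBall_self hε0.le
    rw [h1]
    refine im_circleIntegral_nonneg (fun z hz => (hFd' z
      (mem_sphere_zero_iff_norm.1 hz).le).continuousAt.continuousWithinAt) (fun z hz => ?_) hQ
    have h2 := hFs (ρ * z) (by rw [hnorm, mem_sphere_zero_iff_norm.1 hz, mul_one])
    rw [Complex.im_ofReal_mul] at h2
    nlinarith [hρ.1]
  have hJc : Tendsto J (𝓝[<] 1) (𝓝 (J 1)) := by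
    set π : ℝ → ℝ := fun x => (projIcc (0 : ℝ) 1 zero_le_one x : ℝ) with hπ
    have hπc : Continuous π := continuous_subtype_val.comp continuous_projIcc
    have hne : ∀ θ : ℝ, circleMap 0 ε θ ≠ 0 := fun θ => circleMap_ne_center hε0.ne'
    have hmem : ∀ x θ : ℝ, (π x : ℂ) * circleMap 0 ε θ ∈ Metric.closedBall (0 : ℂ) ε := by
      intro x θ
      have h1 := (projIcc (0 : ℝ) 1 zero_le_one x).2
      rw [mem_closedBall_zero_iff, norm_mul, Complex.norm_real, norm_circleMap_zero,
        abs_of_pos hε0, Real.norm_eq_abs, abs_of_nonneg h1.1]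
      exact mul_le_of_le_one_left hε0.le h1.2
    have hcont : Continuous fun x => J (π x) := by
      simp only [hJ, circleIntegral]
      refine intervalIntegral.continuous_parametric_intervalIntegral_of_continuous' ?_ _ _
      have h1 : Continuous fun y : ℝ × ℝ => discGerm c r (π y.1 * circleMap 0 ε y.2) :=
        hGc.comp_continuous ((Complex.continuous_ofReal.comp (hπc.comp continuous_fst)).mul
          ((continuous_circleMap 0 ε).comp continuous_snd)) fun y => hmem _ _
      have h2 : Continuous fun θ : ℝ => slitCoord (circleMap 0 ε θ) :=
        continuous_iff_continuousAt.2 fun θ => ContinuousAt.comp (g := slitCoord)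
          (hasDerivAt_slitCoord (hne θ)).continuousAt (continuous_circleMap 0 ε).continuousAt
      have h3 : Continuous fun θ : ℝ => slitDensity (circleMap 0 ε θ) :=
        (continuousOn_slitDensity (U := {0}ᶜ) (by simp)).comp_continuous
          (continuous_circleMap 0 ε) hne
      have h4 : Continuous fun θ : ℝ => aeval (slitCoord (circleMap 0 ε θ)) Q :=
        Q.continuous_aeval.comp h2
      have h5 : Continuous (deriv (circleMap 0 ε)) := by
        have : deriv (circleMap 0 ε) = fun θ => circleMap 0 ε θ * Complex.I := by
          ext θ; rw [deriv_circleMap]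
        rw [this]; fun_prop
      simp only [Function.uncurry_def]
      exact (h5.comp continuous_snd).smul ((h1.mul (h4.comp continuous_snd)).mul
        (h3.comp continuous_snd))
    have h1 := (hcont.tendsto 1).mono_left (nhdsWithin_le_nhds (s := Iio 1))
    have h2 : π 1 = 1 := by simp [hπ]
    rw [h2] at h1
    refine h1.congr' ?_
    filter_upwards [Ioo_mem_nhdsLT (zero_lt_one (α := ℝ))] with x hx
    have : π x = x := by simp only [hπ]; rw [projIcc_of_mem _ (Ioo_subset_Icc_self hx)]
    rw [this]
  have h1 : 0 ≤ (J 1).im := by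
    refine ge_of_tendsto ((Complex.continuous_im.tendsto _).comp hJc) ?_
    filter_upwards [Ioo_mem_nhdsLT (zero_lt_one (α := ℝ))] with ρ hρ using hJpos ρ hρ
  have h2 : (J 1).im = 2 * Real.pi * r * momentFunctional (sepMoment c r) Q := by
    rw [hJ1, show (2 * Real.pi * Complex.I * (r * momentFunctional (sepMoment c r) Q) : ℂ) =
      ((2 * Real.pi * r * momentFunctional (sepMoment c r) Q : ℝ) : ℂ) * Complex.I by
        push_cast; ring]
    simp
  rw [h2] at h1
  exact (mul_nonneg_iff_of_pos_left (by positivity)).1 h1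

/-! ### Generating series of moments, and irrationality of the separatrix -/

section MomentSeries

variable {s : ℕ → ℝ} {w : ℝ}

/-- The generating series `∑ L(X^l P) w^l` of a moment functional, that is, `L` formally applied to
`P / (1 - w X)`. -/
noncomputable def momentSeries (s : ℕ → ℝ) (w : ℝ) (P : ℝ[X]) : ℝ :=
  ∑' l, momentFunctional s (X ^ l * P) * w ^ l

theorem exists_abs_momentFunctional_le (hs : ∀ n, |s n| ≤ 1) (P : ℝ[X]) :
    ∃ B, ∀ l, |momentFunctional s (X ^ l * P)| ≤ B := by
  induction P using Polynomial.induction_on' with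
  | add P Q hP hQ =>
    obtain ⟨B, hB⟩ := hP
    obtain ⟨B', hB'⟩ := hQ
    refine ⟨B + B', fun l => ?_⟩
    rw [mul_add, map_add]
    exact (abs_add_le _ _).trans (add_le_add (hB l) (hB' l))
  | monomial k a =>
    refine ⟨|a|, fun l => ?_⟩
    rw [X_pow_mul_monomial, momentFunctional_monomial, abs_mul]
    exact mul_le_of_le_one_left (abs_nonneg _) (hs _)

theorem summable_momentSeries (hs : ∀ n, |s n| ≤ 1) (hw : |w| < 1) (P : ℝ[X]) :
    Summable fun l => momentFunctional s (X ^ l * P) * w ^ l := by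
  obtain ⟨B, hB⟩ := exists_abs_momentFunctional_le hs P
  refine Summable.of_norm_bounded ((summable_geometric_of_lt_one (abs_nonneg w) hw).mul_left B)
    fun l => ?_
  rw [norm_mul, norm_pow, Real.norm_eq_abs, Real.norm_eq_abs]
  exact mul_le_mul_of_nonneg_right (hB l) (by positivity)

theorem momentSeries_add (hs : ∀ n, |s n| ≤ 1) (hw : |w| < 1) (P Q : ℝ[X]) :
    momentSeries s w (P + Q) = momentSeries s w P + momentSeries s w Q := by
  rw [momentSeries, momentSeries, momentSeries,
    ← (summable_momentSeries hs hw P).tsum_add (summable_momentSeries hs hw Q)]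
  refine tsum_congr fun l => ?_
  rw [mul_add, map_add, add_mul]

theorem momentSeries_smul (a : ℝ) (P : ℝ[X]) :
    momentSeries s w (a • P) = a * momentSeries s w P := by
  rw [momentSeries, momentSeries, ← tsum_mul_left]
  refine tsum_congr fun l => ?_
  rw [mul_smul_comm, map_smul, smul_eq_mul, mul_assoc]

/-- As a linear functional, `momentSeries` satisfies `M((1 - w X) P) = L(P)`. -/
theorem momentSeries_eq_add (hs : ∀ n, |s n| ≤ 1) (hw : |w| < 1) (P : ℝ[X]) :
    momentSeries s w P = momentFunctional s P + w * momentSeries s w (X * P) := by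
  rw [momentSeries, (summable_momentSeries hs hw P).tsum_eq_zero_add, momentSeries,
    ← tsum_mul_left]
  simp only [pow_zero, one_mul, mul_one]
  congr 1
  refine tsum_congr fun l => ?_
  rw [pow_succ X, mul_assoc]; ring

theorem momentSeries_eq_sum_add (hs : ∀ n, |s n| ≤ 1) (hw : |w| < 1) (P : ℝ[X]) (k : ℕ) :
    momentSeries s w P = (∑ j ∈ Finset.range k, momentFunctional s (X ^ j * P) * w ^ j) +
      w ^ k * momentSeries s w (X ^ k * P) := by
  induction k with
  | zero => simp
  | succ k ih =>
    rw [ih, Finset.sum_range_succ, momentSeries_eq_add hs hw (X ^ k * P), ← mul_assoc X,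
      ← pow_succ']
    ring

theorem momentSeries_sum (hs : ∀ n, |s n| ≤ 1) (hw : |w| < 1) {ι : Type*} (I : Finset ι)
    (P : ι → ℝ[X]) : momentSeries s w (∑ i ∈ I, P i) = ∑ i ∈ I, momentSeries s w (P i) := by
  classical
  induction I using Finset.induction_on with
  | empty => simp [momentSeries]
  | insert i I hi ih => rw [Finset.sum_insert hi, Finset.sum_insert hi, momentSeries_add hs hw, ih]

/-- The polynomial part of `w^d Q(1/w) S(w)`, where `S` is the generating series of the moments. -/
noncomputable def padeNumerator (s : ℕ → ℝ) (d : ℕ) (Q : ℝ[X]) : ℝ[X] :=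
  ∑ i ∈ Finset.range (d + 1), ∑ j ∈ Finset.range i, monomial (d - i + j) (Q.coeff i * s j)

theorem eval_reflect_eq_sum {d : ℕ} {Q : ℝ[X]} (hQ : Q.natDegree ≤ d) (w : ℝ) :
    (Q.reflect d).eval w = ∑ i ∈ Finset.range (d + 1), Q.coeff i * w ^ (d - i) := by
  rw [eval_eq_sum_range' (n := d + 1) (Nat.lt_succ_of_le
    ((natDegree_reflect_le).trans (max_le le_rfl hQ))), ← Finset.sum_range_reflect]
  refine Finset.sum_congr rfl fun i hi => ?_
  have hi' : i ≤ d := Nat.lt_succ_iff.1 (Finset.mem_range.1 hi)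
  rw [show d + 1 - 1 - i = d - i by omega, coeff_reflect, revAt_le (Nat.sub_le d i),
    show d - (d - i) = i by omega]

/-- Multiplying the generating series by a reversed polynomial shifts the moments. -/
theorem reflect_mul_momentSeries (hs : ∀ n, |s n| ≤ 1) (hw : |w| < 1) {d : ℕ} {Q : ℝ[X]}
    (hQ : Q.natDegree ≤ d) :
    (Q.reflect d).eval w * momentSeries s w 1 =
      (padeNumerator s d Q).eval w + w ^ d * momentSeries s w Q := by
  have h1 : momentSeries s w Q =
      ∑ i ∈ Finset.range (d + 1), Q.coeff i * momentSeries s w (X ^ i) := by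
    conv_lhs => rw [Q.as_sum_range' (d + 1) (Nat.lt_succ_of_le hQ)]
    rw [momentSeries_sum hs hw]
    refine Finset.sum_congr rfl fun i _ => ?_
    rw [← momentSeries_smul, smul_eq_C_mul, C_mul_X_pow_eq_monomial]
  rw [h1, eval_reflect_eq_sum hQ, padeNumerator, eval_finsetSum, Finset.sum_mul, Finset.mul_sum,
    ← Finset.sum_add_distrib]
  refine Finset.sum_congr rfl fun i hi => ?_
  have hi' : i ≤ d := Nat.lt_succ_iff.1 (Finset.mem_range.1 hi)
  rw [momentSeries_eq_sum_add hs hw 1 i, eval_finsetSum, mul_one]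
  have h2 : ∀ j ∈ Finset.range i, (monomial (d - i + j) (Q.coeff i * s j)).eval w =
      Q.coeff i * w ^ (d - i) * (momentFunctional s (X ^ j * 1) * w ^ j) := by
    intro j _
    rw [eval_monomial, mul_one, momentFunctional_X_pow, pow_add]; ring
  rw [Finset.sum_congr rfl h2, ← Finset.mul_sum]
  have h3 : w ^ d = w ^ (d - i) * w ^ i := by rw [← pow_add]; congr 1; omega
  rw [h3]
  ring

end MomentSeries

section Irrational

theorem exists_eq_mul_isCoprime {R : Type*} [EuclideanDomain R] (a : R) {b : R} (hb : b ≠ 0) :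
    ∃ g a' b' : R, IsCoprime a' b' ∧ a = g * a' ∧ b = g * b' := by
  classical
  let _ := EuclideanDomain.gcdMonoid R
  have h0 : gcd a b ≠ 0 := fun h => hb ((gcd_eq_zero_iff a b).1 h).2
  exact ⟨gcd a b, a / gcd a b, b / gcd a b, isCoprime_div_gcd_div_gcd hb,
    (EuclideanDomain.mul_div_cancel' h0 (gcd_dvd_left a b)).symm,
    (EuclideanDomain.mul_div_cancel' h0 (gcd_dvd_right a b)).symm⟩

/-- The equation `y y' = w (1 - w) - c y` has no rational solution: the denominator of a reduced
solution would divide its derivative, and a polynomial solution is excluded by its degree. -/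
theorem not_rational_of_ode {c : ℝ} {y : ℝ → ℝ}
    (hy : ∀ᶠ w in 𝓝 (0 : ℝ), DifferentiableAt ℝ y w ∧ y w * deriv y w = w * (1 - w) - c * y w)
    {B N : ℝ[X]} (hB : B ≠ 0) (h : ∀ᶠ w in 𝓝[≠] (0 : ℝ), B.eval w * y w = N.eval w) : False := by
  obtain ⟨g, B₁, N₁, hcop, hBg, hNg⟩ : ∃ g B₁ N₁ : ℝ[X], IsCoprime N₁ B₁ ∧ B = g * B₁ ∧
      N = g * N₁ := by
    obtain ⟨g, N₁, B₁, hcop, hN, hB'⟩ := exists_eq_mul_isCoprime N hB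
    exact ⟨g, B₁, N₁, hcop, hB', hN⟩
  have hg : g ≠ 0 := fun h0 => hB (by rw [hBg, h0, zero_mul])
  have hB₁ : B₁ ≠ 0 := fun h0 => hB (by rw [hBg, h0, mul_zero])
  have hgr : ∀ᶠ w in 𝓝[≠] (0 : ℝ), g.eval w ≠ 0 := by
    have h1 : {w : ℝ | g.eval w = 0}.Finite := g.finite_setOfPred_isRoot hg
    have h2 := h1.isClosed.isOpen_compl
    have h3 := (h1.subset (sdiff_subset (t := {(0 : ℝ)}))).isClosed.isOpen_compl.mem_nhds
      (show (0 : ℝ) ∈ ({w : ℝ | g.eval w = 0} \ {0})ᶜ by simp)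
    filter_upwards [nhdsWithin_le_nhds h3, self_mem_nhdsWithin] with w hw hw0 hgw
    exact hw ⟨hgw, hw0⟩
  have h₁ : ∀ᶠ w in 𝓝[≠] (0 : ℝ), B₁.eval w * y w = N₁.eval w := by
    filter_upwards [h, hgr] with w hw hgw
    rw [hBg, hNg, eval_mul, eval_mul, mul_assoc] at hw
    exact mul_left_cancel₀ hgw hw
  have hid : N₁ * (derivative N₁ * B₁ - N₁ * derivative B₁) =
      B₁ ^ 2 * (X * (1 - X) * B₁ - C c * N₁) := by
    refine eq_of_infinite_eval_eq _ _ ?_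
    have hev : ∀ᶠ w in 𝓝[≠] (0 : ℝ),
        (N₁ * (derivative N₁ * B₁ - N₁ * derivative B₁)).eval w =
          (B₁ ^ 2 * (X * (1 - X) * B₁ - C c * N₁)).eval w := by
      filter_upwards [eventually_eventually_nhdsWithin.2 h₁, self_mem_nhdsWithin,
        nhdsWithin_le_nhds hy] with w hw hw0 hyw
      have hw' : (fun x => B₁.eval x * y x) =ᶠ[𝓝 w] fun x => N₁.eval x := by
        rwa [isOpen_compl_singleton.nhdsWithin_eq hw0] at hw
      have h1 := ((B₁.hasDerivAt w).mul hyw.1.hasDerivAt).unique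
        ((N₁.hasDerivAt w).congr_of_eventuallyEq hw')
      have h2 := hw'.self_of_nhds
      simp only at h2
      simp only [eval_mul, eval_sub, eval_pow, eval_X, eval_one, eval_C]
      rw [← h2, ← h1]
      linear_combination (eval w B₁) ^ 3 * hyw.2
    have hinf : (𝓝[≠] (0 : ℝ)).NeBot := inferInstance
    intro hfin
    have h3 := (hfin.subset (sdiff_subset (t := {(0 : ℝ)}))).isClosed.isOpen_compl.mem_nhds
      (show (0 : ℝ) ∈ (_ \ {0})ᶜ by simp)
    have h4 : ∀ᶠ w in 𝓝[≠] (0 : ℝ), False := by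
      filter_upwards [hev, nhdsWithin_le_nhds h3, self_mem_nhdsWithin] with w hw1 hw2 hw3
      exact hw2 ⟨hw1, hw3⟩
    exact h4.exists.elim fun _ h => h
  have hdvd : B₁ ∣ derivative B₁ := by
    have h1 : B₁ ∣ N₁ * (N₁ * derivative B₁) := by
      refine ⟨N₁ * derivative N₁ - B₁ * (X * (1 - X) * B₁ - C c * N₁), ?_⟩
      linear_combination -hid
    exact hcop.symm.dvd_of_dvd_mul_left (hcop.symm.dvd_of_dvd_mul_left h1)
  have hder : derivative B₁ = 0 := by
    by_contra h0
    exact absurd (natDegree_le_of_dvd hdvd h0) (not_le.2 (natDegree_derivative_lt fun h2 => h0 (by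
      rw [eq_C_of_natDegree_eq_zero h2, derivative_C])))
  obtain ⟨b, hb⟩ : ∃ b, B₁ = C b := ⟨_, eq_C_of_natDegree_eq_zero (derivative_eq_zero.1 hder)⟩
  have hb0 : b ≠ 0 := fun h0 => hB₁ (by rw [hb, h0, C_0])
  rw [hder, hb, mul_zero, sub_zero] at hid
  have hid' : N₁ * derivative N₁ = C b * (X * (1 - X) * C b - C c * N₁) := by
    refine mul_left_cancel₀ (C_ne_zero.2 hb0) ?_
    linear_combination hid
  have e : N₁ * derivative N₁ + C b * C c * N₁ = C (b ^ 2) * X - C (b ^ 2) * X ^ 2 := by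
    rw [hid', C_pow]; ring
  rcases le_or_gt N₁.natDegree 1 with hd | hd
  · have h1 : ∀ x : ℝ, N₁.eval x * (derivative N₁).eval x + b * c * N₁.eval x =
        b ^ 2 * x - b ^ 2 * x ^ 2 := fun x => by simpa using congrArg (eval x) e
    obtain ⟨a, d, had⟩ := exists_eq_X_add_C_of_natDegree_le_one hd
    rw [had] at h1
    simp only [derivative_add, derivative_C_mul, derivative_X, derivative_C, eval_add, eval_mul,
      eval_C, eval_X, eval_one, eval_zero] at h1
    -- the left hand side is affine in `x`, so its second difference vanishes
    have h2 : b ^ 2 = 0 := by linarith [h1 0, h1 1, h1 (-1)]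
    exact hb0 (pow_eq_zero_iff two_ne_zero |>.1 h2)
  · have h0 : derivative N₁ ≠ 0 := fun h0 => by
      have := derivative_eq_zero.1 h0; omega
    have h1 : (N₁ * derivative N₁).natDegree = 2 * N₁.natDegree - 1 := by
      rw [natDegree_mul (fun h => by simp [h] at hd) h0, natDegree_derivative N₁ ]
      omega
    have h2 : N₁ * derivative N₁ = C (b ^ 2) * X - C (b ^ 2) * X ^ 2 - C b * C c * N₁ := by
      linear_combination e
    have h3 : (C (b ^ 2) * X - C (b ^ 2) * X ^ 2 - C b * C c * N₁ : ℝ[X]).natDegree ≤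
        N₁.natDegree := by
      refine (natDegree_sub_le _ _).trans (max_le ((natDegree_sub_le _ _).trans (max_le ?_ ?_)) ?_)
      · exact (natDegree_C_mul_le _ _).trans (by rw [natDegree_X]; omega)
      · exact (natDegree_C_mul_X_pow_le _ _).trans hd
      · rw [← C_mul]; exact natDegree_C_mul_le _ _
    rw [← h2, h1] at h3
    omega

end Irrational

/-! ### Strict positivity of the moment functional -/

section SepMoment

variable {c r : ℝ}

theorem abs_sepMoment_le (hc : 2 ≤ c) (hr : 0 < r) (hcr : r ^ 2 + c * r = 1) (n : ℕ) :
    |sepMoment c r n| ≤ 1 := by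
  have h1 : 0 ≤ sepMoment c r n := by
    rw [← momentFunctional_X_pow (sepMoment c r)]
    exact momentFunctional_nonneg hc hr hcr fun t ht => by
      rw [eval_pow, eval_X]; exact pow_nonneg ht.1 n
  have h2 : 0 ≤ momentFunctional (sepMoment c r) (X ^ 0 - X ^ n) :=
    momentFunctional_nonneg hc hr hcr fun t ht => by
      simpa using pow_le_one₀ ht.1 ht.2
  rw [map_sub, momentFunctional_X_pow, momentFunctional_X_pow, sepMoment_zero] at h2
  rw [abs_of_nonneg h1]
  linarith

theorem sepCoeff_le (hc : 2 ≤ c) (hr : 0 < r) (hcr : r ^ 2 + c * r = 1) (n : ℕ) :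
    sepCoeff c r n ≤ 2 * r := by
  have h1 := abs_le.1 (abs_sepMoment_le hc hr hcr n)
  have h2 := abs_le.1 (abs_sepMoment_le hc hr hcr (n + 1))
  rw [sepMoment_succ] at h2
  have h3 : sepCoeff c r n / r ≤ 2 := by linarith
  rwa [div_le_iff₀ hr] at h3

/-- Positivity of the moments shows that the expansion at the saddle converges up to the node. -/
theorem summable_sepCoeff (hc : 2 ≤ c) (hr : 0 < r) (hcr : r ^ 2 + c * r = 1) {ϱ : ℝ}
    (h0 : 0 ≤ ϱ) (h1 : ϱ < 1) : Summable fun n => sepCoeff c r n * ϱ ^ n := by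
  refine Summable.of_nonneg_of_le (fun n => ?_) (fun n => ?_)
    ((summable_geometric_of_lt_one h0 h1).mul_left (2 * r))
  · exact mul_nonneg (sepCoeff_pos (by linarith) hr n).le (pow_nonneg h0 n)
  · exact mul_le_mul_of_nonneg_right (sepCoeff_le hc hr hcr n) (pow_nonneg h0 n)

theorem sepFun_eq_mul_momentSeries (hc : 2 ≤ c) (hr : 0 < r) (hcr : r ^ 2 + c * r = 1) {w : ℝ}
    (hw : |w| < 1) :
    sepFun ℝ c r w = r * w * (1 - w) * momentSeries (sepMoment c r) w 1 := by
  have hs := abs_sepMoment_le hc hr hcr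
  have hA : Summable fun n => sepCoeff c r n * w ^ n := by
    refine Summable.of_norm_bounded (summable_sepCoeff hc hr hcr (abs_nonneg w) hw) fun n => ?_
    rw [norm_mul, norm_pow, Real.norm_eq_abs, Real.norm_eq_abs,
      abs_of_pos (sepCoeff_pos (by linarith) hr n)]
  have h1 : momentSeries (sepMoment c r) w 1 = ∑' n, sepMoment c r n * w ^ n :=
    tsum_congr fun n => by rw [mul_one, momentFunctional_X_pow]
  have hS : Summable fun n => sepMoment c r n * w ^ n := by
    refine (summable_momentSeries hs hw 1).congr fun n => ?_
    rw [mul_one, momentFunctional_X_pow]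
  have h2 : ∑' n, sepMoment c r n * w ^ n = 1 + w * ((∑' n, sepMoment c r n * w ^ n) -
      r⁻¹ * ∑' n, sepCoeff c r n * w ^ n) := by
    conv_lhs => rw [hS.tsum_eq_zero_add]
    rw [← tsum_mul_left (a := r⁻¹), ← hS.tsum_sub (hA.mul_left r⁻¹), ← tsum_mul_left]
    rw [sepMoment_zero, pow_zero, mul_one]
    congr 1
    refine tsum_congr fun n => ?_
    rw [sepMoment_succ]
    ring
  have h3 : sepSeries ℝ c r w = ∑' n, sepCoeff c r n * w ^ n := rfl
  rw [h1, sepFun, h3]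
  simp only [RCLike.ofReal_real_eq_id, id_eq]
  field_simp at h2
  linear_combination (-w) * h2

/-- The functional `L` with moments `s` is strictly positive on `[0, 1]`: `L(W Q²) > 0` for nonzero
polynomials `W` and `Q` with `W ≥ 0` on `[0, 1]`. The moments of a positive measure on `[0, 1]`
with infinite support have this property. -/
def IsPosMoment (s : ℕ → ℝ) : Prop :=
  ∀ W Q : ℝ[X], (∀ t ∈ Icc (0 : ℝ) 1, 0 ≤ W.eval t) → W ≠ 0 → Q ≠ 0 →
    0 < momentFunctional s (W * Q ^ 2)

/-- If `L(W Q²) = 0`, then by Cauchy–Schwarz `W Q` is orthogonal to all polynomials, so that the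
generating series of the moments is rational; but it solves an equation without rational solutions.
-/
theorem isPosMoment_sepMoment (hc : 2 ≤ c) (hr : 0 < r) (hcr : r ^ 2 + c * r = 1) :
    IsPosMoment (sepMoment c r) := by
  intro W Q hW hW0 hQ0
  have hs := abs_sepMoment_le hc hr hcr
  set L := momentFunctional (sepMoment c r) with hL
  have hnn : ∀ R : ℝ[X], 0 ≤ L (W * R ^ 2) := fun R =>
    momentFunctional_nonneg hc hr hcr fun t ht => by
      rw [eval_mul, eval_pow]; exact mul_nonneg (hW t ht) (sq_nonneg _)
  refine lt_of_le_of_ne (hnn Q) fun h0 => ?_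
  have horth : ∀ R : ℝ[X], L (R * (W * Q)) = 0 := by
    intro R
    have h1 : ∀ x : ℝ, 0 ≤ 2 * x * L (R * (W * Q)) + x ^ 2 * L (W * R ^ 2) := by
      intro x
      have h2 := hnn (Q + x • R)
      have h3 : W * (Q + x • R) ^ 2 = W * Q ^ 2 + (2 * x) • (R * (W * Q)) +
          x ^ 2 • (W * R ^ 2) := by
        simp only [smul_eq_C_mul, C_mul, C_pow, map_ofNat]
        ring
      rw [h3, map_add, map_add, map_smul, map_smul, ← h0, zero_add, smul_eq_mul,
        smul_eq_mul] at h2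
      exact h2
    have h2 := discrim_le_zero (a := L (W * R ^ 2)) (b := 2 * L (R * (W * Q))) (c := 0)
      fun x => by linarith [h1 x]
    rw [discrim] at h2
    nlinarith [sq_nonneg (L (R * (W * Q)))]
  set N := W * Q with hN
  have hN0 : N ≠ 0 := mul_ne_zero hW0 hQ0
  obtain ⟨ϱ, hϱ, hsum⟩ := exists_summable_sepCoeff (show 0 < c by linarith) hr
  refine not_rational_of_ode (c := c) (y := sepFun ℝ c r) (B := N.reflect N.natDegree)
    (N := C r * X * (1 - X) * padeNumerator (sepMoment c r) N.natDegree N) ?_ ?_ ?_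
  · filter_upwards [Metric.ball_mem_nhds (0 : ℝ) hϱ] with w hw
    exact sepFun_ode (𝕜 := ℝ) (by linarith) hr hcr hsum (mem_ball_zero_iff.1 hw)
  · rwa [Ne, reflect_eq_zero_iff]
  · filter_upwards [nhdsWithin_le_nhds (Metric.ball_mem_nhds (0 : ℝ) one_pos)] with w hw
    have hw1 : |w| < 1 := mem_ball_zero_iff.1 hw
    have h1 : momentSeries (sepMoment c r) w N = 0 := by
      rw [momentSeries, ← hL]
      simp [horth]
    have h2 := reflect_mul_momentSeries hs hw1 (le_refl N.natDegree)
    rw [h1, mul_zero, add_zero] at h2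
    rw [sepFun_eq_mul_momentSeries hc hr hcr hw1]
    simp only [eval_mul, eval_sub, eval_C, eval_X, eval_one]
    linear_combination r * w * (1 - w) * h2

end SepMoment

/-! ### Padé approximants of the generating series of positive moments -/

section Pade

variable {s : ℕ → ℝ}

theorem coeff_padeNumerator_eq_zero {d k : ℕ} (hk : d ≤ k) (Q : ℝ[X]) :
    (padeNumerator s d Q).coeff k = 0 := by
  rw [padeNumerator, finsetSum_coeff]
  refine Finset.sum_eq_zero fun i hi => ?_
  rw [finsetSum_coeff]
  refine Finset.sum_eq_zero fun j hj => ?_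
  have h1 := Finset.mem_range.1 hi
  have h2 := Finset.mem_range.1 hj
  rw [coeff_monomial, if_neg (by omega)]

/-- A polynomial of degree at most `k` that is `O(w^{k+1})` vanishes. -/
theorem eq_zero_of_isBigO {E : ℝ[X]} {k : ℕ} (hE : E.natDegree ≤ k)
    (h : (fun w => E.eval w) =O[𝓝[≠] (0 : ℝ)] fun w => w ^ (k + 1)) : E = 0 := by
  by_contra h0
  obtain ⟨F, hF, hF0⟩ := exists_eq_pow_rootMultiplicity_mul_and_not_dvd E h0 0
  set j := rootMultiplicity 0 E with hj
  rw [C_0, sub_zero] at hF hF0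
  have hFne : F ≠ 0 := fun h => h0 (by rw [hF, h, mul_zero])
  have hjk : j ≤ k := by
    have h1 := congrArg natDegree hF
    rw [natDegree_mul (pow_ne_zero _ X_ne_zero) hFne, natDegree_X_pow] at h1
    omega
  have h1 : (fun w => F.eval w) =O[𝓝[≠] (0 : ℝ)] fun w => w ^ (k + 1 - j) := by
    have h2 : (fun w : ℝ => (w ^ j)⁻¹ * E.eval w) =O[𝓝[≠] (0 : ℝ)]
        fun w => (w ^ j)⁻¹ * w ^ (k + 1) := (isBigO_refl _ _).mul h
    refine h2.congr' ?_ ?_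
    · filter_upwards [self_mem_nhdsWithin] with w hw
      have hw' : w ≠ 0 := hw
      conv_lhs => rw [hF]
      rw [eval_mul, eval_pow, eval_X]
      field_simp
    · filter_upwards [self_mem_nhdsWithin] with w hw
      have hw' : w ≠ 0 := hw
      have : k + 1 = (k + 1 - j) + j := by omega
      conv_lhs => rw [this, pow_add]
      field_simp
  have h2 : Tendsto (fun w : ℝ => w ^ (k + 1 - j)) (𝓝[≠] 0) (𝓝 0) := by
    have h3 : Tendsto (fun w : ℝ => w ^ (k + 1 - j)) (𝓝 0) (𝓝 (0 ^ (k + 1 - j))) :=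
      (continuous_pow _).tendsto 0
    rw [zero_pow (by omega)] at h3
    exact h3.mono_left nhdsWithin_le_nhds
  have h3 := h1.trans_tendsto h2
  have h4 := tendsto_nhds_unique h3 ((F.continuous.tendsto 0).mono_left nhdsWithin_le_nhds)
  exact hF0 (X_dvd_iff.2 (by rw [coeff_zero_eq_eval_zero]; exact h4.symm))

theorem momentSeries_isBigO_one (hs : ∀ n, |s n| ≤ 1) (P : ℝ[X]) :
    (fun w => momentSeries s w P) =O[𝓝[≠] (0 : ℝ)] fun _ => (1 : ℝ) := by
  obtain ⟨B, hB⟩ := exists_abs_momentFunctional_le hs P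
  have hB0 : 0 ≤ B := (abs_nonneg _).trans (hB 0)
  refine IsBigO.of_bound (B * 2) ?_
  filter_upwards [nhdsWithin_le_nhds (Metric.ball_mem_nhds (0 : ℝ) (ε := 1 / 2) (by norm_num))]
    with w hw
  have hw' : |w| < 1 / 2 := mem_ball_zero_iff.1 hw
  have hsum := (summable_geometric_of_lt_one (abs_nonneg w)
    (hw'.trans (by norm_num))).mul_left B
  have h1 : ‖momentSeries s w P‖ ≤ ∑' l, B * |w| ^ l :=
    tsum_of_norm_bounded hsum.hasSum fun l => by
      rw [norm_mul, norm_pow, Real.norm_eq_abs, Real.norm_eq_abs]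
      exact mul_le_mul_of_nonneg_right (hB l) (by positivity)
  rw [tsum_mul_left, tsum_geometric_of_lt_one (abs_nonneg w) (hw'.trans (by norm_num))] at h1
  rw [norm_one, mul_one]
  refine h1.trans (mul_le_mul_of_nonneg_left ?_ hB0)
  rw [inv_le_comm₀ (by linarith) two_pos]
  linarith

theorem natDegree_reflect_le' {d : ℕ} {q : ℝ[X]} (hq : q.natDegree ≤ d) :
    (q.reflect d).natDegree ≤ d :=
  natDegree_reflect_le.trans (max_le le_rfl hq)

/-- The Padé conditions are orthogonality relations for the reversed denominator, and they
determine the numerator. -/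
theorem orthogonal_of_isBigO (hs : ∀ n, |s n| ≤ 1) {d n : ℕ} {p q : ℝ[X]} (hp : p.natDegree ≤ d)
    (hq : q.natDegree ≤ d)
    (h : (fun w => q.eval w * momentSeries s w 1 - p.eval w) =O[𝓝[≠] (0 : ℝ)]
      fun w => w ^ (d + n + 1)) :
    (∀ j, 1 ≤ j → j ≤ n → momentFunctional s (X ^ j * q.reflect d) = 0) ∧
      p = padeNumerator s d (q.reflect d) + monomial d (momentFunctional s (q.reflect d)) := by
  set Q := q.reflect d with hQ
  have hQq : Q.reflect d = q := reflect_reflect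
  set E : ℝ[X] := padeNumerator s d Q + ∑ j ∈ Finset.range (n + 1),
    monomial (d + j) (momentFunctional s (X ^ j * Q)) - p with hE
  have hpk : ∀ k, d < k → p.coeff k = 0 := fun k hk =>
    coeff_eq_zero_of_natDegree_lt (hp.trans_lt hk)
  have hcoeff : ∀ k, E.coeff k = (padeNumerator s d Q).coeff k + (∑ j ∈ Finset.range (n + 1),
      if d + j = k then momentFunctional s (X ^ j * Q) else 0) - p.coeff k := by
    intro k
    simp only [hE, coeff_sub, coeff_add, finsetSum_coeff, coeff_monomial]
  have hE0 : E = 0 := by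
    refine eq_zero_of_isBigO (k := d + n) (natDegree_le_iff_coeff_eq_zero.2 fun k hk => ?_) ?_
    · rw [hcoeff, coeff_padeNumerator_eq_zero (by omega), hpk k (by omega), zero_add, sub_zero]
      refine Finset.sum_eq_zero fun j hj => if_neg ?_
      have := Finset.mem_range.1 hj
      omega
    · have h1 : (fun w => w ^ (d + n + 1) * momentSeries s w (X ^ (n + 1) * Q)) =O[𝓝[≠] (0 : ℝ)]
          fun w => w ^ (d + n + 1) * 1 := (isBigO_refl _ _).mul (momentSeries_isBigO_one hs _)
      simp only [mul_one] at h1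
      refine (h.sub h1).congr' ?_ EventuallyEq.rfl
      filter_upwards [nhdsWithin_le_nhds (Metric.ball_mem_nhds (0 : ℝ) one_pos)] with w hw
      have hw1 : |w| < 1 := mem_ball_zero_iff.1 hw
      have h2 := reflect_mul_momentSeries hs hw1 (natDegree_reflect_le' hq)
      rw [← hQ, hQq, momentSeries_eq_sum_add hs hw1 Q (n + 1)] at h2
      simp only [hE, eval_sub, eval_add, eval_finsetSum, eval_monomial]
      rw [h2]
      have h3 : ∑ j ∈ Finset.range (n + 1), momentFunctional s (X ^ j * Q) * w ^ (d + j) =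
          w ^ d * ∑ j ∈ Finset.range (n + 1), momentFunctional s (X ^ j * Q) * w ^ j := by
        rw [Finset.mul_sum]
        exact Finset.sum_congr rfl fun j _ => by rw [pow_add]; ring
      rw [h3]
      ring
  have horth : ∀ j, 1 ≤ j → j ≤ n → momentFunctional s (X ^ j * Q) = 0 := by
    intro j hj hjn
    have h1 := hcoeff (d + j)
    rw [hE0, coeff_zero, coeff_padeNumerator_eq_zero (by omega), hpk _ (by omega), zero_add,
      sub_zero, Finset.sum_eq_single j (fun i _ hij => if_neg (by omega))
        (fun hnot => absurd (Finset.mem_range.2 (by omega)) hnot), if_pos rfl] at h1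
    exact h1.symm
  refine ⟨horth, ?_⟩
  have h1 : ∑ j ∈ Finset.range (n + 1), monomial (d + j) (momentFunctional s (X ^ j * Q)) =
      monomial d (momentFunctional s Q) := by
    rw [Finset.sum_range_succ', Finset.sum_eq_zero fun j hj => ?_]
    · simp
    · rw [horth (j + 1) (by omega) (by have := Finset.mem_range.1 hj; omega), monomial_zero_right]
  rw [hE, h1, sub_eq_zero] at hE0
  exact hE0.symm

/-- `p / q` is the Padé approximant of order `(m, m)` at `0` of the generating series of the
moments, in terms of orthogonality. -/
structure IsMomentPade (s : ℕ → ℝ) (m : ℕ) (p q : ℝ[X]) : Prop where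
  natDegree_le : q.natDegree ≤ m
  coeff_zero_ne : q.coeff 0 ≠ 0
  orth : ∀ j, 1 ≤ j → j ≤ m → momentFunctional s (X ^ j * q.reflect m) = 0
  num : p = padeNumerator s m (q.reflect m) + monomial m (momentFunctional s (q.reflect m))

theorem momentFunctional_mul_eq_zero {m : ℕ} {Q R : ℝ[X]}
    (h : ∀ j, 1 ≤ j → j ≤ m → momentFunctional s (X ^ j * Q) = 0)
    (hR : ∀ k, m ≤ k → R.coeff k = 0) : momentFunctional s (X * R * Q) = 0 := by
  have hR' : R = ∑ k ∈ Finset.range m, R.coeff k • X ^ k := by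
    ext k
    simp only [finsetSum_coeff, coeff_smul, coeff_X_pow, smul_eq_mul, mul_ite, mul_one, mul_zero]
    rcases lt_or_ge k m with hk | hk
    · rw [Finset.sum_eq_single k (fun i _ hi => if_neg (Ne.symm hi))
        (fun hn => absurd (Finset.mem_range.2 hk) hn), if_pos rfl]
    · rw [hR k hk, Finset.sum_eq_zero]
      intro i hi
      have := Finset.mem_range.1 hi
      exact if_neg (by omega)
  rw [hR', Finset.mul_sum, Finset.sum_mul, map_sum]
  refine Finset.sum_eq_zero fun k hk => ?_
  rw [mul_smul_comm, smul_mul_assoc, map_smul, ← pow_succ', h (k + 1) (by omega)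
    (by have := Finset.mem_range.1 hk; omega), smul_zero]

theorem coeff_reflect_self (m : ℕ) (q : ℝ[X]) : (q.reflect m).coeff m = q.coeff 0 := by
  rw [coeff_reflect, revAt_le le_rfl, Nat.sub_self]

namespace IsMomentPade

variable {m : ℕ} {p q : ℝ[X]}

theorem ne_zero (h : IsMomentPade s m p q) : q ≠ 0 := fun h0 => h.coeff_zero_ne (by simp [h0])

theorem reflect_ne_zero (h : IsMomentPade s m p q) : q.reflect m ≠ 0 := by
  rw [Ne, reflect_eq_zero_iff]; exact h.ne_zero

theorem coeff_reflect_gt (h : IsMomentPade s m p q) {k : ℕ} (hk : m < k) :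
    (q.reflect m).coeff k = 0 :=
  coeff_eq_zero_of_natDegree_lt ((natDegree_reflect_le' h.natDegree_le).trans_lt hk)

/-- The cofactor of a factor of positive degree of the reversed denominator is orthogonal to it. -/
theorem momentFunctional_factor (h : IsMomentPade s m p q) {R F : ℝ[X]} (hF : 0 < F.natDegree)
    (hRF : q.reflect m = F * R) : momentFunctional s (X * R * q.reflect m) = 0 := by
  refine momentFunctional_mul_eq_zero h.orth fun k hk => coeff_eq_zero_of_natDegree_lt ?_
  have h0 := h.reflect_ne_zero
  rw [hRF] at h0
  have h1 := natDegree_mul (left_ne_zero_of_mul h0) (right_ne_zero_of_mul h0)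
  rw [← hRF] at h1
  have := natDegree_reflect_le' h.natDegree_le
  omega

theorem natDegree_eq (hpos : IsPosMoment s) (h : IsMomentPade s m p q) : q.natDegree = m := by
  refine le_antisymm h.natDegree_le (le_natDegree_of_ne_zero fun h0 => ?_)
  have h1 : (q.reflect m).coeff 0 = 0 := by
    rw [coeff_reflect, revAt_le (Nat.zero_le m), Nat.sub_zero]; exact h0
  obtain ⟨R, hR⟩ := X_dvd_iff.2 h1
  have h2 := h.momentFunctional_factor (by simp) hR
  have h3 := hpos (X ^ 2) R (fun t _ => by simpa using sq_nonneg t) (pow_ne_zero 2 X_ne_zero)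
    (fun h4 => h.reflect_ne_zero (by rw [hR, h4, mul_zero]))
  rw [hR, show X * R * (X * R) = X ^ 2 * R ^ 2 by ring] at h2
  exact h3.ne' h2

/-- The zeros of the orthogonal polynomials lie inside `(0, 1)`, those of the reversed polynomials
outside `[0, 1]`. -/
theorem eval_ne_zero (hpos : IsPosMoment s) (h : IsMomentPade s m p q) {w : ℝ}
    (hw : w ∈ Icc (0 : ℝ) 1) : q.eval w ≠ 0 := by
  rcases eq_or_lt_of_le hw.1 with h0 | h0
  · rw [← h0, ← coeff_zero_eq_eval_zero]; exact h.coeff_zero_ne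
  intro hq0
  have : Invertible w := invertibleOfNonzero h0.ne'
  have h1 := eval₂_reflect_mul_pow (RingHom.id ℝ) w m q h.natDegree_le
  rw [← eval, ← eval, hq0, invOf_eq_inv] at h1
  have hroot : (q.reflect m).IsRoot w⁻¹ :=
    (mul_eq_zero.1 h1).resolve_right (pow_ne_zero m h0.ne')
  obtain ⟨R, hR⟩ := dvd_iff_isRoot.2 hroot
  have hinv : 1 ≤ w⁻¹ := (one_le_inv₀ h0).2 hw.2
  have h2 := h.momentFunctional_factor (by simp) hR
  have h3 := hpos (X * (C w⁻¹ - X)) R (fun t ht => by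
      simp only [eval_mul, eval_X, eval_sub, eval_C]
      exact mul_nonneg ht.1 (by linarith [ht.2]))
    (mul_ne_zero X_ne_zero fun h4 => by
      have := congrArg (eval (w⁻¹ + 1)) h4
      simp at this)
    (fun h4 => h.reflect_ne_zero (by rw [hR, h4, mul_zero]))
  rw [hR, show X * R * ((X - C w⁻¹) * R) = -(X * (C w⁻¹ - X) * R ^ 2) by ring, map_neg,
    neg_eq_zero] at h2
  exact h3.ne' h2

theorem mul_eval_pos (hpos : IsPosMoment s) (h : IsMomentPade s m p q) {w : ℝ}
    (hw : w ∈ Icc (0 : ℝ) 1) : 0 < q.coeff 0 * q.eval w := by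
  by_contra hcon
  have h1 : ContinuousOn (fun x => q.coeff 0 * q.eval x) (Icc 0 w) := by fun_prop
  obtain ⟨x, hx, hx0⟩ := intermediate_value_Icc' hw.1 h1
    (show (0 : ℝ) ∈ Icc _ _ from ⟨not_lt.1 hcon, by
      rw [← coeff_zero_eq_eval_zero]; exact mul_self_nonneg _⟩)
  exact (mul_ne_zero h.coeff_zero_ne (h.eval_ne_zero hpos ⟨hx.1, hx.2.trans hw.2⟩)) hx0

theorem coeff_num (h : IsMomentPade s m p q) : p.coeff m = momentFunctional s (q.reflect m) := by
  rw [h.num, coeff_add, coeff_padeNumerator_eq_zero le_rfl, coeff_monomial, if_pos rfl, zero_add]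

theorem natDegree_num_le (h : IsMomentPade s m p q) : p.natDegree ≤ m :=
  natDegree_le_iff_coeff_eq_zero.2 fun k hk => by
    rw [h.num, coeff_add, coeff_padeNumerator_eq_zero hk.le, coeff_monomial, if_neg (by omega),
      zero_add]

theorem natDegree_num (hpos : IsPosMoment s) (h : IsMomentPade s m p q) : p.natDegree = m := by
  refine le_antisymm h.natDegree_num_le (le_natDegree_of_ne_zero fun h0 => ?_)
  rw [h.coeff_num] at h0
  set Q := q.reflect m with hQ
  have h1 := hpos 1 Q (fun t _ => by simp) one_ne_zero h.reflect_ne_zero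
  have h2 : momentFunctional s (X * Q.divX * Q) = 0 :=
    momentFunctional_mul_eq_zero h.orth fun k hk => by
      rw [coeff_divX]; exact h.coeff_reflect_gt (by omega)
  have h3 : 1 * Q ^ 2 = X * Q.divX * Q + Q.coeff 0 • Q := by
    conv_lhs => rw [one_mul, sq]
    nth_rewrite 1 [← X_mul_divX_add Q]
    rw [add_mul, smul_eq_C_mul]
  rw [h3, map_add, map_smul, h2, h0, smul_zero, add_zero] at h1
  exact lt_irrefl _ h1

theorem mul_momentSeries_sub (hs : ∀ n, |s n| ≤ 1) (h : IsMomentPade s m p q) {w : ℝ}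
    (hw : |w| < 1) : q.eval w * momentSeries s w 1 - p.eval w =
      w ^ (2 * m + 1) * momentSeries s w (X ^ (m + 1) * q.reflect m) := by
  have h1 := reflect_mul_momentSeries hs hw (natDegree_reflect_le' h.natDegree_le)
  rw [reflect_reflect, momentSeries_eq_sum_add hs hw (q.reflect m) (m + 1),
    Finset.sum_range_succ', Finset.sum_eq_zero fun j hj => ?_] at h1
  · rw [h1]
    conv_lhs => rw [h.num]
    simp only [eval_add, eval_monomial, pow_zero, one_mul]
    ring
  · rw [h.orth (j + 1) (by omega) (by have := Finset.mem_range.1 hj; omega), zero_mul]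

theorem isBigO (hs : ∀ n, |s n| ≤ 1) (h : IsMomentPade s m p q) :
    (fun w => q.eval w * momentSeries s w 1 - p.eval w) =O[𝓝[≠] (0 : ℝ)]
      fun w => w ^ (2 * m + 1) := by
  have h1 : (fun w => w ^ (2 * m + 1) * momentSeries s w (X ^ (m + 1) * q.reflect m))
      =O[𝓝[≠] (0 : ℝ)] fun w => w ^ (2 * m + 1) * 1 :=
    (isBigO_refl _ _).mul (momentSeries_isBigO_one hs _)
  simp only [mul_one] at h1
  refine h1.congr' ?_ EventuallyEq.rfl
  filter_upwards [nhdsWithin_le_nhds (Metric.ball_mem_nhds (0 : ℝ) one_pos)] with w hw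
  exact (h.mul_momentSeries_sub hs (mem_ball_zero_iff.1 hw)).symm

/-- The remainder of the Padé approximant has the sign of the denominator: modulo polynomials that
are orthogonal to `Q`, one has `q(w) X^m ≡ Q` in `L(· X Q / (1 - w X))`. -/
theorem eval_mul_momentSeries (hs : ∀ n, |s n| ≤ 1) (h : IsMomentPade s m p q) {w : ℝ}
    (hw : |w| < 1) : q.eval w * momentSeries s w (X ^ (m + 1) * q.reflect m) =
      momentSeries s w (X * q.reflect m ^ 2) := by
  set Q := q.reflect m with hQ
  have hQd : Q.natDegree ≤ m := natDegree_reflect_le' h.natDegree_le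
  set R : ℝ[X] := ∑ i ∈ Finset.range (m + 1),
    C (Q.coeff i) * (X ^ i * ∑ j ∈ Finset.range (m - i), (C w * X) ^ j) with hR
  have hqw : q.eval w = ∑ i ∈ Finset.range (m + 1), Q.coeff i * w ^ (m - i) := by
    rw [← eval_reflect_eq_sum hQd, hQ, reflect_reflect]
  have hkey : Q = q.eval w • X ^ m + (R - C w * X * R) := by
    have h1 : ∀ i ∈ Finset.range (m + 1), C (Q.coeff i) * X ^ i =
        C (Q.coeff i * w ^ (m - i)) * X ^ m +
          (1 - C w * X) * (C (Q.coeff i) * (X ^ i * ∑ j ∈ Finset.range (m - i), (C w * X) ^ j)) := by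
      intro i hi
      have h2 := mul_neg_geom_sum (C w * X : ℝ[X]) (m - i)
      have h3 : (X : ℝ[X]) ^ m = X ^ (m - i) * X ^ i := by
        rw [← pow_add]; congr 1; have := Finset.mem_range.1 hi; omega
      rw [C_mul, C_pow, h3]
      rw [mul_pow] at h2
      linear_combination (-C (Q.coeff i) * X ^ i) * h2
    conv_lhs => rw [Q.as_sum_range_C_mul_X_pow' (Nat.lt_succ_of_le hQd)]
    rw [Finset.sum_congr rfl h1, Finset.sum_add_distrib, ← Finset.mul_sum, ← hR,
      ← Finset.sum_mul, ← map_sum, ← hqw, smul_eq_C_mul]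
    ring
  have hRk : ∀ k, m ≤ k → R.coeff k = 0 := by
    intro k hk
    rw [hR, finsetSum_coeff]
    refine Finset.sum_eq_zero fun i hi => ?_
    rw [coeff_C_mul, Finset.mul_sum, finsetSum_coeff, Finset.sum_eq_zero, mul_zero]
    intro j hj
    have := Finset.mem_range.1 hj
    rw [mul_pow, ← C_pow, mul_left_comm, ← pow_add, coeff_C_mul_X_pow, if_neg (by omega)]
  have horth : momentSeries s w (X * (R - C w * X * R) * Q) = 0 := by
    have h1 : X * (R - C w * X * R) * Q = X * R * Q + (-w) • (X * (X * R * Q)) := by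
      rw [smul_eq_C_mul, C_neg]; ring
    rw [h1, momentSeries_add hs hw, momentSeries_smul, momentSeries_eq_add hs hw (X * R * Q),
      momentFunctional_mul_eq_zero h.orth hRk]
    ring
  have h2 : X * Q ^ 2 = q.eval w • (X ^ (m + 1) * Q) + X * (R - C w * X * R) * Q := by
    conv_lhs => rw [sq]
    nth_rewrite 1 [hkey]
    simp only [smul_eq_C_mul]
    ring
  rw [h2, momentSeries_add hs hw, momentSeries_smul, horth, add_zero]

theorem momentSeries_sq_pos (hpos : IsPosMoment s) (hs : ∀ n, |s n| ≤ 1) {w : ℝ} (hw0 : 0 ≤ w)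
    (hw1 : w < 1) {Q : ℝ[X]} (hQ : Q ≠ 0) : 0 < momentSeries s w (X * Q ^ 2) := by
  have hw : |w| < 1 := by rwa [abs_of_nonneg hw0]
  have h1 : ∀ l, 0 < momentFunctional s (X ^ l * (X * Q ^ 2)) := fun l => by
    rw [← mul_assoc, ← pow_succ]
    exact hpos _ _ (fun t ht => by rw [eval_pow, eval_X]; exact pow_nonneg ht.1 _)
      (pow_ne_zero _ X_ne_zero) hQ
  refine (summable_momentSeries hs hw _).tsum_pos
    (fun l => mul_nonneg (h1 l).le (pow_nonneg hw0 l)) 0 ?_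
  simpa using h1 0

theorem eval_div_lt (hpos : IsPosMoment s) (hs : ∀ n, |s n| ≤ 1) (h : IsMomentPade s m p q) {w : ℝ}
    (hw : w ∈ Ioo (0 : ℝ) 1) : p.eval w / q.eval w < momentSeries s w 1 := by
  have hw' : |w| < 1 := by rw [abs_of_pos hw.1]; exact hw.2
  have hq := h.eval_ne_zero hpos (Ioo_subset_Icc_self hw)
  have h1 := h.mul_momentSeries_sub hs hw'
  have h2 := h.eval_mul_momentSeries hs hw'
  have h3 := momentSeries_sq_pos hpos hs hw.1.le hw.2 h.reflect_ne_zero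
  have h4 : momentSeries s w 1 - p.eval w / q.eval w =
      w ^ (2 * m + 1) * momentSeries s w (X * q.reflect m ^ 2) / q.eval w ^ 2 := by
    rw [← h2]
    field_simp
    linear_combination h1
  have h5 : 0 < w ^ (2 * m + 1) * momentSeries s w (X * q.reflect m ^ 2) / q.eval w ^ 2 :=
    div_pos (mul_pos (pow_pos hw.1 _) h3) (by positivity)
  linarith

theorem coeff_mul_momentFunctional_pos (hpos : IsPosMoment s) (h : IsMomentPade s m p q) :
    0 < q.coeff 0 * momentFunctional s (X ^ (m + 1) * q.reflect m) := by
  set Q := q.reflect m with hQ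
  have h1 := hpos X Q (fun t ht => by simpa using ht.1) X_ne_zero h.reflect_ne_zero
  have h2 : momentFunctional s (X * (Q - C (q.coeff 0) * X ^ m) * Q) = 0 :=
    momentFunctional_mul_eq_zero h.orth fun k hk => by
      rw [coeff_sub, coeff_C_mul_X_pow]
      rcases eq_or_lt_of_le hk with hk | hk
      · rw [← hk, if_pos rfl, hQ, coeff_reflect_self, sub_self]
      · rw [if_neg (by omega), h.coeff_reflect_gt hk, sub_zero]
  have h3 : X * Q ^ 2 = X * (Q - C (q.coeff 0) * X ^ m) * Q +
      q.coeff 0 • (X ^ (m + 1) * Q) := by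
    rw [smul_eq_C_mul]; ring
  rwa [h3, map_add, h2, zero_add, map_smul, smul_eq_mul] at h1

/-- Consecutive Padé approximants differ by a multiple of `w^{2m+1}` over the product of the
denominators, and the sign of the factor is given by positivity. -/
theorem eval_div_lt_succ (hpos : IsPosMoment s) (hs : ∀ n, |s n| ≤ 1) (h : IsMomentPade s m p q)
    {p' q' : ℝ[X]} (h' : IsMomentPade s (m + 1) p' q') {w : ℝ} (hw : w ∈ Ioo (0 : ℝ) 1) :
    p.eval w / q.eval w < p'.eval w / q'.eval w := by
  set Λ := momentFunctional s (X ^ (m + 1) * q.reflect m) with hΛ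
  set κ := q'.coeff 0 * Λ with hκ
  have hD : p' * q - p * q' - C κ * X ^ (2 * m + 1) = 0 := by
    refine eq_zero_of_isBigO (k := 2 * m + 1) ?_ ?_
    · have h1 := h.natDegree_le
      have h2 := h.natDegree_num_le
      have h3 := h'.natDegree_le
      have h4 := h'.natDegree_num_le
      refine (natDegree_sub_le _ _).trans (max_le ((natDegree_sub_le _ _).trans (max_le ?_ ?_)) ?_)
      · exact natDegree_mul_le.trans (by omega)
      · exact natDegree_mul_le.trans (by omega)
      · exact natDegree_C_mul_X_pow_le _ _
    · have hpoly : ∀ P : ℝ[X], (fun w => P.eval w) =O[𝓝[≠] (0 : ℝ)] fun _ => (1 : ℝ) := fun P =>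
        ((P.continuous.tendsto 0).mono_left nhdsWithin_le_nhds).isBigO_one ℝ
      have h1 : (fun w => q'.eval w * momentSeries s w (X * (X ^ (m + 1) * q.reflect m)) +
          q'.divX.eval w * Λ - q.eval w * w * momentSeries s w (X ^ (m + 1 + 1) * q'.reflect (m + 1)))
          =O[𝓝[≠] (0 : ℝ)] fun _ => (1 : ℝ) := by
        have e1 := (hpoly q').mul (momentSeries_isBigO_one hs (X * (X ^ (m + 1) * q.reflect m)))
        have e2 := (hpoly q'.divX).mul (hpoly (C Λ))
        have e3 := (hpoly (q * X)).mul
          (momentSeries_isBigO_one hs (X ^ (m + 1 + 1) * q'.reflect (m + 1)))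
        simpa only [mul_one, eval_mul, eval_X, eval_C] using (e1.add e2).sub e3
      have h2 := (isBigO_refl (fun w : ℝ => w ^ (2 * m + 1 + 1)) (𝓝[≠] 0)).mul h1
      simp only [mul_one] at h2
      refine h2.congr' ?_ EventuallyEq.rfl
      filter_upwards [nhdsWithin_le_nhds (Metric.ball_mem_nhds (0 : ℝ) one_pos)] with w hw
      have hw1 : |w| < 1 := mem_ball_zero_iff.1 hw
      have e1 := h.mul_momentSeries_sub hs hw1
      have e2 := h'.mul_momentSeries_sub hs hw1
      have e3 := momentSeries_eq_add hs hw1 (X ^ (m + 1) * q.reflect m)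
      have e4 : q'.eval w = w * q'.divX.eval w + q'.coeff 0 := by
        have := congrArg (eval w) (X_mul_divX_add q')
        rw [eval_add, eval_mul, eval_X, eval_C] at this
        exact this.symm
      rw [e3] at e1
      simp only [eval_sub, eval_mul, eval_C, eval_pow, eval_X, hκ]
      linear_combination (-q'.eval w) * e1 + q.eval w * e2 - w ^ (2 * m + 1) * Λ * e4
  have hq := h.eval_ne_zero hpos (Ioo_subset_Icc_self hw)
  have hq' := h'.eval_ne_zero hpos (Ioo_subset_Icc_self hw)
  have h1 := congrArg (eval w) hD
  simp only [eval_sub, eval_mul, eval_C, eval_pow, eval_X, eval_zero] at h1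
  have h2 := h.mul_eval_pos hpos (Ioo_subset_Icc_self hw)
  have h3 := h'.mul_eval_pos hpos (Ioo_subset_Icc_self hw)
  have h4 := h.coeff_mul_momentFunctional_pos hpos
  have h5 : 0 < Λ * q.eval w := by
    have := mul_pos h2 h4
    have h6 : 0 < q.coeff 0 ^ 2 * (Λ * q.eval w) := by rw [← hΛ] at this; linarith
    exact pos_of_mul_pos_right h6 (sq_nonneg _)
  have h6 : 0 < κ * (q.eval w * q'.eval w) := by
    have := mul_pos h5 h3
    rw [hκ]; linarith
  have h7 : p'.eval w / q'.eval w - p.eval w / q.eval w =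
      κ * (q.eval w * q'.eval w) * w ^ (2 * m + 1) / (q.eval w * q'.eval w) ^ 2 := by
    field_simp
    linear_combination h1
  have h8 : 0 < κ * (q.eval w * q'.eval w) * w ^ (2 * m + 1) / (q.eval w * q'.eval w) ^ 2 :=
    div_pos (mul_pos h6 (pow_pos hw.1 _)) (by positivity)
  linarith

/-- Cancelling a common factor would give a denominator of degree less than `m` that is orthogonal
to itself. -/
theorem isCoprime (hpos : IsPosMoment s) (hs : ∀ n, |s n| ≤ 1) (h : IsMomentPade s m p q) :
    IsCoprime p q := by
  obtain ⟨g, p₁, q₁, hcop, hpg, hqg⟩ := exists_eq_mul_isCoprime p h.ne_zero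
  have hg0 : g ≠ 0 := fun h0 => h.ne_zero (by rw [hqg, h0, zero_mul])
  have hq₁0 : q₁ ≠ 0 := fun h0 => h.ne_zero (by rw [hqg, h0, mul_zero])
  rcases Nat.eq_zero_or_pos g.natDegree with hg | hg
  · have hu : IsUnit g := by
      rw [eq_C_of_natDegree_eq_zero hg] at hg0 ⊢
      exact isUnit_C.2 (IsUnit.mk0 _ fun h0 => hg0 (by rw [h0, C_0]))
    rw [hpg, hqg, isCoprime_mul_unit_left hu]
    exact hcop
  exfalso
  have hg00 : g.eval 0 ≠ 0 := fun h0 => h.coeff_zero_ne (by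
    rw [coeff_zero_eq_eval_zero, hqg, eval_mul, h0, zero_mul])
  have hdq : q₁.natDegree + g.natDegree ≤ m := by
    have := natDegree_mul hg0 hq₁0
    rw [← hqg] at this
    have := h.natDegree_le
    omega
  have hdp : p₁.natDegree ≤ m - 1 := by
    by_cases hp0 : p₁ = 0
    · rw [hp0, natDegree_zero]; exact Nat.zero_le _
    have := natDegree_mul hg0 hp0
    rw [← hpg] at this
    have := h.natDegree_num_le
    omega
  have hO : (fun w => q₁.eval w * momentSeries s w 1 - p₁.eval w) =O[𝓝[≠] (0 : ℝ)]
      fun w => w ^ (m - 1 + (m + 1) + 1) := by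
    have h1 : (fun w => (g.eval w)⁻¹) =O[𝓝[≠] (0 : ℝ)] fun _ => (1 : ℝ) :=
      (((g.continuous.tendsto 0).inv₀ hg00).mono_left nhdsWithin_le_nhds).isBigO_one ℝ
    have h2 := h1.mul (h.isBigO hs)
    simp only [one_mul] at h2
    rw [show m - 1 + (m + 1) + 1 = 2 * m + 1 by omega]
    refine h2.congr' ?_ EventuallyEq.rfl
    filter_upwards [nhdsWithin_le_nhds
      ((g.continuous.continuousAt (x := 0)).eventually_ne hg00)] with w hw
    rw [hpg, hqg, eval_mul, eval_mul]
    field_simp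
  obtain ⟨horth, -⟩ := orthogonal_of_isBigO hs hdp (by omega) hO
  have h1 : momentFunctional s (X * q₁.reflect (m - 1) * q₁.reflect (m - 1)) = 0 :=
    momentFunctional_mul_eq_zero horth fun k hk => coeff_eq_zero_of_natDegree_lt
      ((natDegree_reflect_le' (d := m - 1) (by omega)).trans_lt (by omega))
  have h2 := hpos X (q₁.reflect (m - 1)) (fun t ht => by simpa using ht.1) X_ne_zero
    (by rwa [Ne, reflect_eq_zero_iff])
  rw [sq, ← mul_assoc] at h2
  exact h2.ne' h1

theorem of_isBigO (hs : ∀ n, |s n| ≤ 1) (hp : p.natDegree ≤ m) (hq : q.natDegree ≤ m)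
    (hq0 : q.eval 0 ≠ 0)
    (h : (fun w => q.eval w * momentSeries s w 1 - p.eval w) =O[𝓝[≠] (0 : ℝ)]
      fun w => w ^ (2 * m + 1)) : IsMomentPade s m p q := by
  rw [two_mul] at h
  obtain ⟨h1, h2⟩ := orthogonal_of_isBigO hs hp hq h
  exact ⟨hq, by rwa [coeff_zero_eq_eval_zero], h1, h2⟩

end IsMomentPade

/-- The orthogonality relations are a square linear system, and its matrix is injective by
positivity. -/
theorem exists_isMomentPade (hpos : IsPosMoment s) (m : ℕ) : ∃ p q, IsMomentPade s m p q := by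
  let φ : degreeLT ℝ m →ₗ[ℝ] (Fin m → ℝ) :=
    { toFun := fun R i => momentFunctional s (X ^ (i.1 + 1) * (R : ℝ[X]))
      map_add' := fun R R' => by ext i; simp [mul_add]
      map_smul' := fun a R => by ext i; simp }
  have hinj : Function.Injective φ := by
    rw [injective_iff_map_eq_zero]
    rintro ⟨R, hRm⟩ hR
    have horth : ∀ j, 1 ≤ j → j ≤ m → momentFunctional s (X ^ j * R) = 0 := by
      intro j hj hjm
      have h1 := congrFun hR ⟨j - 1, by omega⟩
      simp only [φ, LinearMap.coe_mk, AddHom.coe_mk, Nat.sub_add_cancel hj] at h1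
      exact h1
    have h1 : momentFunctional s (X * R * R) = 0 :=
      momentFunctional_mul_eq_zero horth fun k hk =>
        coeff_eq_zero_of_degree_lt ((mem_degreeLT.1 hRm).trans_le (by exact_mod_cast hk))
    by_contra h0
    have h2 := hpos X R (fun t ht => by simpa using ht.1) X_ne_zero
      (fun h => h0 (Subtype.ext h))
    rw [sq, ← mul_assoc] at h2
    exact h2.ne' h1
  have hsurj : Function.Surjective φ :=
    (LinearMap.injective_iff_surjective_of_finrank_eq_finrank
      ((degreeLTEquiv ℝ m).finrank_eq)).1 hinj
  obtain ⟨⟨R, hRd⟩, hR⟩ := hsurj fun i => -momentFunctional s (X ^ (i.1 + 1) * X ^ m)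
  set Q : ℝ[X] := X ^ m + R with hQ
  have hRm : R.coeff m = 0 := coeff_eq_zero_of_degree_lt (mem_degreeLT.1 hRd)
  have hQd : Q.natDegree ≤ m := by
    refine natDegree_add_le_of_degree_le (natDegree_X_pow_le m) ?_
    exact natDegree_le_of_degree_le (mem_degreeLT.1 hRd).le
  refine ⟨_, Q.reflect m, natDegree_reflect_le' hQd, ?_, fun j hj hjm => ?_, rfl⟩
  · rw [coeff_reflect, revAt_le (Nat.zero_le m), Nat.sub_zero, hQ, coeff_add, hRm, coeff_X_pow]
    simp
  · rw [reflect_reflect, hQ, mul_add, map_add]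
    have := congrFun hR ⟨j - 1, by omega⟩
    simp only [φ, LinearMap.coe_mk, AddHom.coe_mk, Nat.sub_add_cancel hj] at this
    rw [this]
    ring

end Pade

/-! ### The heteroclinic orbit as a solution of the scalar equation -/

section Heteroclinic

variable {c : ℝ} {h : ℝ → ℝ}

theorem mem_Icc_of_mem_graph {h : ℝ → ℝ} {z : ℝ × ℝ}
    (hz : z ∈ (fun x : ℝ => (x, h x)) '' Icc (0 : ℝ) 1) : z.1 ∈ Icc (0 : ℝ) 1 ∧ z.2 = h z.1 := by
  obtain ⟨x, hx, rfl⟩ := hz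
  exact ⟨hx, rfl⟩

/-- `h` is a negative solution of the scalar orbit equation `h h' = -c h - x (1 - x)` on `(0, 1)`. The
saddle enters through `h 1 = 0` and values of `h` near `x = 1` that are arbitrarily close to `0`;
continuity at `1` is not part of the definition. -/
structure IsGraphFunction (c : ℝ) (h : ℝ → ℝ) : Prop where
  one : h 1 = 0
  neg : ∀ x ∈ Ioo (0 : ℝ) 1, h x < 0
  hasDerivAt : ∀ x ∈ Ioo (0 : ℝ) 1, HasDerivAt h ((-c * h x - x * (1 - x)) / h x) x
  small : ∀ ε > 0, ∃ x ∈ Ioo (0 : ℝ) 1, 1 - ε < x ∧ -ε < h x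

/-- Where `v ≠ 0` the time can be eliminated by the inverse function theorem. The sign of `h` is
forced by the direction from `u = 1` to `u = 0`. -/
theorem IsHeteroclinicGraph.isGraphFunction (hh : IsHeteroclinicGraph c h) :
    IsGraphFunction c h := by
  obtain ⟨u, v, ⟨hsol, hbot, htop⟩, hgraph⟩ := hh
  have hu : ∀ s, HasDerivAt u (v s) s := fun s => (hsol s).1
  have hv : ∀ s, HasDerivAt v (-c * v s - u s * (1 - u s)) s := fun s => (hsol s).2
  have huc : Continuous u := continuous_iff_continuousAt.2 fun s => (hu s).continuousAt
  have hvc : Continuous v := continuous_iff_continuousAt.2 fun s => (hv s).continuousAt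
  have h0 : h 0 = 0 := by
    have : ((0 : ℝ), (0 : ℝ)) ∈ (fun x : ℝ => (x, h x)) '' Icc (0 : ℝ) 1 := by
      rw [hgraph]; exact Or.inr (Or.inl rfl)
    exact (mem_Icc_of_mem_graph this).2.symm
  have h1 : h 1 = 0 := by
    have : ((1 : ℝ), (0 : ℝ)) ∈ (fun x : ℝ => (x, h x)) '' Icc (0 : ℝ) 1 := by
      rw [hgraph]; exact Or.inr (Or.inr rfl)
    exact (mem_Icc_of_mem_graph this).2.symm
  have huv : ∀ s, u s ∈ Icc (0 : ℝ) 1 ∧ v s = h (u s) := by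
    intro s
    have : (u s, v s) ∈ (fun x : ℝ => (x, h x)) '' Icc (0 : ℝ) 1 := by
      rw [hgraph]; exact Or.inl ⟨s, rfl⟩
    exact mem_Icc_of_mem_graph this
  have hsurj : ∀ x ∈ Ioo (0 : ℝ) 1, ∃ s, u s = x := by
    intro x hx
    have : (x, h x) ∈ (fun x : ℝ => (x, h x)) '' Icc (0 : ℝ) 1 := ⟨x, Ioo_subset_Icc_self hx, rfl⟩
    rw [hgraph] at this
    rcases this with ⟨s, hs⟩ | h' | h'
    · exact ⟨s, congrArg Prod.fst hs⟩
    · exact absurd (congrArg Prod.fst h') hx.1.ne'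
    · exact absurd (congrArg Prod.fst h') hx.2.ne
  -- where `v` vanishes, `u` would have a strict maximum, and the orbit would not be a graph
  have hv0 : ∀ s, u s ∈ Ioo (0 : ℝ) 1 → v s ≠ 0 := by
    intro s hs hvs
    have hneg : -c * v s - u s * (1 - u s) < 0 := by
      rw [hvs]; nlinarith [mul_pos hs.1 (show 0 < 1 - u s by linarith [hs.2])]
    have hslope := hasDerivAt_iff_tendsto_slope.1 (hv s)
    have hev : ∀ᶠ x in 𝓝[≠] s, slope v s x < 0 := hslope.eventually_lt_const hneg
    rw [eventually_nhdsWithin_iff] at hev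
    obtain ⟨δ, hδ, hball⟩ := Metric.eventually_nhds_iff_ball.1 hev
    have hsl : ∀ x, |x - s| < δ → x ≠ s → v x / (x - s) < 0 := by
      intro x hx hxs
      have := hball x (by rwa [Metric.mem_ball, Real.dist_eq]) hxs
      rwa [slope_def_field, hvs, sub_zero] at this
    have hleft : ∀ x ∈ Ioo (s - δ) s, 0 < v x := by
      intro x hx
      have h2 := hsl x (by rw [abs_lt]; constructor <;> linarith [hx.1, hx.2]) hx.2.ne
      by_contra hcon
      exact absurd (div_nonneg_of_nonpos (not_lt.1 hcon) (by linarith [hx.2])) (not_le.2 h2)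
    have hright : ∀ x ∈ Ioo s (s + δ), v x < 0 := by
      intro x hx
      have h2 := hsl x (by rw [abs_lt]; constructor <;> linarith [hx.1, hx.2]) hx.1.ne'
      by_contra hcon
      exact absurd (div_nonneg (not_lt.1 hcon) (by linarith [hx.1])) (not_le.2 h2)
    have hmono : StrictMonoOn u (Icc (s - δ / 2) s) := by
      refine strictMonoOn_of_deriv_pos (convex_Icc _ _) huc.continuousOn fun x hx => ?_
      rw [interior_Icc] at hx
      rw [(hu x).deriv]
      exact hleft x ⟨by linarith [hx.1], hx.2⟩
    have hanti : StrictAntiOn u (Icc s (s + δ / 2)) := by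
      refine strictAntiOn_of_deriv_neg (convex_Icc _ _) huc.continuousOn fun x hx => ?_
      rw [interior_Icc] at hx
      rw [(hu x).deriv]
      exact hright x ⟨hx.1, by linarith [hx.2]⟩
    have ha := hmono (left_mem_Icc.2 (by linarith)) (right_mem_Icc.2 (by linarith))
      (show s - δ / 2 < s by linarith)
    have hb := hanti (left_mem_Icc.2 (by linarith)) (right_mem_Icc.2 (by linarith))
      (show s < s + δ / 2 by linarith)
    set y := max (u (s - δ / 2)) (u (s + δ / 2)) with hy
    have hys : y < u s := max_lt ha hb
    obtain ⟨a, haI, hay⟩ := intermediate_value_Icc (show s - δ / 2 ≤ s by linarith)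
      huc.continuousOn (show y ∈ Icc _ _ from ⟨le_max_left _ _, hys.le⟩)
    obtain ⟨b, hbI, hby⟩ := intermediate_value_Icc' (show s ≤ s + δ / 2 by linarith)
      huc.continuousOn (show y ∈ Icc _ _ from ⟨le_max_right _ _, hys.le⟩)
    have has : a < s := lt_of_le_of_ne haI.2 fun h => by rw [h] at hay; exact hys.ne' hay
    have hbs : s < b := lt_of_le_of_ne hbI.1 fun h => by rw [← h] at hby; exact hys.ne' hby
    have hva := hleft a ⟨by linarith [haI.1], has⟩
    have hvb := hright b ⟨hbs, by linarith [hbI.2]⟩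
    rw [(huv a).2, hay] at hva
    rw [(huv b).2, hby] at hvb
    linarith
  have hder : ∀ x ∈ Ioo (0 : ℝ) 1, HasDerivAt h ((-c * h x - x * (1 - x)) / h x) x := by
    intro x hx
    obtain ⟨s, rfl⟩ := hsurj x hx
    have hvs := hv0 s hx
    have hstrict : HasStrictDerivAt u (v s) s :=
      hasStrictDerivAt_of_hasDerivAt_of_continuousAt (Eventually.of_forall hu) hvc.continuousAt
    have hg := (hstrict.to_localInverse hvs).hasDerivAt
    have hgs : hstrict.localInverse u (v s) s hvs (u s) = s :=
      hstrict.hasStrictFDerivAt_equiv hvs |>.localInverse_apply_image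
    have h2 := (hv (hstrict.localInverse u (v s) s hvs (u s))).comp (u s) hg
    rw [hgs] at h2
    have h3 : h =ᶠ[𝓝 (u s)] v ∘ hstrict.localInverse u (v s) s hvs := by
      filter_upwards [(hstrict.hasStrictFDerivAt_equiv hvs).eventually_right_inverse] with y hy
      have h4 := (huv (hstrict.localInverse u (v s) s hvs y)).2
      rw [Function.comp_apply, h4]
      exact congrArg h hy.symm
    refine (h2.congr_of_eventuallyEq h3).congr_deriv ?_
    rw [← (huv s).2, div_eq_mul_inv]
  have hne : ∀ x ∈ Ioo (0 : ℝ) 1, h x ≠ 0 := by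
    intro x hx
    obtain ⟨s, rfl⟩ := hsurj x hx
    rw [← (huv s).2]; exact hv0 s hx
  have hcont : ContinuousOn h (Ioo 0 1) := fun x hx => (hder x hx).continuousAt.continuousWithinAt
  have hubot : Tendsto u atBot (𝓝 1) := (continuous_fst.tendsto _).comp hbot
  have hutop : Tendsto u atTop (𝓝 0) := (continuous_fst.tendsto _).comp htop
  have hvbot : Tendsto v atBot (𝓝 0) := (continuous_snd.tendsto _).comp hbot
  have hneg : ∀ x ∈ Ioo (0 : ℝ) 1, h x < 0 := by
    by_contra! hcon
    obtain ⟨a, ha, hpa⟩ := hcon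
    have hpos : ∀ x ∈ Ioo (0 : ℝ) 1, 0 < h x := by
      intro x hx
      by_contra hx0
      obtain ⟨y, hy, hy0⟩ := isPreconnected_Ioo.intermediate_value hx ha hcont
        (show (0 : ℝ) ∈ Icc _ _ from ⟨not_lt.1 hx0, hpa⟩)
      exact hne y hy hy0
    have hvnn : ∀ s, 0 ≤ v s := by
      intro s
      obtain ⟨hs, hsv⟩ := huv s
      rw [hsv]
      rcases eq_or_lt_of_le hs.1 with h2 | h2
      · rw [← h2, h0]
      rcases eq_or_lt_of_le hs.2 with h3 | h3
      · rw [h3, h1]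
      · exact (hpos _ ⟨h2, h3⟩).le
    have hmono : Monotone u := monotone_of_deriv_nonneg (fun s => (hu s).differentiableAt)
      fun s => by rw [(hu s).deriv]; exact hvnn s
    have h2 : (1 : ℝ) ≤ u 0 := hmono.le_of_tendsto hubot 0
    have h3 : u 0 ≤ 0 := hmono.ge_of_tendsto hutop 0
    linarith
  refine ⟨h1, hneg, hder, fun ε hε => ?_⟩
  -- points of the orbit with `u < 1` that are close to the saddle
  set ε' := min ε 1 with hε'
  have hε'0 : 0 < ε' := lt_min hε one_pos
  have hclose : ∃ s, u s ≠ 1 ∧ 1 - ε' < u s ∧ -ε' < v s := by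
    have hev : ∀ᶠ s in atBot, 1 - ε' < u s ∧ -ε' < v s :=
      (hubot.eventually_const_lt (by linarith)).and (hvbot.eventually_const_lt (by linarith))
    obtain ⟨S, hS⟩ := hev.exists
    by_cases hS1 : u S = 1
    · have hclosed : IsClosed {s | u s = 1} := isClosed_eq huc continuous_const
      obtain ⟨T, hT⟩ := eventually_atTop.1 (hutop.eventually_lt_const (zero_lt_one (α := ℝ)))
      have hbdd : BddAbove {s | u s = 1} := ⟨T, fun s hs => by
        by_contra hcon
        exact absurd hs (hT s (not_le.1 hcon).le).ne⟩
      have hmem := hclosed.csSup_mem ⟨S, hS1⟩ hbdd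
      set σ := sSup {s | u s = 1} with hσ
      have hσ1 : u σ = 1 := hmem
      have hσv : v σ = 0 := by rw [(huv σ).2, hσ1, h1]
      have hev2 : ∀ᶠ s in 𝓝[>] σ, 1 - ε' < u s ∧ -ε' < v s :=
        nhdsWithin_le_nhds ((huc.continuousAt.eventually_const_lt (by rw [hσ1]; linarith)).and
          (hvc.continuousAt.eventually_const_lt (by rw [hσv]; linarith)))
      obtain ⟨s, hs, hsσ⟩ := (hev2.and self_mem_nhdsWithin).exists
      exact ⟨s, fun h2 => absurd (le_csSup hbdd h2) (not_le.2 hsσ), hs⟩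
    · exact ⟨S, hS1, hS⟩
  obtain ⟨s, hs1, hs2, hs3⟩ := hclose
  have hs := (huv s).1
  have := min_le_left ε 1
  have := min_le_right ε 1
  refine ⟨u s, ⟨by linarith, lt_of_le_of_ne hs.2 hs1⟩, by linarith, ?_⟩
  rw [← (huv s).2]
  linarith

end Heteroclinic

/-! ### Identification of the heteroclinic orbit with the power series -/

section Identification

variable {c r : ℝ} {h : ℝ → ℝ}

theorem sepFun_ode_of_lt_one (hc : 2 ≤ c) (hr : 0 < r) (hcr : r ^ 2 + c * r = 1) {w : ℝ}
    (hw : |w| < 1) : DifferentiableAt ℝ (sepFun ℝ c r) w ∧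
      sepFun ℝ c r w * deriv (sepFun ℝ c r) w = w * (1 - w) - c * sepFun ℝ c r w := by
  have hsum := summable_sepCoeff hc hr hcr (ϱ := (|w| + 1) / 2) (by positivity) (by linarith)
  exact sepFun_ode (𝕜 := ℝ) (by linarith) hr hcr hsum (by rw [Real.norm_eq_abs]; linarith)

theorem momentSeries_one_pos (hc : 2 ≤ c) (hr : 0 < r) (hcr : r ^ 2 + c * r = 1) {w : ℝ}
    (hw0 : 0 ≤ w) (hw1 : w < 1) : 0 < momentSeries (sepMoment c r) w 1 := by
  have hnn : ∀ l, 0 ≤ momentFunctional (sepMoment c r) (X ^ l * 1) := fun l =>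
    momentFunctional_nonneg hc hr hcr fun t ht => by simpa using pow_nonneg ht.1 l
  refine (summable_momentSeries (abs_sepMoment_le hc hr hcr)
    (by rwa [abs_of_nonneg hw0]) 1).tsum_pos
    (fun l => mul_nonneg (hnn l) (pow_nonneg hw0 l)) 0 ?_
  have := momentFunctional_X_pow (sepMoment c r) 0
  rw [pow_zero, sepMoment_zero] at this
  simp [this]

theorem sepFun_pos (hc : 2 ≤ c) (hr : 0 < r) (hcr : r ^ 2 + c * r = 1) {w : ℝ}
    (hw : w ∈ Ioo (0 : ℝ) 1) : 0 < sepFun ℝ c r w := by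
  rw [sepFun_eq_mul_momentSeries hc hr hcr (by rw [abs_of_pos hw.1]; exact hw.2)]
  have := momentSeries_one_pos hc hr hcr hw.1.le hw.2
  have := hw.1
  have : 0 < 1 - w := by linarith [hw.2]
  positivity

/-- The equation has only one positive solution that tends to `0` at `0`: for two of them, the
square of the difference of squares is nonincreasing and tends to `0`. -/
theorem eqOn_of_ode (hc : 0 < c) {y Y : ℝ → ℝ} (hy : ∀ w ∈ Ioo (0 : ℝ) 1, 0 < y w)
    (hY : ∀ w ∈ Ioo (0 : ℝ) 1, 0 < Y w)
    (hyd : ∀ w ∈ Ioo (0 : ℝ) 1, HasDerivAt y ((w * (1 - w) - c * y w) / y w) w)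
    (hYd : ∀ w ∈ Ioo (0 : ℝ) 1, HasDerivAt Y ((w * (1 - w) - c * Y w) / Y w) w)
    (hy0 : Tendsto y (𝓝[>] 0) (𝓝 0)) (hY0 : Tendsto Y (𝓝[>] 0) (𝓝 0)) :
    EqOn y Y (Ioo 0 1) := by
  set D : ℝ → ℝ := fun w => (y w ^ 2 - Y w ^ 2) ^ 2 with hD
  have hDd : ∀ w ∈ Ioo (0 : ℝ) 1, HasDerivAt D
      (-4 * c * (y w - Y w) ^ 2 * (y w + Y w)) w := by
    intro w hw
    have h1 := (hy w hw).ne'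
    have h2 := (hY w hw).ne'
    refine ((((hyd w hw).pow 2).sub ((hYd w hw).pow 2)).pow 2).congr_deriv ?_
    simp only [Pi.sub_apply, Pi.pow_apply]
    field_simp
    push_cast
    ring
  have hanti : AntitoneOn D (Ioo 0 1) := by
    refine antitoneOn_of_deriv_nonpos (convex_Ioo _ _)
      (fun w hw => (hDd w hw).continuousAt.continuousWithinAt)
      (fun w hw => ?_) fun w hw => ?_
    · rw [interior_Ioo] at hw
      exact (hDd w hw).differentiableAt.differentiableWithinAt
    · rw [interior_Ioo] at hw
      rw [(hDd w hw).deriv]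
      have := mul_nonneg (mul_nonneg hc.le (sq_nonneg (y w - Y w)))
        (add_pos (hy w hw) (hY w hw)).le
      nlinarith
  have hD0 : Tendsto D (𝓝[>] 0) (𝓝 0) := by
    have := ((hy0.pow 2).sub (hY0.pow 2)).pow 2
    simpa using this
  intro w hw
  have h1 : D w ≤ 0 := by
    refine ge_of_tendsto hD0 ?_
    filter_upwards [Ioo_mem_nhdsGT hw.1] with x hx
    exact hanti ⟨hx.1, hx.2.trans hw.2⟩ hw hx.2.le
  have h2 : y w ^ 2 - Y w ^ 2 = 0 := pow_eq_zero_iff two_ne_zero |>.1 (le_antisymm h1 (sq_nonneg _))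
  have h3 : (y w - Y w) * (y w + Y w) = 0 := by rw [← h2]; ring
  have h4 := (add_pos (hy w hw) (hY w hw)).ne'
  exact sub_eq_zero.1 ((mul_eq_zero.1 h3).resolve_right h4)

/-- The function `-h(1 - w) + c w` is monotone, so its small values near `w = 0` force the limit
`0`. -/
theorem IsGraphFunction.tendsto_zero (hc : 0 < c) (hh : IsGraphFunction c h) :
    Tendsto (fun w => -h (1 - w)) (𝓝[>] 0) (𝓝 0) := by
  have hder : ∀ w ∈ Ioo (0 : ℝ) 1, HasDerivAt (fun w => -h (1 - w) + c * w)
      (-(w * (1 - w)) / h (1 - w)) w := by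
    intro w hw
    have hw' : 1 - w ∈ Ioo (0 : ℝ) 1 := ⟨by linarith [hw.2], by linarith [hw.1]⟩
    have h0 := (hh.neg _ hw').ne
    have h1 := (hh.hasDerivAt _ hw').comp w ((hasDerivAt_id w).const_sub 1)
    refine (h1.neg.add ((hasDerivAt_id w).const_mul c)).congr_deriv ?_
    field_simp
    ring
  have hmono : MonotoneOn (fun w => -h (1 - w) + c * w) (Ioo 0 1) := by
    refine monotoneOn_of_deriv_nonneg (convex_Ioo _ _)
      (fun w hw => (hder w hw).continuousAt.continuousWithinAt)
      (fun w hw => ?_) fun w hw => ?_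
    · rw [interior_Ioo] at hw
      exact (hder w hw).differentiableAt.differentiableWithinAt
    · rw [interior_Ioo] at hw
      rw [(hder w hw).deriv]
      have hw' : 1 - w ∈ Ioo (0 : ℝ) 1 := ⟨by linarith [hw.2], by linarith [hw.1]⟩
      refine div_nonneg_of_nonpos ?_ (hh.neg _ hw').le
      have := mul_pos hw.1 hw'.1
      linarith
  rw [Metric.tendsto_nhds]
  intro ε hε
  set δ := ε / (1 + c) with hδ
  have hδ0 : 0 < δ := by positivity
  obtain ⟨x, hx, hx1, hx2⟩ := hh.small δ hδ0
  have hx' : 1 - x ∈ Ioo (0 : ℝ) 1 := ⟨by linarith [hx.2], by linarith [hx.1]⟩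
  filter_upwards [Ioo_mem_nhdsGT hx'.1] with w hw
  have hw1 : w ∈ Ioo (0 : ℝ) 1 := ⟨hw.1, hw.2.trans hx'.2⟩
  have h1 := hmono hw1 hx' hw.2.le
  simp only [sub_sub_cancel] at h1
  have h2 := hh.neg (1 - w) ⟨by linarith [hw1.2], by linarith [hw1.1]⟩
  rw [Real.dist_eq, sub_zero, abs_of_pos (by linarith)]
  have h3 : c * (1 - x) < c * δ := mul_lt_mul_of_pos_left (by linarith) hc
  have h4 : (1 + c) * δ = ε := by rw [hδ]; field_simp
  have h5 : 0 < c * w := mul_pos hc hw.1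
  linarith

/-- The heteroclinic orbit is given by the power series all the way to the node. -/
theorem IsGraphFunction.eq_sepFun (hc : 2 ≤ c) (hr : 0 < r) (hcr : r ^ 2 + c * r = 1)
    (hh : IsGraphFunction c h) {x : ℝ} (hx : x ∈ Ioc (0 : ℝ) 1) :
    h x = -sepFun ℝ c r (1 - x) := by
  have hc0 : 0 < c := by linarith
  rcases eq_or_lt_of_le hx.2 with h1 | h1
  · rw [h1, hh.one]; simp [sepFun]
  have hflip : ∀ {w : ℝ}, w ∈ Ioo (0 : ℝ) 1 → 1 - w ∈ Ioo (0 : ℝ) 1 := fun hw =>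
    ⟨by linarith [hw.2], by linarith [hw.1]⟩
  have hode : ∀ w ∈ Ioo (0 : ℝ) 1, _ := fun w (hw : w ∈ Ioo (0 : ℝ) 1) =>
    sepFun_ode_of_lt_one hc hr hcr (by rw [abs_of_pos hw.1]; exact hw.2)
  have key := eqOn_of_ode hc0 (y := fun w => -h (1 - w)) (Y := sepFun ℝ c r)
    (fun w hw => neg_pos.2 (hh.neg _ (hflip hw))) (fun w hw => sepFun_pos hc hr hcr hw)
    (fun w hw => by
      have h0 := (hh.neg _ (hflip hw)).ne
      refine (((hh.hasDerivAt _ (hflip hw)).comp w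
        ((hasDerivAt_id w).const_sub 1)).neg).congr_deriv ?_
      field_simp
      ring)
    (fun w hw => (hode w hw).1.hasDerivAt.congr_deriv (by
      rw [eq_div_iff (sepFun_pos hc hr hcr hw).ne', ← (hode w hw).2]; ring))
    (hh.tendsto_zero hc0) (by
      have h2 := (sepFun_ode_of_lt_one hc hr hcr (w := 0) (by simp)).1.continuousAt.tendsto
      rw [show sepFun ℝ c r 0 = 0 by simp [sepFun]] at h2
      exact h2.mono_left nhdsWithin_le_nhds)
    (hflip ⟨hx.1, h1⟩)
  simp only [sub_sub_cancel] at key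
  linarith

end Identification

/-! ### Taylor polynomials, and transfer of the Padé approximants -/

section Taylor

variable {c r : ℝ} {h : ℝ → ℝ}

/-- The coefficients of the expansion of `h` in powers of `u - 1`. -/
noncomputable def graphCoeff (c r : ℝ) : ℕ → ℝ
  | 0 => 0
  | 1 => r
  | n + 2 => (-1) ^ n * sepCoeff c r n

theorem hasFPowerSeriesOnBall_graph (hc : 2 ≤ c) (hr : 0 < r) (hcr : r ^ 2 + c * r = 1) :
    HasFPowerSeriesOnBall (fun x => -sepFun ℝ c r (1 - x))
      (FormalMultilinearSeries.ofScalars ℝ (graphCoeff c r)) 1 (ENNReal.ofReal (1 / 2)) := by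
  have hsum := summable_sepCoeff hc hr hcr (ϱ := 1 / 2) (by norm_num) (by norm_num)
  have hsum' : Summable fun n => ‖graphCoeff c r n‖ * (1 / 2 : ℝ) ^ n := by
    rw [← summable_nat_add_iff 2]
    refine (hsum.mul_right ((1 / 2) ^ 2)).congr fun n => ?_
    rw [graphCoeff, norm_mul, norm_pow, norm_neg, norm_one, one_pow, one_mul, Real.norm_eq_abs,
      abs_of_pos (sepCoeff_pos (by linarith) hr n), pow_add, mul_assoc]
  have h1 := (hasFPowerSeriesOnBall_tsum (𝕜 := ℝ) (by norm_num) hsum').comp_sub 1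
  rw [zero_add] at h1
  refine h1.congr fun x hx => ?_
  rw [Metric.mem_eball, edist_dist, ENNReal.ofReal_lt_ofReal_iff (by norm_num),
    Real.dist_eq] at hx
  have h2 : Summable fun n => graphCoeff c r n * (x - 1) ^ n := by
    refine Summable.of_norm_bounded hsum' fun n => ?_
    rw [norm_mul, norm_pow, Real.norm_eq_abs (x - 1)]
    gcongr
  simp only
  rw [h2.tsum_eq_zero_add, ((summable_nat_add_iff 1).2 h2).tsum_eq_zero_add, sepFun, sepSeries]
  simp only [graphCoeff, RCLike.ofReal_real_eq_id, id_eq]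
  rw [show -(r * (1 - x) - (1 - x) ^ 2 * ∑' n, sepCoeff c r n * (1 - x) ^ n) =
    r * (x - 1) + ∑' n, (1 - x) ^ 2 * (sepCoeff c r n * (1 - x) ^ n) by rw [tsum_mul_left]; ring]
  simp only [zero_mul, zero_add, pow_one]
  congr 1
  refine tsum_congr fun n => ?_
  rw [show 1 - x = -1 * (x - 1) by ring, mul_pow, mul_pow]
  ring

theorem IsGraphFunction.eventuallyEq (hc : 2 ≤ c) (hr : 0 < r) (hcr : r ^ 2 + c * r = 1)
    (hh : IsGraphFunction c h) :
    h =ᶠ[𝓝[Icc (0 : ℝ) 1] 1] fun x => -sepFun ℝ c r (1 - x) := by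
  filter_upwards [self_mem_nhdsWithin, nhdsWithin_le_nhds (Ioi_mem_nhds (zero_lt_one (α := ℝ)))]
    with x hx hx0
  exact hh.eq_sepFun hc hr hcr ⟨hx0, hx.2⟩

theorem IsGraphFunction.analyticWithinAt (hc : 2 ≤ c) (hr : 0 < r) (hcr : r ^ 2 + c * r = 1)
    (hh : IsGraphFunction c h) : AnalyticWithinAt ℝ h (Icc (0 : ℝ) 1) 1 :=
  ((hasFPowerSeriesOnBall_graph hc hr hcr).analyticAt.analyticWithinAt).congr_of_eventuallyEq
    (hh.eventuallyEq hc hr hcr) (hh.eq_sepFun hc hr hcr ⟨one_pos, le_rfl⟩)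

theorem IsGraphFunction.separatrixTaylor_succ (hc : 2 ≤ c) (hr : 0 < r)
    (hcr : r ^ 2 + c * r = 1) (hh : IsGraphFunction c h) (n : ℕ) (u : ℝ) :
    separatrixTaylor h (n + 1) u =
      -r * (1 - u) + ∑ j ∈ Finset.range n, sepCoeff c r j * (1 - u) ^ (j + 2) := by
  have hps := hasFPowerSeriesOnBall_graph hc hr hcr
  have hcoef : ∀ k, iteratedDerivWithin k h (Icc (0 : ℝ) 1) 1 = k.factorial * graphCoeff c r k := by
    intro k
    have h1 := hps.factorial_smul 1 k
    rw [FormalMultilinearSeries.ofScalars_apply_eq, one_pow, smul_eq_mul, mul_one, nsmul_eq_mul,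
      ← iteratedDeriv_eq_iteratedFDeriv] at h1
    rw [h1, (hh.eventuallyEq hc hr hcr).iteratedDerivWithin_eq
      (hh.eq_sepFun hc hr hcr ⟨one_pos, le_rfl⟩)]
    exact iteratedDerivWithin_eq_iteratedDeriv (uniqueDiffOn_Icc zero_lt_one)
      hps.analyticAt.contDiffAt (right_mem_Icc.2 zero_le_one)
  rw [separatrixTaylor, taylor_within_apply, Finset.sum_range_succ', Finset.sum_range_succ']
  simp only [hcoef, graphCoeff, smul_eq_mul]
  have h2 : ∀ j ∈ Finset.range n, (((j + 1 + 1).factorial : ℝ)⁻¹ * (u - 1) ^ (j + 1 + 1)) *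
      ((j + 1 + 1).factorial * ((-1) ^ j * sepCoeff c r j)) =
      sepCoeff c r j * (1 - u) ^ (j + 2) := by
    intro j _
    have : ((j + 1 + 1).factorial : ℝ) ≠ 0 := by exact_mod_cast Nat.factorial_ne_zero _
    rw [show 1 - u = -1 * (u - 1) by ring, mul_pow (-1)]
    field_simp
    ring
  rw [Finset.sum_congr rfl h2]
  simp
  ring

theorem sepSeries_sub_isBigO (hc : 2 ≤ c) (hr : 0 < r) (hcr : r ^ 2 + c * r = 1) (n : ℕ) :
    (fun w => sepSeries ℝ c r w - ∑ j ∈ Finset.range n, sepCoeff c r j * w ^ j)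
      =O[𝓝 (0 : ℝ)] fun w => w ^ n := by
  have hsum := summable_sepCoeff hc hr hcr (ϱ := 1 / 2) (by norm_num) (by norm_num)
  have h1 := (hasFPowerSeriesOnBall_sepSeries (𝕜 := ℝ) (by linarith) hr (by norm_num)
    hsum).hasFPowerSeriesAt.isBigO_sub_partialSum_pow n
  refine (h1.congr_left fun w => ?_).trans (isBigO_of_le _ fun w => by simp)
  simp [FormalMultilinearSeries.partialSum, mul_comm]

end Taylor

section Transfer

variable {c : ℝ} {h : ℝ → ℝ}

theorem saddleRate_pos (c : ℝ) : 0 < saddleRate c := by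
  have h1 : |c| < √(c ^ 2 + 4) := by
    rw [← Real.sqrt_sq_eq_abs]
    exact Real.sqrt_lt_sqrt (sq_nonneg c) (by linarith)
  have := le_abs_self c
  rw [saddleRate]
  linarith

theorem saddleRate_sq_add (c : ℝ) : saddleRate c ^ 2 + c * saddleRate c = 1 := by
  have h1 := Real.sq_sqrt (show 0 ≤ c ^ 2 + 4 by positivity)
  rw [saddleRate]
  linarith

/-- The Taylor polynomial of degree `22` determines the quotient up to `w^{22}`, beyond the order
`2 m ≤ 20` that the Padé approximants see. -/
theorem IsGraphFunction.taylorQuotient_sub_isBigO (hc : 2 ≤ c) (hh : IsGraphFunction c h) :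
    (fun w => taylorQuotient c h (1 - w) - momentSeries (sepMoment c (saddleRate c)) w 1)
      =O[𝓝[≠] (0 : ℝ)] fun w => w ^ 22 := by
  set r := saddleRate c with hrdef
  have hr : 0 < r := saddleRate_pos c
  have hcr : r ^ 2 + c * r = 1 := saddleRate_sq_add c
  have h1 : (fun w : ℝ => (r * (1 - w))⁻¹ * w) =O[𝓝[≠] (0 : ℝ)] fun w => 1 * w := by
    refine IsBigO.mul ?_ (isBigO_refl _ _)
    have : Tendsto (fun w : ℝ => (r * (1 - w))⁻¹) (𝓝 0) (𝓝 (r * (1 - 0))⁻¹) :=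
      ((continuous_const.mul (continuous_const.sub continuous_id)).tendsto 0).inv₀
        (by simpa using hr.ne')
    exact (this.mono_left nhdsWithin_le_nhds).isBigO_one ℝ
  have h2 := h1.mul ((sepSeries_sub_isBigO hc hr hcr 21).mono (nhdsWithin_le_nhds (s := {0}ᶜ)))
  refine h2.congr' ?_ (Eventually.of_forall fun w => by ring)
  filter_upwards [self_mem_nhdsWithin, nhdsWithin_le_nhds (Metric.ball_mem_nhds (0 : ℝ) one_pos)]
    with w hw0 hw
  have hw0' : w ≠ 0 := hw0
  have hw1 : |w| < 1 := mem_ball_zero_iff.1 hw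
  have hw2 : 1 - w ≠ 0 := by linarith [le_abs_self w]
  have h3 := sepFun_eq_mul_momentSeries hc hr hcr hw1
  simp only [sepFun, RCLike.ofReal_real_eq_id, id_eq] at h3
  have h4 : momentSeries (sepMoment c r) w 1 = (r - w * sepSeries ℝ c r w) / (r * (1 - w)) := by
    rw [eq_div_iff (mul_ne_zero hr.ne' hw2)]
    refine mul_left_cancel₀ hw0' ?_
    linear_combination -h3
  have h5 : ∑ j ∈ Finset.range 21, sepCoeff c r j * w ^ (j + 2) =
      w ^ 2 * ∑ j ∈ Finset.range 21, sepCoeff c r j * w ^ j := by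
    rw [Finset.mul_sum]
    exact Finset.sum_congr rfl fun j _ => by ring
  rw [taylorQuotient, hh.separatrixTaylor_succ hc hr hcr 21, ← hrdef, h4, sub_sub_cancel, h5,
    show 1 - w - 1 = -w by ring]
  field_simp
  ring

theorem tendsto_one_sub : Tendsto (fun w : ℝ => 1 - w) (𝓝[≠] 0) (𝓝[≠] 1) := by
  refine tendsto_nhdsWithin_iff.2 ⟨?_, ?_⟩
  · have : Tendsto (fun w : ℝ => 1 - w) (𝓝 0) (𝓝 (1 - 0)) :=
      (continuous_const.sub continuous_id).tendsto 0
    rw [sub_zero] at this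
    exact this.mono_left nhdsWithin_le_nhds
  · filter_upwards [self_mem_nhdsWithin] with w hw hw1
    exact hw (by simpa using hw1)

theorem tendsto_one_sub' : Tendsto (fun x : ℝ => 1 - x) (𝓝[≠] 1) (𝓝[≠] 0) := by
  refine tendsto_nhdsWithin_iff.2 ⟨?_, ?_⟩
  · have : Tendsto (fun w : ℝ => 1 - w) (𝓝 1) (𝓝 (1 - 1)) :=
      (continuous_const.sub continuous_id).tendsto 1
    rw [sub_self] at this
    exact this.mono_left nhdsWithin_le_nhds
  · filter_upwards [self_mem_nhdsWithin] with x hx hx1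
    have : 1 - x = 0 := hx1
    exact hx (show x = 1 by linarith)

theorem pow_isBigO_pow_of_le {k n : ℕ} (hkn : k ≤ n) :
    (fun w : ℝ => w ^ n) =O[𝓝[≠] (0 : ℝ)] fun w => w ^ k := by
  have h1 : (fun w : ℝ => w ^ (n - k)) =O[𝓝[≠] (0 : ℝ)] fun _ => (1 : ℝ) :=
    (((continuous_pow (n - k)).tendsto 0).mono_left nhdsWithin_le_nhds).isBigO_one ℝ
  refine ((isBigO_refl (fun w : ℝ => w ^ k) _).mul h1).congr (fun w => ?_) fun w => mul_one _
  rw [← pow_add, Nat.add_sub_cancel' hkn]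

theorem natDegree_one_sub_X : (1 - X : ℝ[X]).natDegree = 1 := by
  rw [← natDegree_neg, neg_sub]
  exact natDegree_X_sub_C (1 : ℝ)

theorem natDegree_comp_one_sub (P : ℝ[X]) : (P.comp (1 - X)).natDegree = P.natDegree := by
  rw [natDegree_comp, natDegree_one_sub_X, mul_one]

theorem comp_one_sub_comp_one_sub (P : ℝ[X]) : (P.comp (1 - X)).comp (1 - X) = P := by
  rw [comp_assoc]; simp

/-- In the variable `w = 1 - u`, the Padé approximants of the quotient of the Taylor polynomial are
those of the generating series of the moments. -/
theorem IsGraphFunction.isPadeApproximant_iff (hc : 2 ≤ c) (hh : IsGraphFunction c h) {m : ℕ}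
    (hm : m ≤ 10) {p q : ℝ[X]} :
    IsPadeApproximant (taylorQuotient c h) 1 m m p q ↔
      IsMomentPade (sepMoment c (saddleRate c)) m (p.comp (1 - X)) (q.comp (1 - X)) := by
  have hs := abs_sepMoment_le hc (saddleRate_pos c) (saddleRate_sq_add c)
  have hF := (hh.taylorQuotient_sub_isBigO hc).trans
    (pow_isBigO_pow_of_le (show 2 * m + 1 ≤ 22 by omega))
  have hev : ∀ P : ℝ[X], ∀ w, (P.comp (1 - X)).eval w = P.eval (1 - w) := fun P w => by
    rw [eval_comp]; simp
  have hne : (q.comp (1 - X)).eval 0 ≠ 0 → ∀ᶠ w in 𝓝[≠] (0 : ℝ), (q.comp (1 - X)).eval w ≠ 0 :=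
    fun h0 => nhdsWithin_le_nhds ((q.comp (1 - X)).continuous.continuousAt.eventually_ne h0)
  constructor
  · rintro ⟨hp, hq, hq1, hO⟩
    have hq0 : (q.comp (1 - X)).eval 0 ≠ 0 := by rwa [hev, sub_zero]
    refine IsMomentPade.of_isBigO hs (by rwa [natDegree_comp_one_sub])
      (by rwa [natDegree_comp_one_sub]) hq0 ?_
    have h1 : (fun w => taylorQuotient c h (1 - w) - p.eval (1 - w) / q.eval (1 - w))
        =O[𝓝[≠] (0 : ℝ)] fun w => w ^ (2 * m + 1) := by
      refine (hO.comp_tendsto tendsto_one_sub).trans (isBigO_of_le _ fun w => ?_)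
      simp [two_mul]
    have h2 : (fun w => (q.comp (1 - X)).eval w) =O[𝓝[≠] (0 : ℝ)] fun _ => (1 : ℝ) :=
      (((q.comp (1 - X)).continuous.tendsto 0).mono_left nhdsWithin_le_nhds).isBigO_one ℝ
    have h3 := h2.mul (h1.sub hF)
    simp only [one_mul] at h3
    refine h3.congr' ?_ EventuallyEq.rfl
    filter_upwards [hne hq0] with w hw
    rw [hev] at hw
    rw [hev, hev]
    field_simp
    ring
  · intro hP
    have hq0 : (q.comp (1 - X)).eval 0 ≠ 0 := by
      rw [← coeff_zero_eq_eval_zero]; exact hP.coeff_zero_ne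
    have hdp := hP.natDegree_num_le
    have hdq := hP.natDegree_le
    rw [natDegree_comp_one_sub] at hdp hdq
    refine ⟨hdp, hdq, by rwa [hev, sub_zero] at hq0, ?_⟩
    have h2 : (fun w => ((q.comp (1 - X)).eval w)⁻¹) =O[𝓝[≠] (0 : ℝ)] fun _ => (1 : ℝ) :=
      ((((q.comp (1 - X)).continuous.tendsto 0).inv₀ hq0).mono_left
        nhdsWithin_le_nhds).isBigO_one ℝ
    have h3 := h2.mul (hP.isBigO hs)
    simp only [one_mul] at h3
    have h4 : (fun w => taylorQuotient c h (1 - w) - p.eval (1 - w) / q.eval (1 - w))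
        =O[𝓝[≠] (0 : ℝ)] fun w => w ^ (2 * m + 1) := by
      refine (hF.add h3).congr' ?_ EventuallyEq.rfl
      filter_upwards [hne hq0] with w hw
      rw [hev] at hw
      rw [hev, hev]
      field_simp
      ring
    refine ((h4.comp_tendsto tendsto_one_sub').congr_left fun x => ?_).trans
      (isBigO_of_le _ fun x => ?_)
    · simp
    · simp only [Function.comp_apply, norm_pow, Real.norm_eq_abs]
      rw [abs_sub_comm, two_mul]

end Transfer

/-! ### The chain of inequalities -/

section Chain

variable {c : ℝ} {h : ℝ → ℝ}

theorem natDegree_boundNumerator (c : ℝ) {p : ℝ[X]} (hp : p ≠ 0) :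
    (boundNumerator c p).natDegree = p.natDegree + 2 := by
  have h1 : C (saddleRate c) ≠ 0 := C_ne_zero.2 (saddleRate_pos c).ne'
  have h2 : (X - 1 : ℝ[X]) ≠ 0 := X_sub_C_ne_zero (1 : ℝ)
  have h3 : (X - 1 : ℝ[X]).natDegree = 1 := natDegree_X_sub_C (1 : ℝ)
  rw [boundNumerator, natDegree_mul (mul_ne_zero (mul_ne_zero h1 X_ne_zero) h2) hp,
    natDegree_mul (mul_ne_zero h1 X_ne_zero) h2, natDegree_mul h1 X_ne_zero, natDegree_C,
    natDegree_X, h3]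
  ring

theorem isCoprime_X_sub_C_of_eval_ne_zero {q : ℝ[X]} {a : ℝ} (h : q.eval a ≠ 0) :
    IsCoprime (X - C a) q :=
  (irreducible_X_sub_C a).coprime_iff_not_dvd.2 fun hd => h (dvd_iff_isRoot.1 hd)

theorem isCoprime_boundNumerator (c : ℝ) {p q : ℝ[X]} (hpq : IsCoprime p q)
    (h0 : q.eval 0 ≠ 0) (h1 : q.eval 1 ≠ 0) : IsCoprime (boundNumerator c p) q := by
  have hC : IsCoprime (C (saddleRate c)) q :=
    isCoprime_one_left.of_isCoprime_of_dvd_left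
      (isUnit_C.2 (saddleRate_pos c).ne'.isUnit).dvd
  have hX := isCoprime_X_sub_C_of_eval_ne_zero h0
  rw [C_0, sub_zero] at hX
  have hX1 := isCoprime_X_sub_C_of_eval_ne_zero h1
  rw [C_1] at hX1
  exact ((hC.mul_left hX).mul_left hX1).mul_left hpq

theorem isCoprime_of_comp_one_sub {p q : ℝ[X]}
    (h : IsCoprime (p.comp (1 - X)) (q.comp (1 - X))) : IsCoprime p q := by
  have := h.map (compRingHom (1 - X : ℝ[X]))
  simpa only [coe_compRingHom_apply, comp_one_sub_comp_one_sub] using this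

theorem eval_comp_one_sub (P : ℝ[X]) (u : ℝ) : (P.comp (1 - X)).eval (1 - u) = P.eval u := by
  rw [eval_comp]; simp

theorem rationalBound_eq (c : ℝ) (p q : ℝ[X]) (u : ℝ) :
    rationalBound c p q u = saddleRate c * u * (u - 1) *
      ((p.comp (1 - X)).eval (1 - u) / (q.comp (1 - X)).eval (1 - u)) := by
  rw [eval_comp_one_sub, eval_comp_one_sub, rationalBound, boundNumerator]
  simp only [eval_mul, eval_C, eval_X, eval_sub, eval_one]
  ring

theorem IsGraphFunction.eq_mul_momentSeries (hc : 2 ≤ c) (hh : IsGraphFunction c h) {u : ℝ}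
    (hu : u ∈ Ioo (0 : ℝ) 1) : h u = saddleRate c * u * (u - 1) *
      momentSeries (sepMoment c (saddleRate c)) (1 - u) 1 := by
  have hw : |1 - u| < 1 := by rw [abs_lt]; constructor <;> linarith [hu.1, hu.2]
  rw [hh.eq_sepFun hc (saddleRate_pos c) (saddleRate_sq_add c) (Ioo_subset_Ioc_self hu),
    sepFun_eq_mul_momentSeries hc (saddleRate_pos c) (saddleRate_sq_add c) hw]
  ring

theorem IsGraphFunction.separatrixTaylor_lt_succ (hc : 2 ≤ c) (hh : IsGraphFunction c h) {n : ℕ}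
    (hn : 1 ≤ n) {u : ℝ} (hu : u < 1) : separatrixTaylor h n u < separatrixTaylor h (n + 1) u := by
  obtain ⟨k, rfl⟩ := Nat.exists_eq_add_of_le' hn
  have hr := saddleRate_pos c
  rw [hh.separatrixTaylor_succ hc hr (saddleRate_sq_add c),
    hh.separatrixTaylor_succ hc hr (saddleRate_sq_add c), Finset.sum_range_succ, ← add_assoc]
  exact lt_add_of_pos_right _
    (mul_pos (sepCoeff_pos (by linarith) hr k) (pow_pos (sub_pos.2 hu) _))

theorem IsGraphFunction.separatrixTaylor_lt (hc : 2 ≤ c) (hh : IsGraphFunction c h) {n : ℕ}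
    (hn : 1 ≤ n) {u : ℝ} (hu : u ∈ Ioo (0 : ℝ) 1) : separatrixTaylor h n u < h u := by
  obtain ⟨k, rfl⟩ := Nat.exists_eq_add_of_le' hn
  have hr := saddleRate_pos c
  have hcr := saddleRate_sq_add c
  have hpos := sepCoeff_pos (show 0 < c by linarith) hr
  have hw : 0 < 1 - u := sub_pos.2 hu.2
  have hsum := summable_sepCoeff hc hr hcr hw.le (by linarith [hu.1])
  have hlt : ∑ j ∈ Finset.range k, sepCoeff c (saddleRate c) j * (1 - u) ^ j <
      ∑' j, sepCoeff c (saddleRate c) j * (1 - u) ^ j :=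
    (Finset.sum_lt_sum_of_subset (Finset.range_mono k.le_succ) (Finset.self_mem_range_succ k)
      Finset.notMem_range_self (mul_pos (hpos k) (pow_pos hw k))
      fun j _ _ => mul_nonneg (hpos j).le (pow_nonneg hw.le j)).trans_le
      (hsum.sum_le_tsum _ fun j _ => mul_nonneg (hpos j).le (pow_nonneg hw.le j))
  have h1 := mul_lt_mul_of_pos_left hlt (pow_pos hw 2)
  rw [Finset.mul_sum] at h1
  have h2 : ∀ j ∈ Finset.range k, sepCoeff c (saddleRate c) j * (1 - u) ^ (j + 2) =
      (1 - u) ^ 2 * (sepCoeff c (saddleRate c) j * (1 - u) ^ j) := fun j _ => by ring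
  rw [hh.separatrixTaylor_succ hc hr hcr, hh.eq_sepFun hc hr hcr (Ioo_subset_Ioc_self hu), sepFun,
    sepSeries, Finset.sum_congr rfl h2]
  simp only [RCLike.ofReal_real_eq_id, id_eq]
  linarith

end Chain

theorem theorem1p2 (c : ℝ) (hc : 2 ≤ c) (h : ℝ → ℝ) (hh : IsHeteroclinicGraph c h) :
    -- the separatrix is analytic at the saddle, so that its Taylor polynomials are meaningful
    AnalyticWithinAt ℝ h (Icc (0 : ℝ) 1) 1 ∧
    -- the Padé approximants of order `(m, m)` exist for `1 ≤ m ≤ 10`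
    (∀ m : ℕ, 1 ≤ m → m ≤ 10 →
      ∃ p q : ℝ[X], IsPadeApproximant (taylorQuotient c h) 1 m m p q) ∧
    ∀ p q : ℕ → ℝ[X],
      (∀ m : ℕ, 1 ≤ m → m ≤ 10 →
        IsPadeApproximant (taylorQuotient c h) 1 m m (p m) (q m)) →
      -- degrees, lowest terms, and absence of poles on `[0, 1]`
      (∀ m : ℕ, 1 ≤ m → m ≤ 10 →
        (boundNumerator c (p m)).natDegree = m + 2 ∧ (q m).natDegree = m ∧
        IsCoprime (boundNumerator c (p m)) (q m) ∧
        ∀ u ∈ Icc (0 : ℝ) 1, (q m).eval u ≠ 0) ∧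
      -- the chain of inequalities
      ∀ u ∈ Ioo (0 : ℝ) 1,
        (∀ n : ℕ, 2 ≤ n → n < 100 → separatrixTaylor h n u < separatrixTaylor h (n + 1) u) ∧
        separatrixTaylor h 100 u < h u ∧
        h u < rationalBound c (p 10) (q 10) u ∧
        (∀ m : ℕ, 1 ≤ m → m < 10 →
          rationalBound c (p (m + 1)) (q (m + 1)) u < rationalBound c (p m) (q m) u) := by
  have hg := hh.isGraphFunction
  have hr := saddleRate_pos c
  have hcr := saddleRate_sq_add c
  have hs := abs_sepMoment_le hc hr hcr
  have hpos := isPosMoment_sepMoment hc hr hcr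
  refine ⟨hg.analyticWithinAt hc hr hcr, fun m _ hm => ?_, fun p q hpq => ?_⟩
  · obtain ⟨P, Q, hPQ⟩ := exists_isMomentPade hpos m
    refine ⟨P.comp (1 - X), Q.comp (1 - X), (hg.isPadeApproximant_iff hc hm).2 ?_⟩
    rwa [comp_one_sub_comp_one_sub, comp_one_sub_comp_one_sub]
  have hM : ∀ m, 1 ≤ m → m ≤ 10 → IsMomentPade (sepMoment c (saddleRate c)) m
      ((p m).comp (1 - X)) ((q m).comp (1 - X)) := fun m hm1 hm =>
    (hg.isPadeApproximant_iff hc hm).1 (hpq m hm1 hm)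
  refine ⟨fun m hm1 hm => ?_, fun u hu => ⟨fun n hn _ => hg.separatrixTaylor_lt_succ hc
    (by omega) hu.2, hg.separatrixTaylor_lt hc (by norm_num) hu, ?_, fun m hm1 hm => ?_⟩⟩
  · have hP := hM m hm1 hm
    have hdp := hP.natDegree_num hpos
    have hdq := hP.natDegree_eq hpos
    rw [natDegree_comp_one_sub] at hdp hdq
    have hp0 : p m ≠ 0 := fun h0 => by rw [h0, natDegree_zero] at hdp; omega
    have hne : ∀ u ∈ Icc (0 : ℝ) 1, (q m).eval u ≠ 0 := fun u hu => by
      rw [← eval_comp_one_sub]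
      exact hP.eval_ne_zero hpos ⟨by linarith [hu.2], by linarith [hu.1]⟩
    exact ⟨by rw [natDegree_boundNumerator c hp0, hdp], hdq,
      isCoprime_boundNumerator c (isCoprime_of_comp_one_sub (hP.isCoprime hpos hs))
        (hne 0 (left_mem_Icc.2 zero_le_one)) (hne 1 (right_mem_Icc.2 zero_le_one)), hne⟩
  all_goals
    have hw : 1 - u ∈ Ioo (0 : ℝ) 1 := ⟨by linarith [hu.2], by linarith [hu.1]⟩
    -- the common factor `r u (u - 1)` is negative, so the bounds for the quotient are reversed
    have hneg : saddleRate c * u * (u - 1) < 0 :=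
      mul_neg_of_pos_of_neg (mul_pos hr hu.1) (by linarith [hu.2])
  · rw [rationalBound_eq, hg.eq_mul_momentSeries hc hu]
    exact mul_lt_mul_of_neg_left ((hM 10 (by norm_num) le_rfl).eval_div_lt hpos hs hw) hneg
  · rw [rationalBound_eq, rationalBound_eq]
    exact mul_lt_mul_of_neg_left ((hM m hm1 hm.le).eval_div_lt_succ hpos hs
      (hM (m + 1) (by omega) hm) hw) hneg
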